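/- Let $n,k\in\mathbb N$ and $0\le\rho<1$. All symbols are families of smooth functions $\mathbb R^{2n}\to\mathbb C$ depending on a parameter $h\in(0,1]$. Write $a\in S_{(k)}$ if $|\partial^\alpha a|\le C_\alpha$ on $\mathbb R^{2n}$ for all $|\alpha|\ge k$, and $b\in S^{L^1}_\rho$ if $h^{-n}\|\partial^\alpha b\|_{L^1(\mathbb R^{2n})}\le C_\alpha h^{-\rho|\alpha|}$ for all $\alpha$, with constants $C_\alpha$ independent of $h$. For $a\in\mathscr S'(\mathbb R^{2n})$ let $\mathrm{Op}_h^{\mathrm w}(a):\mathscr S(\mathbb R^n)\to\mathscr S'(\mathbb R^n)$ be the Weyl quantization $$\mathrm{Op}^{\mathrm w}_h(a)u(x)=\frac1{(2\pi h)^n}\iint a\Big(\frac{x+y}2,\xi\Big)e^{\frac ih\langle x-y,\xi\rangle}u(y)\,dy\,d\xi$$ (understood weakly), let $D=\frac1i\partial$ and $\sigma(x,\xi,y,\eta)=\langle\xi,y\rangle-\langle x,\eta\rangle$. Let $a\in S_{(k)}$ and $b\in S^{L^1}_\rho$. Then, for every $h\in(0,1]$, $a$ and $b$ are of temperate growth (hence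 are tempered distributions) and $\mathrm{Op}_h^{\mathrm w}(b)$ maps $\mathscr S(\mathbb R^n)$ into itself, and there is a family $c=c(h)\in\mathscr S'(\mathbb R^{2n})$, $h\in(0,1]$, such that $$\mathrm{Op}_h^{\mathrm w}(a)\,\mathrm{Op}_h^{\mathrm w}(b)=\mathrm{Op}_h^{\mathrm w}(c)\quad\text{on }\mathscr S(\mathbb R^n),$$ and for every integer $N\ge k$ $$c(x,\xi)-\sum_{j=0}^{N-1}\frac1{j!}\Big(\frac{ih}{2}\,\sigma(D_x,D_\xi,D_y,D_\eta)\Big)^j a(x,\xi)\,b(y,\eta)\Big|_{y=x,\ \eta=\xi}\ \in\ h^{N(1-\rho)}S^{L^1}_\rho ,$$ i.e. the difference equals $h^{N(1-\rho)}e_N$ for some $e_N\in S^{L^1}_\rho$. -/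

import Mathlib

open MeasureTheory SchwartzMap FourierTransform
open scoped RealInnerProductSpace ContDiff

noncomputable section

namespace Weyl

section PartialFourier

set_option linter.unusedSectionVars false

/-- A continuous seminorm on Schwartz space that dominates `(1 + ‖p‖) ^ k * ‖D ^ l F p‖`. -/
def domSeminorm (D V : Type) [NormedAddCommGroup D] [NormedSpace ℝ D] [NormedAddCommGroup V]
    [NormedSpace ℂ V] (k l : ℕ) : Seminorm ℂ 𝓢(D, V) :=
  ((2 : NNReal) ^ k) • (Finset.Iic (k, l)).sup (schwartzSeminormFamily ℂ D V)

theorem continuous_domSeminorm (D V : Type) [NormedAddCommGroup D] [NormedSpace ℝ D]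
    [NormedAddCommGroup V] [NormedSpace ℂ V] (k l : ℕ) :
    Continuous (domSeminorm D V k l) := by
  have h : Continuous ⇑((Finset.Iic (k, l)).sup
      (schwartzSeminormFamily ℂ D V : ℕ × ℕ → Seminorm ℂ 𝓢(D, V))) :=
    Seminorm.continuous_finsetSup fun i _ => (schwartz_withSeminorms ℂ D V).continuous_seminorm i
  exact h.const_smul ((2 : NNReal) ^ k)

theorem le_domSeminorm {D V : Type} [NormedAddCommGroup D] [NormedSpace ℝ D]
    [NormedAddCommGroup V] [NormedSpace ℂ V] (k l : ℕ)
    (F : 𝓢(D, V)) (p : D) :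
    (1 + ‖p‖) ^ k * ‖iteratedFDeriv ℝ l F p‖ ≤ domSeminorm D V k l F := by
  have := one_add_le_sup_seminorm_apply (𝕜 := ℂ) (m := (k, l)) (k := k) (n := l) le_rfl le_rfl F p
  simpa [domSeminorm, NNReal.smul_def, schwartzSeminormFamily] using! this

variable {E : Type} [NormedAddCommGroup E] [InnerProductSpace ℝ E] [FiniteDimensional ℝ E]
  [MeasurableSpace E] [BorelSpace E]
variable {V : Type} [NormedAddCommGroup V] [NormedSpace ℂ V]

/-- The Fourier transform in the second variable. -/
def pFT (F : E × E → V) (p : E × E) : V :=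
  ∫ s : E, Real.fourierChar (-⟪s, p.2⟫) • F (p.1, s)

/-- An integrable weight. -/
def wt (s : E) : ℝ := ((1 + ‖s‖) ^ (Module.finrank ℝ E + 1))⁻¹

theorem wt_nonneg (s : E) : 0 ≤ wt s := by unfold wt; positivity

theorem integrable_wt : Integrable (wt : E → ℝ) := by
  have := integrable_one_add_norm (E := E) (μ := volume) (r := (Module.finrank ℝ E + 1 : ℕ))
    (by push_cast; linarith)
  refine this.congr (Filter.Eventually.of_forall fun s => ?_)
  simp only [wt]
  rw [Real.rpow_neg (by positivity), Real.rpow_natCast]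

theorem bound_wt (k l : ℕ) (F : 𝓢(E × E, V)) (X s : E) :
    (1 + ‖(X, s)‖) ^ k * ‖iteratedFDeriv ℝ l F (X, s)‖ ≤
      wt s * domSeminorm (E × E) V (k + (Module.finrank ℝ E + 1)) l F := by
  have h := le_domSeminorm (k + (Module.finrank ℝ E + 1)) l F (X, s)
  rw [pow_add] at h
  have h1 : (1 + ‖s‖) ^ (Module.finrank ℝ E + 1) ≤
      (1 + ‖(X, s)‖) ^ (Module.finrank ℝ E + 1) := by
    gcongr; exact le_max_right _ _
  have h2 : (0 : ℝ) < (1 + ‖s‖) ^ (Module.finrank ℝ E + 1) := by positivity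
  unfold wt
  rw [← div_eq_inv_mul, le_div_iff₀ h2]
  refine le_trans ?_ h
  calc _ ≤ (1 + ‖(X, s)‖) ^ k * ‖iteratedFDeriv ℝ l F (X, s)‖ *
        (1 + ‖(X, s)‖) ^ (Module.finrank ℝ E + 1) := by gcongr
    _ = _ := by ring

theorem norm_iteratedFDeriv_slice (l : ℕ) (F : 𝓢(E × E, V)) (X s : E) :
    ‖iteratedFDeriv ℝ l (fun t => F (X, t)) s‖ ≤ ‖iteratedFDeriv ℝ l F (X, s)‖ := by
  let G : E × E → V := fun z => F ((X, 0) + z)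
  have hG : ContDiff ℝ ∞ G := (F.smooth ⊤).comp (contDiff_const.add contDiff_id)
  have e : (fun t => F (X, t)) = G ∘ (ContinuousLinearMap.inr ℝ E E) := by
    ext t; simp [G]
  rw [e, ContinuousLinearMap.iteratedFDeriv_comp_right _ hG _ (by exact_mod_cast le_top)]
  refine (ContinuousMultilinearMap.norm_compContinuousLinearMap_le _ _).trans ?_
  have h1 : ‖ContinuousLinearMap.inr ℝ E E‖ ≤ 1 :=
    ContinuousLinearMap.opNorm_le_bound _ zero_le_one fun t => by simp
  have h2 : ∏ _i : Fin l, ‖ContinuousLinearMap.inr ℝ E E‖ ≤ 1 :=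
    Finset.prod_le_one (fun _ _ => by positivity) fun _ _ => h1
  have h3 : iteratedFDeriv ℝ l G (ContinuousLinearMap.inr ℝ E E s) =
      iteratedFDeriv ℝ l F (X, s) := by
    simp only [G]
    rw [iteratedFDeriv_comp_add_left]
    simp
  rw [h3]
  exact mul_le_of_le_one_right (norm_nonneg _) h2

theorem integrable_slice (F : 𝓢(E × E, V)) (p : E × E) :
    Integrable (fun s : E => Real.fourierChar (-⟪s, p.2⟫) • F (p.1, s)) := by
  refine Integrable.mono' ((integrable_wt (E := E)).mul_const
    (domSeminorm (E × E) V (0 + (Module.finrank ℝ E + 1)) 0 F)) ?_ ?_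
  · apply Continuous.aestronglyMeasurable
    have := F.continuous
    have h2 := Real.continuous_fourierChar
    fun_prop
  · refine Filter.Eventually.of_forall fun s => ?_
    simpa using bound_wt 0 0 F p.1 s

theorem pFT_decay (k : ℕ) : ∃ q : Seminorm ℂ 𝓢(E × E, V), Continuous q ∧
    ∀ (F : 𝓢(E × E, V)) (p : E × E), ‖p‖ ^ k * ‖pFT F p‖ ≤ q F := by
  let J : NNReal := ⟨∫ s : E, wt s, integral_nonneg wt_nonneg⟩
  let d := Module.finrank ℝ E + 1
  let q1 : Seminorm ℂ 𝓢(E × E, V) := J • domSeminorm (E × E) V (k + d) 0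
  let q2 : Seminorm ℂ 𝓢(E × E, V) :=
    (2 ^ k * J) • ∑ j ∈ Finset.range (k + 1), domSeminorm (E × E) V (0 + d) j
  have hJ : (J : ℝ) = ∫ s : E, wt s := rfl
  have hq2 : ∀ F, q2 F =
      (2 ^ k * J) * ∑ j ∈ Finset.range (k + 1), domSeminorm (E × E) V (0 + d) j F := by
    intro F
    have : ∀ t : Finset ℕ, (∑ j ∈ t, domSeminorm (E × E) V (0 + d) j) F =
        ∑ j ∈ t, domSeminorm (E × E) V (0 + d) j F := by
      intro t
      induction t using Finset.induction_on with
      | empty => simp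
      | insert a t ha ih => rw [Finset.sum_insert ha, Finset.sum_insert ha, ← ih]; rfl
    change ((2 ^ k * J : NNReal) : ℝ) * _ = _
    rw [this]
    push_cast
    rfl
  refine ⟨q1 + q2, ?_, fun F p => ?_⟩
  · refine Continuous.add ?_ ?_
    · exact (continuous_domSeminorm (E × E) V (k + d) 0).const_smul J
    · have : ⇑q2 = fun F => (2 ^ k * J : ℝ) *
          ∑ j ∈ Finset.range (k + 1), domSeminorm (E × E) V (0 + d) j F := funext hq2
      rw [this]
      exact continuous_const.mul
        (continuous_finsetSum _ fun j _ => continuous_domSeminorm (E × E) V (0 + d) j)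
  · have hX : ‖p.1‖ ^ k * ‖pFT F p‖ ≤ q1 F := by
      calc ‖p.1‖ ^ k * ‖pFT F p‖ ≤ ‖p.1‖ ^ k * ∫ s, ‖F (p.1, s)‖ := by
            gcongr
            refine (norm_integral_le_integral_norm _).trans (le_of_eq ?_)
            simp
        _ = ∫ s, ‖p.1‖ ^ k * ‖F (p.1, s)‖ := (integral_const_mul _ _).symm
        _ ≤ ∫ s, wt s * domSeminorm (E × E) V (k + d) 0 F := by
            refine integral_mono_of_nonneg (Filter.Eventually.of_forall fun s => by positivity)
              (integrable_wt.mul_const _) (Filter.Eventually.of_forall fun s => ?_)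
            refine le_trans ?_ (bound_wt k 0 F p.1 s)
            simp only [norm_iteratedFDeriv_zero]
            gcongr
            have : ‖p.1‖ ≤ ‖(p.1, s)‖ := le_max_left _ _
            linarith
        _ = q1 F := by rw [integral_mul_const]; rfl
    have hb : ∀ i j (s : E), ‖s‖ ^ i * ‖iteratedFDeriv ℝ j (fun t => F (p.1, t)) s‖ ≤
        wt s * domSeminorm (E × E) V (i + d) j F := by
      intro i j s
      refine le_trans ?_ (bound_wt i j F p.1 s)
      have h1 := norm_iteratedFDeriv_slice j F p.1 s
      have : ‖s‖ ≤ ‖(p.1, s)‖ := le_max_right _ _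
      gcongr
      linarith
    have hsm : ContDiff ℝ ∞ (fun t => F (p.1, t)) :=
      (F.smooth ⊤).comp (contDiff_const.prodMk contDiff_id)
    have hξ : ‖p.2‖ ^ k * ‖pFT F p‖ ≤ q2 F := by
      have key := Real.pow_mul_norm_iteratedFDeriv_fourier_le (V := E) (K := 0) (N := ⊤)
        (f := fun t => F (p.1, t)) hsm
        (fun i j _ _ => Integrable.mono' ((integrable_wt (E := E)).mul_const
          (domSeminorm (E × E) V (i + d) j F))
          (by
            apply Continuous.aestronglyMeasurable
            have := hsm.continuous_iteratedFDeriv (m := j) (by exact_mod_cast le_top)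
            fun_prop)
          (Filter.Eventually.of_forall fun s => by
            rw [Real.norm_of_nonneg (by positivity)]; exact hb i j s))
        (k := 0) (n := k) (by simp) (by exact_mod_cast le_top) p.2
      rw [norm_iteratedFDeriv_zero] at key
      refine key.trans ?_
      rw [hq2]
      simp only [pow_zero, one_mul, Nat.cast_zero, mul_zero, zero_add, Finset.range_one,
        Finset.singleton_product, Finset.sum_map, Function.Embedding.coeFn_mk]
      rw [mul_assoc]
      refine mul_le_mul_of_nonneg_left ?_ (by positivity)
      rw [Finset.mul_sum]
      apply Finset.sum_le_sum
      intro j _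
      calc _ ≤ ∫ s, wt s * domSeminorm (E × E) V (0 + d) j F := by
            refine integral_mono_of_nonneg (Filter.Eventually.of_forall fun s => by positivity)
              (integrable_wt.mul_const _) (Filter.Eventually.of_forall fun s => ?_)
            simpa using hb 0 j s
        _ = J * domSeminorm (E × E) V d j F := by rw [integral_mul_const, hJ, zero_add]
    have hp : ‖p‖ ^ k ≤ ‖p.1‖ ^ k + ‖p.2‖ ^ k := by
      rcases max_choice ‖p.1‖ ‖p.2‖ with h | h <;> rw [Prod.norm_def, h]
      · have : 0 ≤ ‖p.2‖ ^ k := by positivity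
        linarith
      · have : 0 ≤ ‖p.1‖ ^ k := by positivity
        linarith
    calc _ ≤ (‖p.1‖ ^ k + ‖p.2‖ ^ k) * ‖pFT F p‖ := by gcongr
      _ ≤ q1 F + q2 F := by rw [add_mul]; exact add_le_add hX hξ

/-- The bilinear form `(p, q) ↦ ⟪p.2, q.2⟫`. -/
def sndInner (E : Type) [NormedAddCommGroup E] [InnerProductSpace ℝ E] :
    E × E →L[ℝ] E × E →L[ℝ] ℝ :=
  (innerSL ℝ).bilinearComp (ContinuousLinearMap.snd ℝ E E) (ContinuousLinearMap.snd ℝ E E)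

/-- The map `A ↦ A ∘ (p ↦ (p.1, 0))`. -/
def precompFst (E V : Type) [NormedAddCommGroup E] [InnerProductSpace ℝ E] [NormedAddCommGroup V]
    [NormedSpace ℂ V] : (E × E →L[ℝ] V) →L[ℂ] (E × E →L[ℝ] V) :=
  { toFun := fun A =>
      A.comp ((ContinuousLinearMap.inl ℝ E E).comp (ContinuousLinearMap.fst ℝ E E))
    map_add' := fun _ _ => rfl
    map_smul' := fun _ _ => rfl
    cont := (ContinuousLinearMap.precomp V
      ((ContinuousLinearMap.inl ℝ E E).comp (ContinuousLinearMap.fst ℝ E E))).continuous }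

/-- The Schwartz function whose partial Fourier transform is the derivative of `pFT F`. -/
def pFTDeriv (E V : Type) [NormedAddCommGroup E] [InnerProductSpace ℝ E] [NormedAddCommGroup V]
    [NormedSpace ℂ V] : 𝓢(E × E, V) →L[ℂ] 𝓢(E × E, E × E →L[ℝ] V) :=
  (postcompCLM (precompFst E V)).comp
      (fderivCLM ℂ (E × E) V)
  + (-2 * Real.pi * Complex.I) • smulRightCLM ℂ V (sndInner E)

theorem pFTDeriv_apply (F : 𝓢(E × E, V)) (x v : E × E) :
    pFTDeriv E V F x v = fderiv ℝ F x (v.1, 0) +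
      (-2 * Real.pi * Complex.I * (⟪x.2, v.2⟫ : ℝ) : ℂ) • F x := by
  rw [mul_smul, Complex.coe_smul]
  rfl

theorem norm_circle_smul (z : Circle) (v : V) : ‖z • v‖ = ‖v‖ := by simp

theorem hasFDerivAt_pFT (F : 𝓢(E × E, V)) (p : E × E) :
    HasFDerivAt (pFT F) (pFT (pFTDeriv E V F) p) p := by
  let G := pFTDeriv E V F
  have hG1 := (integrable_slice (V := E × E →L[ℝ] V) G p).aestronglyMeasurable
  have hb : ∀ (p : E × E) (s : E), ‖Real.fourierChar (-⟪s, p.2⟫) • G (p.1, s)‖ ≤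
      wt s * domSeminorm (E × E) (E × E →L[ℝ] V) (0 + (Module.finrank ℝ E + 1)) 0 G := by
    intro p s
    have h := bound_wt (V := E × E →L[ℝ] V) 0 0 G p.1 s
    rw [pow_zero, one_mul, norm_iteratedFDeriv_zero] at h
    exact (norm_circle_smul (V := E × E →L[ℝ] V) _ _).trans_le h
  have hd : ∀ (p : E × E) (s : E), HasFDerivAt
      (fun p : E × E => Real.fourierChar (-⟪s, p.2⟫) • F (p.1, s))
      (Real.fourierChar (-⟪s, p.2⟫) • G (p.1, s)) p := by
    intro p s
    have h1 : HasFDerivAt (fun p : E × E => ((Real.fourierChar (-⟪s, p.2⟫) : Circle) : ℂ))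
        (((-2 * Real.pi * Complex.I * Real.fourierChar (-⟪s, p.2⟫)) •
          (Complex.ofRealCLM ∘L (innerSL ℝ s))).comp (ContinuousLinearMap.snd ℝ E E)) p :=
      HasFDerivAt.comp (g := fun w : E => ((Real.fourierChar (-⟪s, w⟫) : Circle) : ℂ)) p
        (Real.hasFDerivAt_fourierChar_neg_bilinear_right (innerSL ℝ) s p.2) hasFDerivAt_snd
    have h2 : HasFDerivAt (fun p : E × E => F (p.1, s))
        ((fderiv ℝ F (p.1, s)).comp
          ((ContinuousLinearMap.inl ℝ E E).comp (ContinuousLinearMap.fst ℝ E E))) p := by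
      refine HasFDerivAt.comp (g := F) p (F.hasFDerivAt (p.1, s)) ?_
      have := (hasFDerivAt_fst (𝕜 := ℝ) (p := p)).prodMk (hasFDerivAt_const s p)
      convert! this using 1
    have h3 := h1.smul h2
    refine HasFDerivAt.congr_fderiv h3 ?_
    refine ContinuousLinearMap.ext fun v => ?_
    change _ = ((Real.fourierChar (-⟪s, p.2⟫) : Circle) : ℂ) • (G (p.1, s) v)
    rw [pFTDeriv_apply]
    simp [smul_smul]
    congr 1
    ring
  change HasFDerivAt (fun p : E × E => ∫ s : E, Real.fourierChar (-⟪s, p.2⟫) • F (p.1, s))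
    (∫ s : E, Real.fourierChar (-⟪s, p.2⟫) • G (p.1, s)) p
  exact hasFDerivAt_integral_of_dominated_of_fderiv_le (s := Set.univ) Filter.univ_mem
    (Filter.Eventually.of_forall fun p => (integrable_slice F p).aestronglyMeasurable)
    (integrable_slice F p) hG1
    (Filter.Eventually.of_forall fun s p _ => hb p s) (integrable_wt.mul_const _)
    (Filter.Eventually.of_forall fun s p _ => hd p s)

theorem contDiff_pFT (m : ℕ) : ∀ (V : Type) [NormedAddCommGroup V] [NormedSpace ℂ V]
    (F : 𝓢(E × E, V)), ContDiff ℝ m (pFT F) := by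
  induction m with
  | zero =>
    intro V _ _ F
    exact contDiff_zero.2 (continuous_iff_continuousAt.2 fun p => (hasFDerivAt_pFT F p).continuousAt)
  | succ m ih =>
    intro V _ _ F
    rw [show ((m + 1 : ℕ) : WithTop ℕ∞) = (m : WithTop ℕ∞) + 1 by norm_cast,
      contDiff_succ_iff_hasFDerivAt]
    exact ⟨_, ih _ (pFTDeriv E V F), hasFDerivAt_pFT F⟩

theorem pFT_bound (l : ℕ) : ∀ (V : Type) [NormedAddCommGroup V] [NormedSpace ℂ V] (k : ℕ),
    ∃ q : Seminorm ℂ 𝓢(E × E, V), Continuous q ∧ ∀ (F : 𝓢(E × E, V)) (p : E × E),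
      ‖p‖ ^ k * ‖iteratedFDeriv ℝ l (pFT F) p‖ ≤ q F := by
  induction l with
  | zero =>
    intro V _ _ k
    simpa using pFT_decay k
  | succ l ih =>
    intro V _ _ k
    obtain ⟨q, hq, h⟩ := ih (E × E →L[ℝ] V) k
    refine ⟨q.comp (pFTDeriv E V).toLinearMap, by exact hq.comp (pFTDeriv E V).continuous, fun F p => ?_⟩
    have e : fderiv ℝ (pFT F) = pFT (pFTDeriv E V F) :=
      funext fun p => (hasFDerivAt_pFT F p).fderiv
    rw [← norm_iteratedFDeriv_fderiv, e]
    exact h _ p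

theorem pFT_add (F G : 𝓢(E × E, ℂ)) (p : E × E) : pFT (F + G) p = pFT F p + pFT G p := by
  have hF := integrable_slice F p
  have hG := integrable_slice G p
  simp only [pFT]
  rw [← integral_add hF hG]
  exact integral_congr_ae (Filter.Eventually.of_forall fun s => smul_add _ _ _)

variable (E) in
/-- The Fourier transform in the second variable, as an operator on Schwartz space. -/
def partialFourierCLM : 𝓢(E × E, ℂ) →L[ℂ] 𝓢(E × E, ℂ) :=
  mkCLM (fun F => pFT F)
    pFT_add
    (fun c F p => by
      simp only [pFT, smul_apply, RingHom.id_apply]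
      rw [← integral_smul]
      exact integral_congr_ae (Filter.Eventually.of_forall fun s => smul_comm _ _ _))
    (fun F => contDiff_infty.2 fun m => contDiff_pFT m ℂ F)
    (fun n => by
      obtain ⟨q, hq, h⟩ := pFT_bound (E := E) n.2 ℂ n.1
      obtain ⟨s, C, -, hC⟩ := Seminorm.bound_of_continuous
        (schwartz_withSeminorms ℂ (E × E) ℂ) q hq
      refine ⟨s, C, C.2, fun F p => (h F p).trans ?_⟩
      simpa [NNReal.smul_def] using! hC F)

theorem partialFourierCLM_apply (F : 𝓢(E × E, ℂ)) (p : E × E) :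
    partialFourierCLM E F p = ∫ s : E, Real.fourierChar (-⟪s, p.2⟫) • F (p.1, s) := rfl

end PartialFourier

section Tensor

variable {D D' : Type} [NormedAddCommGroup D] [NormedSpace ℝ D] [NormedAddCommGroup D']
  [NormedSpace ℝ D']

theorem norm_iteratedFDeriv_comp_le_of_norm_le_one {f : D → ℂ} (hf : ContDiff ℝ ∞ f)
    (L : D' →L[ℝ] D) (hL : ‖L‖ ≤ 1) (i : ℕ) (p : D') :
    ‖iteratedFDeriv ℝ i (fun q => f (L q)) p‖ ≤ ‖iteratedFDeriv ℝ i f (L p)‖ := by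
  have h := ContinuousLinearMap.iteratedFDeriv_comp_right L hf p
    (i := i) (by exact_mod_cast le_top)
  change ‖iteratedFDeriv ℝ i (f ∘ L) p‖ ≤ _
  rw [h]
  refine (ContinuousMultilinearMap.norm_compContinuousLinearMap_le _ _).trans ?_
  exact mul_le_of_le_one_right (norm_nonneg _)
    (Finset.prod_le_one (fun _ _ => by positivity) fun _ _ => hL)

/-- The map `v ↦ u ⊗ v`, where `(u ⊗ v) (y, x) = u y * v x`. -/
def tensorCLM (u : 𝓢(D, ℂ)) : 𝓢(D', ℂ) →L[ℂ] 𝓢(D × D', ℂ) :=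
  mkCLM (fun v p => u p.1 * v p.2)
    (fun v w p => by simp [mul_add])
    (fun c v p => by simp [mul_left_comm])
    (fun v => ((u.smooth ⊤).comp contDiff_fst).mul ((v.smooth ⊤).comp contDiff_snd))
    (fun ⟨k, l⟩ => by
      refine ⟨Finset.Iic (k, l), (∑ i ∈ Finset.range (l + 1),
        (l.choose i : ℝ) * domSeminorm D ℂ k i u) * 2 ^ k, ?_, fun v p => ?_⟩
      · refine mul_nonneg (Finset.sum_nonneg fun i _ => ?_) (by positivity)
        exact mul_nonneg (by positivity) (apply_nonneg _ _)
      have hu : ContDiff ℝ ∞ (fun p : D × D' => u p.1) := (u.smooth ⊤).comp contDiff_fst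
      have hv : ContDiff ℝ ∞ (fun p : D × D' => v p.2) := (v.smooth ⊤).comp contDiff_snd
      have hp : ‖p‖ ^ k ≤ (1 + ‖p.1‖) ^ k * (1 + ‖p.2‖) ^ k := by
        rw [← mul_pow]
        refine pow_le_pow_left₀ (norm_nonneg _) ?_ _
        have h1 := norm_nonneg p.1
        have h2 := norm_nonneg p.2
        refine (max_le ?_ ?_ : max ‖p.1‖ ‖p.2‖ ≤ _) <;> nlinarith [mul_nonneg h1 h2]
      have hi : ∀ i, (1 + ‖p.1‖) ^ k * ‖iteratedFDeriv ℝ i (fun p : D × D' => u p.1) p‖ ≤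
          domSeminorm D ℂ k i u := fun i =>
        (mul_le_mul_of_nonneg_left (norm_iteratedFDeriv_comp_le_of_norm_le_one (u.smooth ⊤)
          (ContinuousLinearMap.fst ℝ D D') (ContinuousLinearMap.norm_fst_le ℝ D D') i p)
          (by positivity)).trans (le_domSeminorm k i u p.1)
      have hj : ∀ j ≤ l, (1 + ‖p.2‖) ^ k * ‖iteratedFDeriv ℝ j (fun p : D × D' => v p.2) p‖ ≤
          2 ^ k * (Finset.Iic (k, l)).sup (schwartzSeminormFamily ℂ D' ℂ) v := fun j hj =>
        (mul_le_mul_of_nonneg_left (norm_iteratedFDeriv_comp_le_of_norm_le_one (v.smooth ⊤)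
          (ContinuousLinearMap.snd ℝ D D') (ContinuousLinearMap.norm_snd_le ℝ D D') j p)
          (by positivity)).trans
          (one_add_le_sup_seminorm_apply (𝕜 := ℂ) (m := (k, l)) le_rfl hj v p.2)
      calc ‖p‖ ^ k * ‖iteratedFDeriv ℝ l (fun p : D × D' => u p.1 * v p.2) p‖
          ≤ ((1 + ‖p.1‖) ^ k * (1 + ‖p.2‖) ^ k) * ∑ i ∈ Finset.range (l + 1), (l.choose i : ℝ) *
            ‖iteratedFDeriv ℝ i (fun p : D × D' => u p.1) p‖ *
            ‖iteratedFDeriv ℝ (l - i) (fun p : D × D' => v p.2) p‖ :=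
            mul_le_mul hp (norm_iteratedFDeriv_mul_le hu hv p (by exact_mod_cast le_top))
              (norm_nonneg _) (by positivity)
        _ = ∑ i ∈ Finset.range (l + 1), (l.choose i : ℝ) *
            ((1 + ‖p.1‖) ^ k * ‖iteratedFDeriv ℝ i (fun p : D × D' => u p.1) p‖) *
            ((1 + ‖p.2‖) ^ k * ‖iteratedFDeriv ℝ (l - i) (fun p : D × D' => v p.2) p‖) := by
            rw [Finset.mul_sum]
            exact Finset.sum_congr rfl fun i _ => by ring
        _ ≤ ∑ i ∈ Finset.range (l + 1), ((l.choose i : ℝ) * domSeminorm D ℂ k i u) *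
            (2 ^ k * (Finset.Iic (k, l)).sup (schwartzSeminormFamily ℂ D' ℂ) v) :=
            Finset.sum_le_sum fun i _ => mul_le_mul
              (mul_le_mul_of_nonneg_left (hi i) (by positivity)) (hj _ (Nat.sub_le _ _))
              (by positivity) (mul_nonneg (by positivity) (apply_nonneg _ _))
        _ = _ := by rw [← Finset.sum_mul]; ring)

end Tensor

section WeylQuantization

/-- The configuration space `ℝⁿ`. -/
abbrev Config (n : ℕ) : Type := EuclideanSpace ℝ (Fin n)

/-- The phase space `ℝⁿ × ℝⁿ`, with points `(x, ξ)`. -/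
abbrev Phase (n : ℕ) : Type := Config n × Config n

/-- The linear change of variables `(X, s) ↦ (X - s / 2, X + s / 2)`. -/
def shear (n : ℕ) : Phase n ≃L[ℝ] Phase n :=
  LinearEquiv.toContinuousLinearEquiv
    { toFun := fun p => (p.1 - (1 / 2 : ℝ) • p.2, p.1 + (1 / 2 : ℝ) • p.2)
      invFun := fun q => ((1 / 2 : ℝ) • (q.1 + q.2), q.2 - q.1)
      map_add' := fun p q => by
        refine Prod.ext ?_ ?_ <;> simp only [Prod.fst_add, Prod.snd_add] <;> module
      map_smul' := fun c p => by
        refine Prod.ext ?_ ?_ <;>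
          simp only [Prod.smul_fst, Prod.smul_snd, RingHom.id_apply] <;> module
      left_inv := fun p => by refine Prod.ext ?_ ?_ <;> dsimp only <;> module
      right_inv := fun q => by refine Prod.ext ?_ ?_ <;> dsimp only <;> module }

/-- The linear change of variables `(X, ξ) ↦ (X, -ξ / (2 π h))`. -/
def momentumScale (n : ℕ) {h : ℝ} (hh : 0 < h) : Phase n ≃L[ℝ] Phase n :=
  (ContinuousLinearEquiv.refl ℝ (Config n)).prodCongr
    (ContinuousLinearEquiv.smulLeft
      (Units.mk0 (-(2 * Real.pi * h)⁻¹)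
        (neg_ne_zero.2 (inv_ne_zero (mul_pos Real.two_pi_pos hh).ne'))))

variable {n : ℕ}

/-- The cross Wigner transform `v ↦ W(u, v)`, where
`W(u, v) (X, ξ) = ∫ exp (i ⟪s, ξ⟫ / h) u (X - s / 2) v (X + s / 2) ds`
(this formula is `wignerCLM_apply`). -/
def wignerCLM {h : ℝ} (hh : 0 < h) (u : 𝓢(Config n, ℂ)) : 𝓢(Config n, ℂ) →L[ℂ] 𝓢(Phase n, ℂ) :=
  (compCLMOfContinuousLinearEquiv ℂ (momentumScale n hh)).comp
    ((partialFourierCLM (Config n)).comp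
      ((compCLMOfContinuousLinearEquiv ℂ (shear n)).comp (tensorCLM u)))

theorem wignerCLM_apply {h : ℝ} (hh : 0 < h) (u v : 𝓢(Config n, ℂ)) (p : Phase n) :
    wignerCLM hh u v p = ∫ s : Config n, Complex.exp (Complex.I * (⟪s, p.2⟫ / h : ℝ)) *
      (u (p.1 - (1 / 2 : ℝ) • s) * v (p.1 + (1 / 2 : ℝ) • s)) := by
  have e : wignerCLM hh u v p = ∫ s : Config n,
      Real.fourierChar (-⟪s, (-(2 * Real.pi * h)⁻¹) • p.2⟫) •
        (u (p.1 - (1 / 2 : ℝ) • s) * v (p.1 + (1 / 2 : ℝ) • s)) := rfl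
  rw [e]
  refine integral_congr_ae (Filter.Eventually.of_forall fun s => ?_)
  simp only [Circle.smul_def, Real.fourierChar_apply, smul_eq_mul, real_inner_smul_right]
  congr 2
  have h1 : (Real.pi : ℂ) ≠ 0 := by exact_mod_cast Real.pi_ne_zero
  have h2 : (h : ℂ) ≠ 0 := by exact_mod_cast hh.ne'
  push_cast
  field_simp

/-- The semiclassical Weyl quantization `Op_h(a) : 𝓢(ℝⁿ) → 𝓢'(ℝⁿ)` of a tempered distribution `a`
on phase space. It is the operator with distributional kernel
`(2 π h)⁻ⁿ ∫ a ((x + y) / 2, ξ) exp (i ⟪x - y, ξ⟫ / h) dξ`: pairing `Op_h(a) u` with `v` and changing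
variables to `X = (x + y) / 2`, `s = x - y` gives `(2 π h)⁻ⁿ ⟨a, W(u, v)⟩`. -/
def weylOp {h : ℝ} (hh : 0 < h) (a : 𝓢'(Phase n, ℂ)) (u : 𝓢(Config n, ℂ)) : 𝓢'(Config n, ℂ) :=
  (((2 * Real.pi * h) ^ n)⁻¹ : ℂ) • PointwiseConvergenceCLM.precomp ℂ (wignerCLM hh u) a

theorem weylOp_apply {h : ℝ} (hh : 0 < h) (a : 𝓢'(Phase n, ℂ)) (u v : 𝓢(Config n, ℂ)) :
    weylOp hh a u v = (((2 * Real.pi * h) ^ n)⁻¹ : ℂ) * a (wignerCLM hh u v) := rfl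

instance instIsAddHaarMeasurePhase : (volume : Measure (Phase n)).IsAddHaarMeasure :=
  MeasureTheory.Measure.prod.instIsAddHaarMeasure
    (volume : Measure (Config n)) (volume : Measure (Config n))

instance instHasTemperateGrowthPhase : (volume : Measure (Phase n)).HasTemperateGrowth :=
  MeasureTheory.Measure.IsAddHaarMeasure.instHasTemperateGrowth

/-- The tempered distribution `T` is the function `f`, which has temperate growth. -/
def Represents (T : 𝓢'(Phase n, ℂ)) (f : Phase n → ℂ) : Prop :=
  ∃ hf : f.HasTemperateGrowth, T = hf.toTemperedDistribution volume

end WeylQuantization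

section Symbols

variable {n : ℕ}

/-- The class `S_(k)`: smooth `h`-dependent symbols, `0 < h ≤ 1`, whose derivatives of every order
`m ≥ k` are bounded, uniformly in `h`. -/
def SymbolS (k : ℕ) (a : ℝ → Phase n → ℂ) : Prop :=
  (∀ h ∈ Set.Ioc (0 : ℝ) 1, ContDiff ℝ ∞ (a h)) ∧
  ∀ m : ℕ, k ≤ m → ∃ C : ℝ, ∀ h ∈ Set.Ioc (0 : ℝ) 1, ∀ z, ‖iteratedFDeriv ℝ m (a h) z‖ ≤ C

/-- The class `S^{L¹}_ρ`: smooth `h`-dependent symbols, `0 < h ≤ 1`, such that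
`h⁻ⁿ ‖D^m b‖_{L¹} ≤ C_m h^{-ρ m}` for every `m`. -/
def SymbolL1 (ρ : ℝ) (b : ℝ → Phase n → ℂ) : Prop :=
  (∀ h ∈ Set.Ioc (0 : ℝ) 1, ContDiff ℝ ∞ (b h)) ∧
  ∀ m : ℕ, ∃ C : ℝ, ∀ h ∈ Set.Ioc (0 : ℝ) 1,
    eLpNorm (iteratedFDeriv ℝ m (b h)) 1 volume ≤ ENNReal.ofReal (C * h ^ n * h ^ (-(ρ * m)))

/-- `D_v F = (1 / i) ∂_v F` on the doubled phase space. -/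
def opD (v : Phase n × Phase n) (F : Phase n × Phase n → ℂ) : Phase n × Phase n → ℂ :=
  fun p => (1 / Complex.I) * fderiv ℝ F p v

/-- The `i`-th standard basis vector of `ℝⁿ`. -/
def stdVec (i : Fin n) : Config n := EuclideanSpace.single i 1

/-- The operator `σ(D_x, D_ξ, D_y, D_η) = ⟨D_ξ, D_y⟩ - ⟨D_x, D_η⟩` on functions of
`((x, ξ), (y, η))`. -/
def sigmaD (F : Phase n × Phase n → ℂ) : Phase n × Phase n → ℂ := fun p =>
  ∑ i : Fin n,
    (opD ((0, stdVec i), 0) (opD (0, (stdVec i, 0)) F) p -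
      opD ((stdVec i, 0), 0) (opD (0, (0, stdVec i)) F) p)

/-- The `N`-term Moyal expansion
`∑_{j < N} (1 / j!) ((i h / 2) σ(D_x, D_ξ, D_y, D_η))^j a(x, ξ) b(y, η)`
at `y = x`, `η = ξ`. -/
def moyalSum (N : ℕ) (h : ℝ) (a b : Phase n → ℂ) (z : Phase n) : ℂ :=
  ∑ j ∈ Finset.range N, (1 / (j.factorial : ℂ)) * (Complex.I * h / 2) ^ j *
    (sigmaD^[j] (fun p => a p.1 * b p.2)) (z, z)

end Symbols

end Weyl

end

/-!
The composition of two Weyl quantizations is computed on the Fourier side of the second symbol only.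
Write `b(z) = ∫ b̂(ζ) exp (2 π i ⟨z, ζ⟩) dζ`. All derivatives of `b` are integrable, so `b̂` is
continuous and rapidly decreasing. The Weyl quantization of one character
`exp (2 π i ⟨z, ζ⟩)` is a phase space translation composed with a modulation; hence `Op_h(b)` is the
superposition `translationAverage` of such operators, which preserves the Schwartz space
(`exists_schwartzMap_eq_translationAverage`). Composing `Op_h(a)` with one of them translates `a` by
`π h J ζ`, where `J (x, ξ) = (-ξ, x)`. Therefore `Op_h(a) Op_h(b) = Op_h(c)` with
`c(z) = ∫ a(z + π h J ζ) b̂(ζ) exp (2 π i ⟨z, ζ⟩) dζ`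
(`weylOp_comp`, from the action on Wigner transforms `integral_wignerCLM_translationAverage`).
This integral converges absolutely since `a` grows at most polynomially.

Taylor's formula for `t ↦ a(z + t π h J ζ)` on `[0, 1]` gives the Moyal expansion
(`shiftedProduct_dirac_one_eq_moyalSum_add`): multiplication of `b̂` by a coordinate of `J ζ` is a
derivative of `b`, so the `j`-th Taylor term is the `j`-th term of the Moyal sum, and the remainder
is `(i h / 2) ^ N` times a sum of averages over `t` of products
`∫ ∂^α a(z + t π h J ζ) (∂^β b)^(ζ) exp (2 π i ⟨z, ζ⟩) dζ`, `|α| = |β| = N`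
(`poissonIter` of `shiftedProduct`). As `N ≥ k`, all `∂^α a` and their derivatives are bounded.

What remains is that such an average belongs to `S^{L¹}_ρ` whenever `a` has bounded derivatives and
`b` is in `S^{L¹}_ρ` (`SymbolL1.shiftedProduct`); by the Leibniz rule only the `L¹` norm itself has
to be bounded. For this, `b̂(ζ) = (1 + |h^ρ ζ|²)^{-K} Ĝ(ζ)`, where `G` results from `b` by applying
`1 - (h^ρ / 2 π)² Δ` `K` times and has `L¹` norm `O(h^n)`. The product becomes an operator with
symbol `a(z + t π h J ζ) (1 + |h^ρ ζ|²)^{-K}` applied to `G`. In the variable `η = h^ρ ζ` the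
derivatives of this symbol are bounded by those of the weight, because `h ≤ h^ρ`. So its kernel is
dominated by an `L¹`-normalized rescaling of `(1 + |w|)^{-K}` (`exists_kernel_bound`), and the
operator is bounded on `L¹` uniformly in `h` (`exists_lintegral_symbol_le`). Each of the `N`
derivatives of `b` costs `h^{-ρ}`, which together with `h^N` gives the factor `h^{N (1 - ρ)}`.
-/

open MeasureTheory SchwartzMap FourierTransform
open scoped RealInnerProductSpace ContDiff

noncomputable section

namespace Weyl

/-! ### Directional derivatives and temperate growth -/

section DirectionalDerivatives

universe u

variable {E : Type*} [NormedAddCommGroup E] [NormedSpace ℝ E]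

/-- The directional derivative `∂_v f`. -/
def dirDeriv (v : E) (f : E → ℂ) (x : E) : ℂ := fderiv ℝ f x v

theorem contDiff_dirDeriv {f : E → ℂ} (hf : ContDiff ℝ ∞ f) (v : E) :
    ContDiff ℝ ∞ (dirDeriv v f) :=
  (hf.fderiv_right (m := ∞) (by simp)).clm_apply contDiff_const

theorem dirDeriv_add {f g : E → ℂ} (hf : Differentiable ℝ f) (hg : Differentiable ℝ g) (v : E) :
    dirDeriv v (f + g) = dirDeriv v f + dirDeriv v g := by
  ext x
  simp [dirDeriv, fderiv_add (hf x) (hg x)]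

theorem dirDeriv_const_smul {f : E → ℂ} (hf : Differentiable ℝ f) (c : ℂ) (v : E) :
    dirDeriv v (c • f) = c • dirDeriv v f := by
  ext x
  simp [dirDeriv, fderiv_const_smul (hf x)]

theorem dirDeriv_zero (v : E) : dirDeriv v (0 : E → ℂ) = 0 := by
  ext x
  simp [dirDeriv]

theorem contDiff_const_smul_fun {f : E → ℂ} (hf : ContDiff ℝ ∞ f) (c : ℂ) :
    ContDiff ℝ ∞ (c • f) := hf.const_smul c

theorem iteratedFDeriv_add_of_smooth {f g : E → ℂ} (hf : ContDiff ℝ ∞ f) (hg : ContDiff ℝ ∞ g)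
    (m : ℕ) : iteratedFDeriv ℝ m (f + g) = iteratedFDeriv ℝ m f + iteratedFDeriv ℝ m g :=
  funext fun _ => iteratedFDeriv_add_apply (hf.of_le (by exact_mod_cast le_top)).contDiffAt
    (hg.of_le (by exact_mod_cast le_top)).contDiffAt

theorem iteratedFDeriv_const_smul_of_smooth {f : E → ℂ} (hf : ContDiff ℝ ∞ f) (c : ℂ) (m : ℕ) :
    iteratedFDeriv ℝ m (c • f) = c • iteratedFDeriv ℝ m f :=
  funext fun _ => iteratedFDeriv_const_smul_apply
    (hf.of_le (by exact_mod_cast le_top)).contDiffAt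

theorem norm_iteratedFDeriv_dirDeriv_le {f : E → ℂ} (hf : ContDiff ℝ ∞ f) (v : E) (m : ℕ)
    (x : E) :
    ‖iteratedFDeriv ℝ m (dirDeriv v f) x‖ ≤ ‖v‖ * ‖iteratedFDeriv ℝ (m + 1) f x‖ := by
  have h1 : ContDiff ℝ ∞ (fderiv ℝ f) := hf.fderiv_right (by simp)
  rw [← norm_iteratedFDeriv_fderiv]
  refine ContinuousMultilinearMap.opNorm_le_bound (by positivity) fun w => ?_
  have h2 := iteratedFDeriv_clm_apply_const_apply (n := (∞ : WithTop ℕ∞)) h1 (i := m)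
    (by exact_mod_cast le_top) (x := x) (u := v) (m := w)
  change ‖iteratedFDeriv ℝ m (fun y => fderiv ℝ f y v) x w‖ ≤ _
  rw [h2]
  refine (ContinuousLinearMap.le_opNorm _ _).trans ?_
  have := (iteratedFDeriv ℝ m (fderiv ℝ f) x).le_opNorm w
  calc _ ≤ (‖iteratedFDeriv ℝ m (fderiv ℝ f) x‖ * ∏ i, ‖w i‖) * ‖v‖ := by gcongr
    _ = _ := by ring

/-- A derivative of order `m + 1` is controlled by the derivatives of order `m` of the partial
derivatives in the directions of a basis. -/
theorem exists_norm_iteratedFDeriv_succ_le {ι : Type*} [Fintype ι] (b : Module.Basis ι ℝ E) :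
    ∃ C : ℝ, 0 < C ∧ ∀ f : E → ℂ, ContDiff ℝ ∞ f → ∀ (m : ℕ) (x : E),
      ‖iteratedFDeriv ℝ (m + 1) f x‖ ≤
        C * ∑ i, ‖iteratedFDeriv ℝ m (dirDeriv (b i) f) x‖ := by
  obtain ⟨C, hC, h⟩ := b.exists_opNorm_le (F := ℂ)
  refine ⟨C, hC, fun f hf m x => ?_⟩
  have h1 : ContDiff ℝ ∞ (fderiv ℝ f) := hf.fderiv_right (by simp)
  rw [← norm_iteratedFDeriv_fderiv]
  refine ContinuousMultilinearMap.opNorm_le_bound (by positivity) fun w => ?_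
  refine (h (M := (∑ i, ‖iteratedFDeriv ℝ m (dirDeriv (b i) f) x‖) * ∏ i, ‖w i‖)
    (by positivity) fun i => ?_).trans (le_of_eq (by ring))
  have h2 := iteratedFDeriv_clm_apply_const_apply (n := (∞ : WithTop ℕ∞)) h1 (i := m)
    (by exact_mod_cast le_top) (x := x) (u := b i) (m := w)
  rw [← h2]
  refine (ContinuousMultilinearMap.le_opNorm _ _).trans ?_
  gcongr
  exact Finset.single_le_sum (f := fun i => ‖iteratedFDeriv ℝ m (dirDeriv (b i) f) x‖)
    (fun _ _ => norm_nonneg _) (Finset.mem_univ i)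

/-- A set of functions that is stable under directional derivatives consists of smooth
functions. -/
theorem contDiff_of_dirDeriv_mem [FiniteDimensional ℝ E] {S : Set (E → ℂ)}
    (hd : ∀ f ∈ S, Differentiable ℝ f) (hS : ∀ f ∈ S, ∀ v, dirDeriv v f ∈ S) {f : E → ℂ}
    (hf : f ∈ S) : ContDiff ℝ ∞ f := by
  refine contDiff_infty.2 fun m => ?_
  induction m generalizing f with
  | zero => exact contDiff_zero.2 (hd f hf).continuous
  | succ m ih =>
    rw [show ((m + 1 : ℕ) : WithTop ℕ∞) = (m : WithTop ℕ∞) + 1 by norm_cast,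
      contDiff_succ_iff_fderiv_apply]
    exact ⟨hd f hf, by simp, fun v => ih (hS f hf v)⟩

/-- A set of polynomially bounded functions that is stable under directional derivatives consists
of functions of temperate growth. -/
theorem hasTemperateGrowth_of_dirDeriv_mem [FiniteDimensional ℝ E] {S : Set (E → ℂ)}
    (hd : ∀ f ∈ S, Differentiable ℝ f) (hS : ∀ f ∈ S, ∀ v, dirDeriv v f ∈ S)
    (hb : ∀ f ∈ S, ∃ (k : ℕ) (C : ℝ), ∀ x, ‖f x‖ ≤ C * (1 + ‖x‖) ^ k) {f : E → ℂ}
    (hf : f ∈ S) : f.HasTemperateGrowth := by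
  refine ⟨contDiff_of_dirDeriv_mem hd hS hf, fun m => ?_⟩
  induction m generalizing f with
  | zero => simpa using hb f hf
  | succ m ih =>
    let b := Module.finBasis ℝ E
    obtain ⟨C, hC, h⟩ := exists_norm_iteratedFDeriv_succ_le b
    choose k D hD using fun i => ih (hS f hf (b i))
    refine ⟨∑ i, k i, C * ∑ i, |D i|, fun x => ?_⟩
    refine (h f (contDiff_of_dirDeriv_mem hd hS hf) m x).trans ?_
    rw [mul_assoc, Finset.sum_mul]
    gcongr with i
    refine (hD i x).trans ?_
    have h1 : (1 : ℝ) ≤ 1 + ‖x‖ := by linarith [norm_nonneg x]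
    have h2 : k i ≤ ∑ i, k i := Finset.single_le_sum (fun _ _ => Nat.zero_le _) (Finset.mem_univ i)
    gcongr
    exact le_abs_self _

/-- A set of rapidly decreasing functions that is stable under directional derivatives consists
of functions all of whose derivatives decrease rapidly. -/
theorem decay_of_dirDeriv_mem [FiniteDimensional ℝ E] {S : Set (E → ℂ)}
    (hd : ∀ f ∈ S, Differentiable ℝ f) (hS : ∀ f ∈ S, ∀ v, dirDeriv v f ∈ S) (k : ℕ)
    (hb : ∀ f ∈ S, ∃ C : ℝ, ∀ x, ‖x‖ ^ k * ‖f x‖ ≤ C) (m : ℕ) {f : E → ℂ}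
    (hf : f ∈ S) : ∃ C : ℝ, ∀ x, ‖x‖ ^ k * ‖iteratedFDeriv ℝ m f x‖ ≤ C := by
  induction m generalizing f with
  | zero => simpa using hb f hf
  | succ m ih =>
    let b := Module.finBasis ℝ E
    obtain ⟨C, hC, h⟩ := exists_norm_iteratedFDeriv_succ_le b
    choose D hD using fun i => ih (hS f hf (b i))
    refine ⟨C * ∑ i, D i, fun x => ?_⟩
    calc _ ≤ ‖x‖ ^ k * (C * ∑ i, ‖iteratedFDeriv ℝ m (dirDeriv (b i) f) x‖) := by
          gcongr
          exact h f (contDiff_of_dirDeriv_mem hd hS hf) m x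
      _ = C * ∑ i, ‖x‖ ^ k * ‖iteratedFDeriv ℝ m (dirDeriv (b i) f) x‖ := by
          rw [Finset.mul_sum, Finset.mul_sum, Finset.mul_sum]
          exact Finset.sum_congr rfl fun i _ => by ring
      _ ≤ _ := by
          gcongr with i
          exact hD i x

theorem HasTemperateGrowth.dirDeriv {f : E → ℂ} (hf : f.HasTemperateGrowth) (v : E) :
    (dirDeriv v f).HasTemperateGrowth := by
  refine ⟨contDiff_dirDeriv hf.1 v, fun m => ?_⟩
  obtain ⟨k, C, h⟩ := hf.2 (m + 1)
  refine ⟨k, ‖v‖ * C, fun x => (norm_iteratedFDeriv_dirDeriv_le hf.1 v m x).trans ?_⟩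
  rw [mul_assoc]
  gcongr
  exact h x

/-- A smooth function whose derivatives of all orders `≥ k` are bounded has temperate growth. The
induction on `k` passes to the derivative, hence from `F` to `E →L[ℝ] F`; this is why `F` varies and
shares the universe of `E`. -/
theorem hasTemperateGrowth_of_bounded_iteratedFDeriv {E : Type u} [NormedAddCommGroup E]
    [NormedSpace ℝ E] (k : ℕ) :
    ∀ {F : Type u} [NormedAddCommGroup F] [NormedSpace ℝ F] {f : E → F}, ContDiff ℝ ∞ f →
      (∀ m, k ≤ m → ∃ C : ℝ, ∀ x, ‖iteratedFDeriv ℝ m f x‖ ≤ C) → f.HasTemperateGrowth := by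
  induction k with
  | zero =>
    intro F _ _ f hf h
    exact ⟨hf, fun m => ⟨0, by simpa using h m (Nat.zero_le m)⟩⟩
  | succ k ih =>
    intro F _ _ f hf h
    have h1 : (fderiv ℝ f).HasTemperateGrowth := by
      refine ih (hf.fderiv_right (by simp)) fun m hm => ?_
      obtain ⟨C, hC⟩ := h (m + 1) (by omega)
      exact ⟨C, fun x => by rw [norm_iteratedFDeriv_fderiv]; exact hC x⟩
    obtain ⟨j, C, hC⟩ := h1.2 0
    have hd : Differentiable ℝ f := hf.differentiable (by simp)
    have hC0 : 0 ≤ C := by simpa using (norm_nonneg _).trans (hC 0)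
    refine h1.of_fderiv hd (k := j + 1) (C := ‖f 0‖ + C) fun x => ?_
    have h2 : ‖f x - f 0‖ ≤ C * (1 + ‖x‖) ^ j * ‖x - 0‖ := by
      refine (convex_closedBall (0 : E) ‖x‖).norm_image_sub_le_of_norm_fderiv_le (𝕜 := ℝ)
        (fun y _ => hd y) (fun y hy => ?_) (by simp) (by simp)
      have h3 := hC y
      rw [norm_iteratedFDeriv_zero] at h3
      refine h3.trans ?_
      have : ‖y‖ ≤ ‖x‖ := by simpa using hy
      gcongr
    have h4 : ‖f x‖ ≤ ‖f 0‖ + ‖f x - f 0‖ := by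
      calc ‖f x‖ = ‖f 0 + (f x - f 0)‖ := by simp
        _ ≤ _ := norm_add_le _ _
    have h5 : (1 : ℝ) ≤ (1 + ‖x‖) ^ (j + 1) := one_le_pow₀ (by linarith [norm_nonneg x])
    have h6 : (1 + ‖x‖) ^ j * ‖x‖ ≤ (1 + ‖x‖) ^ (j + 1) := by
      rw [pow_succ]
      gcongr
      linarith
    rw [sub_zero, mul_assoc] at h2
    calc _ ≤ ‖f 0‖ * 1 + C * ((1 + ‖x‖) ^ j * ‖x‖) := by linarith
      _ ≤ ‖f 0‖ * (1 + ‖x‖) ^ (j + 1) + C * (1 + ‖x‖) ^ (j + 1) := by gcongr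
      _ = _ := by ring

end DirectionalDerivatives

/-! ### The Fourier transform on phase space -/

section PhaseFourier

variable {n : ℕ}

/-- The Euclidean pairing `⟪x, p⟫ + ⟪ξ, q⟫` of `(x, ξ)` and `(p, q)`. The norm of `Phase n` is the
maximum norm, so this is not the inner product of an inner product space structure. -/
def dualForm (n : ℕ) : Phase n →L[ℝ] Phase n →L[ℝ] ℝ :=
  (innerSL ℝ).bilinearComp (ContinuousLinearMap.fst ℝ _ _) (ContinuousLinearMap.fst ℝ _ _) +
  (innerSL ℝ).bilinearComp (ContinuousLinearMap.snd ℝ _ _) (ContinuousLinearMap.snd ℝ _ _)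

theorem dualForm_apply (z w : Phase n) : dualForm n z w = ⟪z.1, w.1⟫ + ⟪z.2, w.2⟫ := rfl

theorem dualForm_comm (z w : Phase n) : dualForm n z w = dualForm n w z := by
  simp only [dualForm_apply, real_inner_comm]

theorem sq_norm_le_dualForm_self (z : Phase n) : ‖z‖ ^ 2 ≤ dualForm n z z := by
  rw [dualForm_apply, real_inner_self_eq_norm_sq, real_inner_self_eq_norm_sq, Prod.norm_def]
  rcases max_choice ‖z.1‖ ‖z.2‖ with h | h <;> rw [h]
  · linarith [sq_nonneg ‖z.2‖]
  · linarith [sq_nonneg ‖z.1‖]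

/-- The character `exp (2 π i (⟪x, p⟫ + ⟪ξ, q⟫))` at `z = (x, ξ)`, `ζ = (p, q)`. -/
def phaseChar (z ζ : Phase n) : ℂ := Real.fourierChar (dualForm n z ζ)

theorem norm_phaseChar (z ζ : Phase n) : ‖phaseChar z ζ‖ = 1 := Circle.norm_coe _

theorem phaseChar_add (z w ζ : Phase n) :
    phaseChar (z + w) ζ = phaseChar z ζ * phaseChar w ζ := by
  simp only [phaseChar, map_add, add_apply, AddChar.map_add_eq_mul, Circle.coe_mul]

theorem phaseChar_smul_comm (c : ℝ) (z ζ : Phase n) :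
    phaseChar (c • z) ζ = phaseChar z (c • ζ) := by
  simp [phaseChar]

@[fun_prop]
theorem continuous_phaseChar {X : Type*} [TopologicalSpace X] {f g : X → Phase n}
    (hf : Continuous f) (hg : Continuous g) : Continuous fun x => phaseChar (f x) (g x) := by
  have h : Continuous fun x => dualForm n (f x) (g x) := by fun_prop
  exact continuous_subtype_val.comp (Real.continuous_fourierChar.comp h)

theorem hasFDerivAt_phaseChar (z ζ : Phase n) :
    HasFDerivAt (fun z => phaseChar z ζ)
      ((2 * Real.pi * Complex.I * phaseChar z ζ) •
        (Complex.ofRealCLM ∘L (dualForm n).flip ζ)) z := by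
  have h1 := (Real.hasDerivAt_fourierChar (dualForm n z ζ)).hasFDerivAt
  have h2 : HasFDerivAt (fun z => dualForm n z ζ) ((dualForm n).flip ζ) z :=
    ((dualForm n).flip ζ).hasFDerivAt
  refine (h1.comp z h2).congr_fderiv ?_
  ext v <;> simp [phaseChar, mul_comm]

/-- The symplectic rotation `(x, ξ) ↦ (-ξ, x)`. -/
def sympJ (n : ℕ) : Phase n →L[ℝ] Phase n :=
  (-ContinuousLinearMap.snd ℝ _ _).prod (ContinuousLinearMap.fst ℝ _ _)

theorem sympJ_apply (z : Phase n) : sympJ n z = (-z.2, z.1) := rfl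

theorem norm_sympJ_apply (z : Phase n) : ‖sympJ n z‖ = ‖z‖ := by
  rw [sympJ_apply, Prod.norm_def, Prod.norm_def, norm_neg, max_comm]

theorem dualForm_sympJ_left (z w : Phase n) :
    dualForm n (sympJ n z) w = -dualForm n (sympJ n w) z := by
  simp only [dualForm_apply, sympJ_apply, inner_neg_left]
  rw [real_inner_comm w.1 z.2, real_inner_comm w.2 z.1]
  ring

theorem dualForm_sympJ_self (z : Phase n) : dualForm n (sympJ n z) z = 0 := by
  have := dualForm_sympJ_left z z
  linarith

theorem phaseChar_smul_sympJ (c : ℝ) (ζ : Phase n) : phaseChar (c • sympJ n ζ) ζ = 1 := by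
  simp [phaseChar, dualForm_sympJ_self]

/-- The standard basis of phase space: first the position, then the momentum directions. -/
def phaseBasis (n : ℕ) : Module.Basis (Fin n ⊕ Fin n) ℝ (Phase n) :=
  (EuclideanSpace.basisFun (Fin n) ℝ).toBasis.prod (EuclideanSpace.basisFun (Fin n) ℝ).toBasis

theorem phaseBasis_inl (i : Fin n) : phaseBasis n (Sum.inl i) = (stdVec i, 0) := by
  simp [phaseBasis, stdVec]

theorem phaseBasis_inr (i : Fin n) : phaseBasis n (Sum.inr i) = (0, stdVec i) := by
  simp [phaseBasis, stdVec]

theorem sum_dualForm_smul_phaseBasis (z : Phase n) :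
    ∑ α, dualForm n (phaseBasis n α) z • phaseBasis n α = z := by
  have h := (phaseBasis n).sum_repr z
  conv_rhs => rw [← h]
  refine Finset.sum_congr rfl fun α _ => ?_
  congr 1
  rcases α with i | i
  · rw [phaseBasis_inl]
    simp [dualForm_apply, stdVec, phaseBasis, EuclideanSpace.inner_single_left]
  · rw [phaseBasis_inr]
    simp [dualForm_apply, stdVec, phaseBasis, EuclideanSpace.inner_single_left]

theorem sum_sq_dualForm_phaseBasis (z : Phase n) :
    ∑ α, dualForm n (phaseBasis n α) z ^ 2 = dualForm n z z := by
  conv_rhs => rw [← sum_dualForm_smul_phaseBasis z]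
  rw [map_sum]
  refine Finset.sum_congr rfl fun α _ => ?_
  rw [sum_dualForm_smul_phaseBasis, map_smul, smul_eq_mul, sq, dualForm_comm z]

/-- The Fourier transform on phase space. -/
def phaseFT (g : Phase n → ℂ) : Phase n → ℂ :=
  VectorFourier.fourierIntegral Real.fourierChar volume (dualForm n).toLinearMap₁₂ g

theorem phaseFT_apply (g : Phase n → ℂ) (ζ : Phase n) :
    phaseFT g ζ = ∫ z, phaseChar (-z) ζ * g z := by
  simp only [phaseFT, VectorFourier.fourierIntegral, Circle.smul_def, phaseChar, map_neg,
    neg_apply, smul_eq_mul]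
  rfl

theorem phaseFT_const_smul (f : Phase n → ℂ) (c : ℂ) :
    phaseFT (c • f) = c • phaseFT f :=
  VectorFourier.fourierIntegral_const_smul _ _ _ f c

/-- Integrability of the derivatives of order `≤ k` makes the Fourier transform decrease like
the `k`-th power of the norm. -/
theorem one_add_norm_pow_mul_norm_phaseFT_le {g : Phase n → ℂ} (hg : ContDiff ℝ ∞ g) {k : ℕ}
    (hi : ∀ j ≤ k, Integrable (iteratedFDeriv ℝ j g)) (ζ : Phase n) :
    (1 + ‖ζ‖) ^ k * ‖phaseFT g ζ‖ ≤
      4 ^ k * 2 * ∑ j ∈ Finset.range (k + 1), ∫ z, ‖iteratedFDeriv ℝ j g z‖ := by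
  have key : ∀ l ≤ k, ‖ζ‖ ^ l * ‖phaseFT g ζ‖ ≤
      2 ^ k * ∑ j ∈ Finset.range (k + 1), ∫ z, ‖iteratedFDeriv ℝ j g z‖ := by
    intro l hl
    set C : ℝ := 2 ^ k * ∑ j ∈ Finset.range (k + 1), ∫ z, ‖iteratedFDeriv ℝ j g z‖ with hCdef
    have hC : 0 ≤ C := mul_nonneg (by positivity)
      (Finset.sum_nonneg fun j _ => integral_nonneg fun z => norm_nonneg _)
    have h := VectorFourier.pow_mul_norm_iteratedFDeriv_fourierIntegral_le (dualForm n)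
      (f := g) (μ := volume) (K := 0) (N := l) (hg.of_le (by exact_mod_cast le_top))
      (fun i j hi' hj => by
        have : i = 0 := by simpa using hi'
        have hj' : j ≤ l := by exact_mod_cast hj
        simpa [this] using (hi j (hj'.trans hl)).norm) (k := 0) (n := l) (by simp) le_rfl ζ ζ
    simp only [pow_zero, one_mul, Nat.cast_zero, mul_zero, zero_add, Finset.range_one,
      Finset.singleton_product, Finset.sum_map, Function.Embedding.coeFn_mk, mul_one,
      norm_iteratedFDeriv_zero] at h
    change |dualForm n ζ ζ| ^ l * ‖phaseFT g ζ‖ ≤ _ at h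
    rw [mul_assoc] at h
    have hlC : 2 ^ l * ∑ j ∈ Finset.range (l + 1), ∫ z, ‖iteratedFDeriv ℝ j g z‖ ≤ C := by
      rw [hCdef]
      refine mul_le_mul (pow_le_pow_right₀ (by norm_num) hl)
        (Finset.sum_le_sum_of_subset_of_nonneg (by simpa using hl) fun j _ _ =>
          integral_nonneg fun z => norm_nonneg _)
        (Finset.sum_nonneg fun j _ => integral_nonneg fun z => norm_nonneg _) (by positivity)
    have h' := h.trans (mul_le_mul_of_nonneg_left hlC (by positivity))
    -- The library bound, with `ζ` as test vector, controls `|⟨ζ, ζ⟩| ^ l ≥ ‖ζ‖ ^ (2 l)`.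
    rcases eq_or_lt_of_le (norm_nonneg ζ) with h0 | h0
    · rcases Nat.eq_zero_or_pos l with rfl | hk
      · simpa using h'
      · rw [← h0, zero_pow hk.ne', zero_mul]
        exact hC
    · have h1 : ‖ζ‖ ^ l * (‖ζ‖ ^ l * ‖phaseFT g ζ‖) ≤ ‖ζ‖ ^ l * C := by
        refine le_trans ?_ h'
        rw [← mul_assoc, ← pow_add, ← two_mul, pow_mul]
        have := (sq_norm_le_dualForm_self ζ).trans (le_abs_self _)
        gcongr
      exact le_of_mul_le_mul_left h1 (by positivity)
  have h2 : (1 + ‖ζ‖) ^ k ≤ 2 ^ k * (1 + ‖ζ‖ ^ k) := by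
    rcases le_total 1 ‖ζ‖ with h | h
    · calc (1 + ‖ζ‖) ^ k ≤ (2 * ‖ζ‖) ^ k := by gcongr; linarith
        _ = 2 ^ k * ‖ζ‖ ^ k := mul_pow _ _ _
        _ ≤ _ := by gcongr; linarith
    · calc (1 + ‖ζ‖) ^ k ≤ 2 ^ k := by gcongr; linarith
        _ ≤ _ := le_mul_of_one_le_right (by positivity)
          (by linarith [pow_nonneg (norm_nonneg ζ) k])
  calc _ ≤ 2 ^ k * (1 + ‖ζ‖ ^ k) * ‖phaseFT g ζ‖ := by gcongr
    _ = 2 ^ k * (‖ζ‖ ^ 0 * ‖phaseFT g ζ‖ + ‖ζ‖ ^ k * ‖phaseFT g ζ‖) := by rw [pow_zero]; ring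
    _ ≤ 2 ^ k * ((2 ^ k * ∑ j ∈ Finset.range (k + 1), ∫ z, ‖iteratedFDeriv ℝ j g z‖) +
          2 ^ k * ∑ j ∈ Finset.range (k + 1), ∫ z, ‖iteratedFDeriv ℝ j g z‖) := by
        exact mul_le_mul_of_nonneg_left
          (add_le_add (key 0 (Nat.zero_le _)) (key k le_rfl)) (by positivity)
    _ = _ := by rw [show (4 : ℝ) = 2 * 2 by norm_num, mul_pow]; ring

theorem integrable_inv_one_add_norm_pow {k : ℕ}
    (hk : Module.finrank ℝ (Phase n) < k) :
    Integrable fun z : Phase n => ((1 + ‖z‖) ^ k)⁻¹ := by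
  have := integrable_one_add_norm (E := Phase n) (μ := volume) (r := k) (by exact_mod_cast hk)
  refine this.congr (.of_forall fun s => ?_)
  simp only
  rw [Real.rpow_neg (by positivity), Real.rpow_natCast]

/-- Smooth functions on phase space all of whose derivatives are integrable. -/
def IntegrableDerivs (g : Phase n → ℂ) : Prop :=
  ContDiff ℝ ∞ g ∧ ∀ m : ℕ, Integrable (iteratedFDeriv ℝ m g)

namespace IntegrableDerivs

theorem integrable {g : Phase n → ℂ} (hg : IntegrableDerivs g) : Integrable g := by
  refine (hg.2 0).mono hg.1.continuous.aestronglyMeasurable (.of_forall fun z => ?_)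
  rw [norm_iteratedFDeriv_zero]

theorem dirDeriv {g : Phase n → ℂ} (hg : IntegrableDerivs g) (v : Phase n) :
    IntegrableDerivs (dirDeriv v g) := by
  refine ⟨contDiff_dirDeriv hg.1 v, fun m => ?_⟩
  refine ((hg.2 (m + 1)).norm.const_mul ‖v‖).mono'
    ((contDiff_dirDeriv hg.1 v).continuous_iteratedFDeriv
      (by exact_mod_cast le_top)).aestronglyMeasurable
    (.of_forall fun z => norm_iteratedFDeriv_dirDeriv_le hg.1 v m z)

theorem continuous_phaseFT {g : Phase n → ℂ} (hg : IntegrableDerivs g) :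
    Continuous (phaseFT g) :=
  VectorFourier.fourierIntegral_continuous Real.continuous_fourierChar
    (by simp only [ContinuousLinearMap.toLinearMap₁₂_apply_apply_apply]; fun_prop) hg.integrable

theorem phaseFT_dirDeriv {g : Phase n → ℂ} (hg : IntegrableDerivs g) (v ζ : Phase n) :
    phaseFT (Weyl.dirDeriv v g) ζ = 2 * Real.pi * Complex.I * dualForm n v ζ * phaseFT g ζ := by
  have hd : Integrable (fderiv ℝ g) := by
    refine (hg.2 1).norm.mono' (hg.1.continuous_fderiv (by simp)).aestronglyMeasurable
      (.of_forall fun z => ?_)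
    rw [← norm_iteratedFDeriv_one]
  have h := VectorFourier.fourierIntegral_fderiv (dualForm n) hg.integrable
    (hg.1.differentiable (by simp)) hd
  have h2 := congrArg (fun A => A v) (congrFun h ζ)
  rw [Real.fourierIntegral_continuousLinearMap_apply' hd] at h2
  refine h2.trans ?_
  simp [VectorFourier.fourierSMulRight_apply, phaseFT]
  ring

theorem exists_pow_mul_norm_phaseFT_le {g : Phase n → ℂ} (hg : IntegrableDerivs g) (k : ℕ) :
    ∃ C : ℝ, ∀ ζ, (1 + ‖ζ‖) ^ k * ‖phaseFT g ζ‖ ≤ C :=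
  ⟨_, one_add_norm_pow_mul_norm_phaseFT_le hg.1 fun j _ => hg.2 j⟩

theorem integrable_pow_mul_phaseFT {g : Phase n → ℂ} (hg : IntegrableDerivs g) (k : ℕ) :
    Integrable fun ζ => (1 + ‖ζ‖) ^ k * ‖phaseFT g ζ‖ := by
  let d := Module.finrank ℝ (Phase n) + 1
  obtain ⟨C, hC⟩ := hg.exists_pow_mul_norm_phaseFT_le (k + d)
  have hd := integrable_inv_one_add_norm_pow (n := n) (k := d) (Nat.lt_succ_self _)
  refine (hd.const_mul C).mono' ?_ (.of_forall fun ζ => ?_)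
  · have := hg.continuous_phaseFT
    exact Continuous.aestronglyMeasurable (by fun_prop)
  · rw [Real.norm_of_nonneg (by positivity), ← div_eq_mul_inv, le_div_iff₀ (by positivity)]
    refine le_trans (le_of_eq ?_) (hC ζ)
    rw [pow_add]
    ring

theorem integrable_phaseFT {g : Phase n → ℂ} (hg : IntegrableDerivs g) :
    Integrable (phaseFT g) := by
  refine (hg.integrable_pow_mul_phaseFT 0).mono' hg.continuous_phaseFT.aestronglyMeasurable
    (.of_forall fun ζ => by simp)

/-- Fourier inversion on phase space, obtained from the one on the inner product space
`WithLp 2 (Phase n)`. -/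
theorem integral_phaseFT_mul_phaseChar {g : Phase n → ℂ} (hg : IntegrableDerivs g)
    (z : Phase n) : ∫ ζ, phaseFT g ζ * phaseChar z ζ = g z := by
  let E := WithLp 2 (Phase n)
  have hmp : MeasurePreserving (WithLp.ofLp : E → Phase n) :=
    WithLp.volume_preserving_ofLp (Config n) (Config n)
  have hme : MeasurableEmbedding (WithLp.ofLp : E → Phase n) :=
    (WithLp.prodContinuousLinearEquiv 2 ℝ (Config n) (Config n)).toHomeomorph.measurableEmbedding
  have hcont : Continuous (WithLp.ofLp : E → Phase n) :=
    (WithLp.prodContinuousLinearEquiv 2 ℝ (Config n) (Config n)).continuous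
  have hin : ∀ v w : E, ⟪v, w⟫ = dualForm n v.ofLp w.ofLp := fun v w => by
    rw [WithLp.prod_inner_apply]; rfl
  have hF : 𝓕 (g ∘ (WithLp.ofLp : E → Phase n)) = phaseFT g ∘ WithLp.ofLp := by
    ext ζ
    rw [Real.fourier_eq, Function.comp_apply, phaseFT, VectorFourier.fourierIntegral]
    rw [← hmp.integral_comp hme]
    refine integral_congr_ae (.of_forall fun v => ?_)
    simp only [hin]
    rfl
  have h := (hg.1.continuous.comp hcont).fourierInv_fourier_eq
    ((hmp.integrable_comp_emb hme).2 hg.integrable)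
    (by rw [hF]; exact (hmp.integrable_comp_emb hme).2 hg.integrable_phaseFT)
  have h2 := congrFun h (WithLp.toLp 2 z)
  rw [hF, Real.fourierInv_eq] at h2
  refine Eq.trans ?_ h2
  rw [← hmp.integral_comp hme]
  refine integral_congr_ae (.of_forall fun v => ?_)
  simp only [hin, Function.comp_apply, Circle.smul_def, smul_eq_mul, phaseChar]
  rw [mul_comm, dualForm_comm]

theorem exists_norm_le {g : Phase n → ℂ} (hg : IntegrableDerivs g) : ∃ C : ℝ, ∀ z, ‖g z‖ ≤ C := by
  refine ⟨∫ ζ, ‖phaseFT g ζ‖, fun z => ?_⟩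
  rw [← hg.integral_phaseFT_mul_phaseChar z]
  refine (norm_integral_le_integral_norm _).trans (le_of_eq ?_)
  simp [norm_phaseChar]

theorem hasTemperateGrowth {g : Phase n → ℂ} (hg : IntegrableDerivs g) :
    g.HasTemperateGrowth :=
  hasTemperateGrowth_of_dirDeriv_mem (S := {f | IntegrableDerivs f})
    (fun _ hf => hf.1.differentiable (by simp)) (fun _ hf v => hf.dirDeriv v)
    (fun _ hf => ⟨0, by simpa using hf.exists_norm_le⟩) hg

end IntegrableDerivs

end PhaseFourier

/-! ### Shifted products of symbols -/

section ShiftedProduct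

variable {n : ℕ}

/-- The average over `t` with respect to `μ` of the products
`z ↦ ∫ a (z + t s J ζ) b̂ ζ exp (2 π i ⟨z, ζ⟩) dζ`, where `b̂` is the Fourier transform of `b`.
For `t = 0` such a product is the pointwise product of `a` and `b`, for `t = 1` and `s = π h` it is
the symbol of the composition of the Weyl quantizations of `a` and `b`. -/
def shiftedProduct (μ : Measure ℝ) (s : ℝ) (a b : Phase n → ℂ) (z : Phase n) : ℂ :=
  ∫ p : Phase n × ℝ, a (z + (p.2 * s) • sympJ n p.1) * (phaseFT b p.1 * phaseChar z p.1)
    ∂(volume.prod μ)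

theorem one_add_norm_shift_le (z ζ : Phase n) {t : ℝ} (ht : t ∈ Set.Icc (0 : ℝ) 1) (s : ℝ) :
    1 + ‖z + (t * s) • sympJ n ζ‖ ≤ (1 + |s|) * (1 + ‖z‖) * (1 + ‖ζ‖) := by
  have h1 : ‖z + (t * s) • sympJ n ζ‖ ≤ ‖z‖ + |s| * ‖ζ‖ := by
    refine (norm_add_le _ _).trans ?_
    rw [norm_smul, norm_sympJ_apply, Real.norm_eq_abs, abs_mul, abs_of_nonneg ht.1]
    have : t * |s| ≤ 1 * |s| := by gcongr; exact ht.2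
    rw [one_mul] at this
    gcongr
  have h2 := abs_nonneg s
  have h3 := norm_nonneg z
  have h4 := norm_nonneg ζ
  nlinarith [mul_nonneg h2 h3, mul_nonneg h3 h4, mul_nonneg h2 h4,
    mul_nonneg (mul_nonneg h2 h3) h4]

variable {μ : Measure ℝ} [IsFiniteMeasure μ]

/-- The rapid decrease of `b̂` makes it integrable against functions of polynomial growth. -/
theorem integrable_mul_phaseFT {V : Type*} [NormedAddCommGroup V] [NormedSpace ℂ V]
    {b : Phase n → ℂ} (hb : IntegrableDerivs b) {A : Phase n × ℝ → V} (z : Phase n)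
    (hA : AEStronglyMeasurable A (volume.prod μ)) {C : ℝ} {k : ℕ}
    (h : ∀ᵐ p ∂((volume : Measure (Phase n)).prod μ), ‖A p‖ ≤ C * (1 + ‖p.1‖) ^ k) :
    Integrable (fun p : Phase n × ℝ => (phaseFT b p.1 * phaseChar z p.1) • A p)
      (volume.prod μ) := by
  have h1 := ((hb.integrable_pow_mul_phaseFT k).const_mul C).comp_fst μ
  refine h1.mono' ?_ (h.mono fun p hp => ?_)
  · have h2 := hb.continuous_phaseFT
    have h4 : Continuous fun p : Phase n × ℝ => phaseFT b p.1 * phaseChar z p.1 := by fun_prop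
    have h5 : AEStronglyMeasurable (fun p : Phase n × ℝ => phaseFT b p.1 * phaseChar z p.1)
        (volume.prod μ) := h4.aestronglyMeasurable
    exact h5.fun_smul hA
  · rw [norm_smul, norm_mul, norm_phaseChar, mul_one]
    calc _ ≤ ‖phaseFT b p.1‖ * (C * (1 + ‖p.1‖) ^ k) := by gcongr
      _ = _ := by ring

theorem ae_prod_snd {μ : Measure ℝ} [SFinite μ] {P : ℝ → Prop} (h : ∀ᵐ t ∂μ, P t) :
    ∀ᵐ p ∂((volume : Measure (Phase n)).prod μ), P p.2 :=
  Measure.quasiMeasurePreserving_snd.ae h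

theorem integrable_shiftedProduct (hμ : ∀ᵐ t ∂μ, t ∈ Set.Icc (0 : ℝ) 1) (s : ℝ)
    {a b : Phase n → ℂ} (ha : a.HasTemperateGrowth) (hb : IntegrableDerivs b) (z : Phase n) :
    Integrable (fun p : Phase n × ℝ =>
      a (z + (p.2 * s) • sympJ n p.1) * (phaseFT b p.1 * phaseChar z p.1)) (volume.prod μ) := by
  obtain ⟨k, C, hC0, hC⟩ := ha.norm_iteratedFDeriv_le_uniform 0
  have h1 : Continuous fun p : Phase n × ℝ => a (z + (p.2 * s) • sympJ n p.1) := by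
    have := ha.1.continuous
    fun_prop
  have h2 := integrable_mul_phaseFT (μ := μ) hb z h1.aestronglyMeasurable
    (C := C * ((1 + |s|) * (1 + ‖z‖)) ^ k) (k := k) ((ae_prod_snd hμ).mono fun p hp => by
      have h3 := hC 0 le_rfl (z + (p.2 * s) • sympJ n p.1)
      rw [norm_iteratedFDeriv_zero] at h3
      refine h3.trans ?_
      rw [mul_assoc, ← mul_pow]
      have := one_add_norm_shift_le z p.1 hp s
      gcongr)
  exact h2.congr (.of_forall fun p => mul_comm _ _)

theorem exists_norm_shiftedProduct_le (hμ : ∀ᵐ t ∂μ, t ∈ Set.Icc (0 : ℝ) 1) (s : ℝ)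
    {a b : Phase n → ℂ} (ha : a.HasTemperateGrowth) (hb : IntegrableDerivs b) :
    ∃ (k : ℕ) (C : ℝ), ∀ z, ‖shiftedProduct μ s a b z‖ ≤ C * (1 + ‖z‖) ^ k := by
  obtain ⟨k, C, hC0, hC⟩ := ha.norm_iteratedFDeriv_le_uniform 0
  refine ⟨k, ∫ p : Phase n × ℝ, (C * (1 + |s|) ^ k) * ((1 + ‖p.1‖) ^ k * ‖phaseFT b p.1‖)
    ∂(volume.prod μ), fun z => ?_⟩
  refine (norm_integral_le_integral_norm _).trans ?_
  rw [← integral_mul_const]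
  refine integral_mono_ae (integrable_shiftedProduct hμ s ha hb z).norm
    ((((hb.integrable_pow_mul_phaseFT k).comp_fst μ).const_mul _).mul_const _)
    ((ae_prod_snd hμ).mono fun p hp => ?_)
  have h3 := hC 0 le_rfl (z + (p.2 * s) • sympJ n p.1)
  rw [norm_iteratedFDeriv_zero] at h3
  have := one_add_norm_shift_le z p.1 hp s
  simp only [norm_mul, norm_phaseChar, mul_one]
  calc _ ≤ (C * ((1 + |s|) * (1 + ‖z‖) * (1 + ‖p.1‖)) ^ k) * ‖phaseFT b p.1‖ := by
        gcongr
        refine h3.trans ?_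
        gcongr
    _ = _ := by rw [mul_pow, mul_pow]; ring

/-- The Leibniz rule for the averaged shifted product, by differentiation under the integral. -/
theorem exists_hasFDerivAt_shiftedProduct (hμ : ∀ᵐ t ∂μ, t ∈ Set.Icc (0 : ℝ) 1) (s : ℝ)
    {a b : Phase n → ℂ} (ha : a.HasTemperateGrowth) (hb : IntegrableDerivs b) (z : Phase n) :
    ∃ A : Phase n →L[ℝ] ℂ, HasFDerivAt (shiftedProduct μ s a b) A z ∧
      ∀ v, A v = shiftedProduct μ s (dirDeriv v a) b z + shiftedProduct μ s a (dirDeriv v b) z := by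
  obtain ⟨k, C, hC0, hC⟩ := ha.norm_iteratedFDeriv_le_uniform 1
  let G : Phase n → Phase n × ℝ → Phase n →L[ℝ] ℂ := fun x p =>
    fderiv ℝ a (x + (p.2 * s) • sympJ n p.1) +
      (a (x + (p.2 * s) • sympJ n p.1) * (2 * Real.pi * Complex.I)) •
        (Complex.ofRealCLM ∘L (dualForm n).flip p.1)
  let F' : Phase n → Phase n × ℝ → Phase n →L[ℝ] ℂ := fun x p =>
    (phaseFT b p.1 * phaseChar x p.1) • G x p
  have hda : Differentiable ℝ a := ha.1.differentiable (by simp)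
  have hd : ∀ (x : Phase n) (p : Phase n × ℝ), HasFDerivAt (fun x : Phase n =>
      a (x + (p.2 * s) • sympJ n p.1) * (phaseFT b p.1 * phaseChar x p.1)) (F' x p) x := by
    intro x p
    have h1 : HasFDerivAt (fun x : Phase n => a (x + (p.2 * s) • sympJ n p.1))
        (fderiv ℝ a (x + (p.2 * s) • sympJ n p.1)) x :=
      (hda _).hasFDerivAt.comp x ((hasFDerivAt_id x).add_const _)
    refine (h1.mul ((hasFDerivAt_phaseChar x p.1).const_mul (phaseFT b p.1))).congr_fderiv ?_
    ext v <;> simp [F', G] <;> ring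
  let D : ℝ := C + C * (2 * Real.pi) * ‖(dualForm n).flip‖
  have hG : ∀ (x : Phase n) (p : Phase n × ℝ), p.2 ∈ Set.Icc (0 : ℝ) 1 →
      ‖G x p‖ ≤ D * ((1 + |s|) * (1 + ‖x‖)) ^ k * (1 + ‖p.1‖) ^ (k + 1) := by
    intro x p hp
    have h0 := one_add_norm_shift_le x p.1 hp s
    have h1 := hC 0 (by norm_num) (x + (p.2 * s) • sympJ n p.1)
    have h2 := hC 1 le_rfl (x + (p.2 * s) • sympJ n p.1)
    rw [norm_iteratedFDeriv_zero] at h1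
    rw [norm_iteratedFDeriv_one] at h2
    have h3 : (1 + ‖x + (p.2 * s) • sympJ n p.1‖) ^ k ≤
        ((1 + |s|) * (1 + ‖x‖)) ^ k * (1 + ‖p.1‖) ^ k := by
      rw [← mul_pow]; gcongr
    have h4 : ‖Complex.ofRealCLM ∘L (dualForm n).flip p.1‖ ≤
        ‖(dualForm n).flip‖ * (1 + ‖p.1‖) := by
      refine (ContinuousLinearMap.opNorm_comp_le _ _).trans ?_
      rw [Complex.ofRealCLM_norm, one_mul]
      refine ((dualForm n).flip.le_opNorm _).trans ?_
      gcongr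
      linarith
    have h5 : ‖(2 * Real.pi * Complex.I : ℂ)‖ = 2 * Real.pi := by
      simp [abs_of_nonneg Real.pi_nonneg]
    have h6 : (1 + ‖p.1‖) ^ k ≤ (1 + ‖p.1‖) ^ (k + 1) := by
      gcongr <;> linarith [norm_nonneg p.1]
    calc ‖G x p‖ ≤ C * (((1 + |s|) * (1 + ‖x‖)) ^ k * (1 + ‖p.1‖) ^ k) +
          C * (((1 + |s|) * (1 + ‖x‖)) ^ k * (1 + ‖p.1‖) ^ k) * (2 * Real.pi) *
            (‖(dualForm n).flip‖ * (1 + ‖p.1‖)) := by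
          refine (norm_add_le _ _).trans ?_
          rw [norm_smul, norm_mul, h5]
          refine add_le_add (h2.trans (by gcongr)) ?_
          have := h1.trans (mul_le_mul_of_nonneg_left h3 hC0)
          gcongr
      _ ≤ C * (((1 + |s|) * (1 + ‖x‖)) ^ k * (1 + ‖p.1‖) ^ (k + 1)) +
          C * (((1 + |s|) * (1 + ‖x‖)) ^ k * (1 + ‖p.1‖) ^ k) * (2 * Real.pi) *
            (‖(dualForm n).flip‖ * (1 + ‖p.1‖)) := by gcongr
      _ = _ := by simp only [D]; ring
  have hGm : ∀ x, AEStronglyMeasurable (G x) ((volume : Measure (Phase n)).prod μ) := by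
    intro x
    refine Continuous.aestronglyMeasurable ?_
    have h1 := ha.1.continuous
    have h2 : Continuous (fderiv ℝ a) := ha.1.continuous_fderiv (by simp)
    have h3 : Continuous fun ζ : Phase n => Complex.ofRealCLM ∘L (dualForm n).flip ζ :=
      (ContinuousLinearMap.compL ℝ _ _ _ Complex.ofRealCLM).continuous.comp
        (dualForm n).flip.continuous
    exact (h2.comp (by fun_prop)).add
      (((h1.comp (by fun_prop)).mul continuous_const).smul (h3.comp continuous_fst))
  have hF' : Integrable (F' z) (volume.prod μ) :=
    integrable_mul_phaseFT hb z (hGm z) ((ae_prod_snd hμ).mono fun p hp => hG z p hp)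
  refine ⟨∫ p, F' z p ∂(volume.prod μ), ?_, fun v => ?_⟩
  · refine hasFDerivAt_integral_of_dominated_of_fderiv_le (Metric.ball_mem_nhds z one_pos)
      (.of_forall fun x => (integrable_shiftedProduct hμ s ha hb x).aestronglyMeasurable)
      (integrable_shiftedProduct hμ s ha hb z) hF'.aestronglyMeasurable
      ((ae_prod_snd hμ).mono fun p hp x hx => ?_)
      ((((hb.integrable_pow_mul_phaseFT (k + 1)).const_mul
        (D * ((1 + |s|) * (2 + ‖z‖)) ^ k)).comp_fst μ))
      (.of_forall fun p x _ => hd x p)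
    have h1 : ‖x‖ ≤ 1 + ‖z‖ := by
      have h2 : ‖x - z‖ < 1 := by simpa [dist_eq_norm] using hx
      calc ‖x‖ = ‖(x - z) + z‖ := by simp
        _ ≤ ‖x - z‖ + ‖z‖ := norm_add_le _ _
        _ ≤ _ := by linarith
    have h2 : 1 + ‖x‖ ≤ 2 + ‖z‖ := by linarith
    have hD : 0 ≤ D := by positivity
    simp only [F']
    rw [norm_smul, norm_mul, norm_phaseChar, mul_one]
    calc _ ≤ ‖phaseFT b p.1‖ *
          (D * ((1 + |s|) * (1 + ‖x‖)) ^ k * (1 + ‖p.1‖) ^ (k + 1)) := by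
          gcongr
          exact hG x p hp
      _ ≤ ‖phaseFT b p.1‖ *
          (D * ((1 + |s|) * (2 + ‖z‖)) ^ k * (1 + ‖p.1‖) ^ (k + 1)) := by gcongr
      _ = _ := by ring
  · rw [ContinuousLinearMap.integral_apply hF']
    simp only [shiftedProduct]
    rw [← integral_add (integrable_shiftedProduct hμ s (HasTemperateGrowth.dirDeriv ha v) hb z)
      (integrable_shiftedProduct hμ s ha (hb.dirDeriv v) z)]
    refine integral_congr_ae (.of_forall fun p => ?_)
    simp only [F', G, hb.phaseFT_dirDeriv, smul_apply, add_apply, smul_eq_mul, dirDeriv,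
      ContinuousLinearMap.comp_apply, ContinuousLinearMap.flip_apply, Complex.ofRealCLM_apply]
    ring

theorem differentiable_shiftedProduct (hμ : ∀ᵐ t ∂μ, t ∈ Set.Icc (0 : ℝ) 1) (s : ℝ)
    {a b : Phase n → ℂ} (ha : a.HasTemperateGrowth) (hb : IntegrableDerivs b) :
    Differentiable ℝ (shiftedProduct μ s a b) := fun z => by
  obtain ⟨A, hA, -⟩ := exists_hasFDerivAt_shiftedProduct hμ s ha hb z
  exact hA.differentiableAt

theorem dirDeriv_shiftedProduct (hμ : ∀ᵐ t ∂μ, t ∈ Set.Icc (0 : ℝ) 1) (s : ℝ)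
    {a b : Phase n → ℂ} (ha : a.HasTemperateGrowth) (hb : IntegrableDerivs b) (v : Phase n) :
    dirDeriv v (shiftedProduct μ s a b) =
      shiftedProduct μ s (dirDeriv v a) b + shiftedProduct μ s a (dirDeriv v b) := by
  ext z
  obtain ⟨A, hA, h⟩ := exists_hasFDerivAt_shiftedProduct hμ s ha hb z
  rw [dirDeriv, hA.fderiv, h]
  rfl

theorem hasTemperateGrowth_shiftedProduct (hμ : ∀ᵐ t ∂μ, t ∈ Set.Icc (0 : ℝ) 1) (s : ℝ)
    {a b : Phase n → ℂ} (ha : a.HasTemperateGrowth) (hb : IntegrableDerivs b) :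
    (shiftedProduct μ s a b).HasTemperateGrowth := by
  -- By the Leibniz rule the finite sums of shifted products are stable under derivatives.
  let T : Set (Phase n → ℂ) := {f | ∃ a b, a.HasTemperateGrowth ∧ IntegrableDerivs b ∧
    f = shiftedProduct μ s a b}
  let S := AddSubmonoid.closure T
  have hS : ∀ f ∈ S, Differentiable ℝ f ∧ ∀ v, dirDeriv v f ∈ S := by
    intro f hf
    induction hf using AddSubmonoid.closure_induction with
    | mem f hf =>
      obtain ⟨a, b, ha, hb, rfl⟩ := hf
      refine ⟨differentiable_shiftedProduct hμ s ha hb, fun v => ?_⟩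
      rw [dirDeriv_shiftedProduct hμ s ha hb]
      exact S.add_mem
        (AddSubmonoid.subset_closure ⟨_, _, HasTemperateGrowth.dirDeriv ha v, hb, rfl⟩)
        (AddSubmonoid.subset_closure ⟨_, _, ha, hb.dirDeriv v, rfl⟩)
    | zero => exact ⟨differentiable_const 0, fun v => by rw [dirDeriv_zero]; exact S.zero_mem⟩
    | add f g _ _ hf hg =>
      refine ⟨hf.1.add hg.1, fun v => ?_⟩
      rw [dirDeriv_add hf.1 hg.1]
      exact S.add_mem (hf.2 v) (hg.2 v)
  refine hasTemperateGrowth_of_dirDeriv_mem (S := S) (fun f hf => (hS f hf).1)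
    (fun f hf => (hS f hf).2) (fun f hf => ?_)
    (AddSubmonoid.subset_closure (show _ ∈ T from ⟨a, b, ha, hb, rfl⟩))
  induction hf using AddSubmonoid.closure_induction with
  | mem f hf =>
    obtain ⟨a, b, ha, hb, rfl⟩ := hf
    exact exists_norm_shiftedProduct_le hμ s ha hb
  | zero => exact ⟨0, 0, by simp⟩
  | add f g _ _ hf hg =>
    obtain ⟨k, C, hC⟩ := hf
    obtain ⟨l, D, hD⟩ := hg
    refine ⟨k + l, |C| + |D|, fun x => (norm_add_le _ _).trans ?_⟩
    have h1 : (1 : ℝ) ≤ 1 + ‖x‖ := by linarith [norm_nonneg x]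
    rw [add_mul]
    refine add_le_add ((hC x).trans ?_) ((hD x).trans ?_)
    · gcongr
      · exact le_abs_self _
      · omega
    · gcongr
      · exact le_abs_self _
      · omega

theorem ae_dirac_mem_Icc {x : ℝ} (hx : x ∈ Set.Icc (0 : ℝ) 1) :
    ∀ᵐ t ∂(Measure.dirac x), t ∈ Set.Icc (0 : ℝ) 1 :=
  (ae_dirac_iff (p := fun t => t ∈ Set.Icc (0 : ℝ) 1) measurableSet_Icc).2 hx

/-- Without a shift, Fourier inversion for `b` gives back the pointwise product. -/
theorem shiftedProduct_dirac_zero (s : ℝ) {a b : Phase n → ℂ} (hb : IntegrableDerivs b)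
    (ha : a.HasTemperateGrowth) (z : Phase n) :
    shiftedProduct (Measure.dirac 0) s a b z = a z * b z := by
  have hμ : ∀ᵐ t ∂(Measure.dirac (0 : ℝ)), t ∈ Set.Icc (0 : ℝ) 1 := ae_dirac_mem_Icc (by simp)
  rw [shiftedProduct, integral_prod _ (integrable_shiftedProduct hμ s ha hb z)]
  simp only [integral_dirac, zero_mul, zero_smul, add_zero]
  rw [integral_const_mul, hb.integral_phaseFT_mul_phaseChar]

theorem shiftedProduct_dirac_one (s : ℝ) {a b : Phase n → ℂ} (hb : IntegrableDerivs b)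
    (ha : a.HasTemperateGrowth) (z : Phase n) :
    shiftedProduct (Measure.dirac 1) s a b z =
      ∫ ζ, a (z + s • sympJ n ζ) * (phaseFT b ζ * phaseChar z ζ) := by
  have hμ : ∀ᵐ t ∂(Measure.dirac (1 : ℝ)), t ∈ Set.Icc (0 : ℝ) 1 := ae_dirac_mem_Icc (by simp)
  rw [shiftedProduct, integral_prod _ (integrable_shiftedProduct hμ s ha hb z)]
  simp only [integral_dirac, one_mul]

theorem shiftedProduct_smul_right (μ : Measure ℝ) (s : ℝ) (a b : Phase n → ℂ) (c : ℂ) :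
    shiftedProduct μ s a (c • b) = c • shiftedProduct μ s a b := by
  ext z
  simp only [shiftedProduct, Pi.smul_apply, smul_eq_mul]
  rw [← integral_const_mul]
  refine integral_congr_ae (.of_forall fun p => ?_)
  simp only [phaseFT_const_smul, Pi.smul_apply, smul_eq_mul]
  ring

end ShiftedProduct

/-! ### The Moyal expansion with exact remainder -/

section MoyalExpansion

variable {n : ℕ}

/-- The `j`-fold iteration of the substitution
`Q (a, b) ↦ ∑_α Q (∂_α a, ∂_{J α} b)`, where `α` runs through the standard basis of phase space.
For the pointwise product `Q` this is the `j`-th power of the Poisson bidifferential operator. -/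
def poissonIter (Q : (Phase n → ℂ) → (Phase n → ℂ) → Phase n → ℂ) :
    ℕ → (Phase n → ℂ) → (Phase n → ℂ) → Phase n → ℂ
  | 0, a, b => Q a b
  | j + 1, a, b => ∑ α, poissonIter Q j (dirDeriv (phaseBasis n α) a)
      (dirDeriv (sympJ n (phaseBasis n α)) b)

theorem opD_eq (v : Phase n × Phase n) (F : Phase n × Phase n → ℂ) :
    opD v F = (1 / Complex.I) • dirDeriv v F := rfl

theorem contDiff_opD {F : Phase n × Phase n → ℂ} (hF : ContDiff ℝ ∞ F) (v : Phase n × Phase n) :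
    ContDiff ℝ ∞ (opD v F) := by
  rw [opD_eq]
  exact (contDiff_dirDeriv hF v).const_smul (1 / Complex.I)

theorem opD_sum {ι : Type*} (s : Finset ι) {F : ι → Phase n × Phase n → ℂ}
    (hF : ∀ i, ContDiff ℝ ∞ (F i)) (v : Phase n × Phase n) :
    opD v (∑ i ∈ s, F i) = ∑ i ∈ s, opD v (F i) := by
  ext p
  rw [opD, fderiv_sum fun i _ => (hF i).differentiable (by simp) p, Finset.sum_apply]
  simp [opD, Finset.mul_sum]

theorem contDiff_sigmaD {F : Phase n × Phase n → ℂ} (hF : ContDiff ℝ ∞ F) :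
    ContDiff ℝ ∞ (sigmaD F) :=
  ContDiff.sum fun _ _ => (contDiff_opD (contDiff_opD hF _) _).sub
    (contDiff_opD (contDiff_opD hF _) _)

theorem sigmaD_sum {ι : Type*} (s : Finset ι) {F : ι → Phase n × Phase n → ℂ}
    (hF : ∀ i, ContDiff ℝ ∞ (F i)) : sigmaD (∑ i ∈ s, F i) = ∑ i ∈ s, sigmaD (F i) := by
  ext p
  simp only [sigmaD, opD_sum s hF, opD_sum s (fun i => contDiff_opD (hF i) _), Finset.sum_apply]
  rw [Finset.sum_comm]
  simp only [Finset.sum_sub_distrib]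

theorem iterate_sigmaD_sum {ι : Type*} (s : Finset ι) (j : ℕ) {F : ι → Phase n × Phase n → ℂ}
    (hF : ∀ i, ContDiff ℝ ∞ (F i)) : sigmaD^[j] (∑ i ∈ s, F i) = ∑ i ∈ s, sigmaD^[j] (F i) := by
  induction j generalizing F with
  | zero => rfl
  | succ j ih =>
    simp only [Function.iterate_succ_apply]
    rw [sigmaD_sum s hF, ih fun i => contDiff_sigmaD (hF i)]

theorem opD_tensor_left {a b : Phase n → ℂ} (ha : Differentiable ℝ a) (hb : Differentiable ℝ b)
    (v : Phase n) :
    opD (v, 0) (fun p => a p.1 * b p.2) = fun p => (1 / Complex.I) * dirDeriv v a p.1 * b p.2 := by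
  ext p
  have h1 := (ha p.1).hasFDerivAt.comp p hasFDerivAt_fst
  have h2 := (hb p.2).hasFDerivAt.comp p hasFDerivAt_snd
  have h : HasFDerivAt (fun p : Phase n × Phase n => a p.1 * b p.2) _ p := h1.mul h2
  rw [opD, h.fderiv]
  simp [dirDeriv]
  ring

theorem opD_tensor_right {a b : Phase n → ℂ} (ha : Differentiable ℝ a) (hb : Differentiable ℝ b)
    (v : Phase n) :
    opD (0, v) (fun p => a p.1 * b p.2) =
      fun p => a p.1 * ((1 / Complex.I) * dirDeriv v b p.2) := by
  ext p
  have h1 := (ha p.1).hasFDerivAt.comp p hasFDerivAt_fst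
  have h2 := (hb p.2).hasFDerivAt.comp p hasFDerivAt_snd
  have h : HasFDerivAt (fun p : Phase n × Phase n => a p.1 * b p.2) _ p := h1.mul h2
  rw [opD, h.fderiv]
  simp [dirDeriv]
  ring

/-- On a tensor product `σ(D_x, D_ξ, D_y, D_η)` is the Poisson bidifferential operator; the signs
from `1 / i² = -1` are absorbed in `J`. -/
theorem sigmaD_tensor {a b : Phase n → ℂ} (ha : ContDiff ℝ ∞ a) (hb : ContDiff ℝ ∞ b) :
    sigmaD (fun p => a p.1 * b p.2) = ∑ α, fun p : Phase n × Phase n =>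
      dirDeriv (phaseBasis n α) a p.1 * dirDeriv (sympJ n (phaseBasis n α)) b p.2 := by
  have hd : ∀ {f : Phase n → ℂ}, ContDiff ℝ ∞ f → Differentiable ℝ f :=
    fun hf => hf.differentiable (by simp)
  have key : ∀ (v w : Phase n) (p : Phase n × Phase n),
      opD (v, 0) (opD (0, w) (fun p => a p.1 * b p.2)) p =
        -(dirDeriv v a p.1 * dirDeriv w b p.2) := by
    intro v w p
    rw [opD_tensor_right (hd ha) (hd hb), opD_tensor_left (b := fun z => (1 / Complex.I) *
      dirDeriv w b z) (hd ha) ((hd (contDiff_dirDeriv hb w)).const_mul _)]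
    simp only [one_div, Complex.inv_I]
    linear_combination (dirDeriv v a p.1 * dirDeriv w b p.2) * Complex.I_mul_I
  ext p
  simp only [sigmaD, key, Finset.sum_apply, Fintype.sum_sum_type, phaseBasis_inl, phaseBasis_inr,
    sympJ_apply, neg_zero, ← Finset.sum_add_distrib]
  refine Finset.sum_congr rfl fun i _ => ?_
  have : dirDeriv (-stdVec i, 0) b p.2 = -dirDeriv (stdVec i, 0) b p.2 := by
    rw [dirDeriv, dirDeriv, ← map_neg]
    simp
  rw [this]
  ring

theorem iterate_sigmaD_tensor (j : ℕ) {a b : Phase n → ℂ} (ha : ContDiff ℝ ∞ a)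
    (hb : ContDiff ℝ ∞ b) (z : Phase n) :
    sigmaD^[j] (fun p => a p.1 * b p.2) (z, z) = poissonIter (fun a b z => a z * b z) j a b z := by
  induction j generalizing a b with
  | zero => rfl
  | succ j ih =>
    rw [Function.iterate_succ_apply, sigmaD_tensor ha hb, iterate_sigmaD_sum, poissonIter,
      Finset.sum_apply, Finset.sum_apply]
    · exact Finset.sum_congr rfl fun α _ => ih (contDiff_dirDeriv ha _) (contDiff_dirDeriv hb _)
    · intro α
      exact ((contDiff_dirDeriv ha _).comp contDiff_fst).mul
        ((contDiff_dirDeriv hb _).comp contDiff_snd)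

/-- One of the `j + 1` derivatives in the direction `w`, expanded in the standard basis. -/
theorem iteratedFDeriv_succ_apply_diag {a : Phase n → ℂ} (ha : ContDiff ℝ ∞ a) (j : ℕ)
    (y w : Phase n) :
    iteratedFDeriv ℝ (j + 1) a y (fun _ => w) = ∑ α, (dualForm n (phaseBasis n α) w : ℂ) *
      iteratedFDeriv ℝ j (dirDeriv (phaseBasis n α) a) y (fun _ => w) := by
  have h1 : ContDiff ℝ ∞ (fderiv ℝ a) := ha.fderiv_right (by simp)
  rw [iteratedFDeriv_succ_apply_right]
  change iteratedFDeriv ℝ j (fderiv ℝ a) y (fun _ => w) w = _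
  conv_lhs => enter [2]; rw [← sum_dualForm_smul_phaseBasis w]
  rw [map_sum]
  refine Finset.sum_congr rfl fun α _ => ?_
  rw [map_smul, Complex.real_smul]
  congr 1
  exact (iteratedFDeriv_clm_apply_const_apply (n := (∞ : WithTop ℕ∞)) h1
    (by exact_mod_cast le_top)).symm

/-- On the Fourier side the derivatives of `a` in the direction of the shift turn into
derivatives of `b`, because the coordinates of `J ζ` are Fourier multipliers. -/
theorem integrable_and_integral_iteratedFDeriv_shift {μ : Measure ℝ} [IsFiniteMeasure μ]
    (hμ : ∀ᵐ t ∂μ, t ∈ Set.Icc (0 : ℝ) 1) (s : ℝ) (j : ℕ)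
    {a b : Phase n → ℂ} (ha : a.HasTemperateGrowth) (hb : IntegrableDerivs b) (z : Phase n) :
    Integrable (fun p : Phase n × ℝ =>
      iteratedFDeriv ℝ j a (z + (p.2 * s) • sympJ n p.1) (fun _ => s • sympJ n p.1) *
        (phaseFT b p.1 * phaseChar z p.1)) (volume.prod μ) ∧
    ∫ p : Phase n × ℝ,
      iteratedFDeriv ℝ j a (z + (p.2 * s) • sympJ n p.1) (fun _ => s • sympJ n p.1) *
        (phaseFT b p.1 * phaseChar z p.1) ∂(volume.prod μ) =
      (Complex.I * s / (2 * Real.pi)) ^ j * poissonIter (shiftedProduct μ s) j a b z := by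
  induction j generalizing a b with
  | zero =>
    simp only [iteratedFDeriv_zero_apply, pow_zero, one_mul]
    exact ⟨integrable_shiftedProduct hμ s ha hb z, rfl⟩
  | succ j ih =>
    have e : (fun p : Phase n × ℝ =>
        iteratedFDeriv ℝ (j + 1) a (z + (p.2 * s) • sympJ n p.1) (fun _ => s • sympJ n p.1) *
          (phaseFT b p.1 * phaseChar z p.1)) = fun p => ∑ α,
        (Complex.I * s / (2 * Real.pi)) *
        (iteratedFDeriv ℝ j (dirDeriv (phaseBasis n α) a) (z + (p.2 * s) • sympJ n p.1)
          (fun _ => s • sympJ n p.1) *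
          (phaseFT (dirDeriv (sympJ n (phaseBasis n α)) b) p.1 * phaseChar z p.1)) := by
      ext p
      rw [iteratedFDeriv_succ_apply_diag ha.1, Finset.sum_mul]
      refine Finset.sum_congr rfl fun α _ => ?_
      rw [hb.phaseFT_dirDeriv, map_smul, dualForm_comm, dualForm_sympJ_left]
      have hpi : (Real.pi : ℂ) ≠ 0 := by exact_mod_cast Real.pi_ne_zero
      simp only [smul_eq_mul]
      push_cast
      field_simp
      linear_combination (-(s * dualForm n (sympJ n (phaseBasis n α)) p.1 *
        iteratedFDeriv ℝ j (dirDeriv (phaseBasis n α) a) (z + (p.2 * s) • sympJ n p.1)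
          (fun _ => s • sympJ n p.1) * phaseFT b p.1 * phaseChar z p.1 : ℂ)) * Complex.I_sq
    have h := fun α => ih (HasTemperateGrowth.dirDeriv ha (phaseBasis n α))
      (hb.dirDeriv (sympJ n (phaseBasis n α)))
    rw [e]
    refine ⟨integrable_finsetSum _ fun α _ => (h α).1.const_mul _, ?_⟩
    rw [integral_finsetSum _ fun α _ => (h α).1.const_mul _, poissonIter, Finset.sum_apply,
      Finset.mul_sum]
    refine Finset.sum_congr rfl fun α _ => ?_
    rw [integral_const_mul, (h α).2]
    ring

/-- The measure that represents the remainder of order `N` in Taylor's formula on `[0, 1]`: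
the point mass at `1` for `N = 0`, and `(1 - t) ^ (N - 1) / (N - 1)! dt` otherwise. -/
def taylorMeasure : ℕ → Measure ℝ
  | 0 => Measure.dirac 1
  | m + 1 => (volume.restrict (Set.Ioc (0 : ℝ) 1)).withDensity fun t =>
      ENNReal.ofReal ((m.factorial : ℝ)⁻¹ * (1 - t) ^ m)

instance instIsFiniteMeasureTaylorMeasure (N : ℕ) : IsFiniteMeasure (taylorMeasure N) := by
  rcases N with _ | m
  · unfold taylorMeasure; infer_instance
  · unfold taylorMeasure
    refine isFiniteMeasure_withDensity_ofReal ?_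
    have h : Continuous fun t : ℝ => (m.factorial : ℝ)⁻¹ * (1 - t) ^ m := by fun_prop
    exact ((h.integrableOn_Icc (a := 0) (b := 1)).mono_set Set.Ioc_subset_Icc_self).2

theorem ae_taylorMeasure_mem_Icc (N : ℕ) : ∀ᵐ t ∂taylorMeasure N, t ∈ Set.Icc (0 : ℝ) 1 := by
  rcases N with _ | m
  · exact ae_dirac_mem_Icc (by simp)
  · refine (withDensity_absolutelyContinuous _ _).ae_le ?_
    filter_upwards [ae_restrict_mem measurableSet_Ioc] with t ht using Set.Ioc_subset_Icc_self ht

/-- Taylor's formula with integral remainder, uniformly in the order `N ≥ 0`. -/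
theorem taylor_eq_sum_add_integral_taylorMeasure (N : ℕ) {a : Phase n → ℂ} (ha : ContDiff ℝ ∞ a)
    (z w : Phase n) :
    a (z + w) = ∑ j ∈ Finset.range N, (1 / (j.factorial : ℂ)) *
        iteratedFDeriv ℝ j a z (fun _ => w) +
      ∫ t, iteratedFDeriv ℝ N a (z + t • w) (fun _ => w) ∂taylorMeasure N := by
  rcases N with _ | m
  · simp [taylorMeasure]
  · have h := map_add_eq_sum_add_integral_iteratedFDeriv (f := a) (x := z) (y := w) (n := m)
      fun t _ => (ha.of_le (by exact_mod_cast le_top)).contDiffAt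
    rw [h]
    congr 1
    · refine Finset.sum_congr rfl fun j _ => ?_
      rw [Complex.real_smul]
      simp
    · rw [taylorMeasure, integral_withDensity_eq_integral_toReal_smul (by fun_prop)
          (.of_forall fun _ => ENNReal.ofReal_lt_top),
        intervalIntegral.integral_of_le zero_le_one, ← integral_smul]
      refine setIntegral_congr_fun measurableSet_Ioc fun t ht => ?_
      have : 0 ≤ (m.factorial : ℝ)⁻¹ * (1 - t) ^ m :=
        mul_nonneg (by positivity) (pow_nonneg (by linarith [ht.2]) _)
      simp only [ENNReal.toReal_ofReal this, smul_smul]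

/-- The Moyal expansion with exact remainder. -/
theorem shiftedProduct_dirac_one_eq_moyalSum_add (N : ℕ) (h : ℝ) {a b : Phase n → ℂ}
    (ha : a.HasTemperateGrowth) (hb : IntegrableDerivs b) (z : Phase n) :
    shiftedProduct (Measure.dirac 1) (Real.pi * h) a b z = moyalSum N h a b z +
      (Complex.I * h / 2) ^ N *
        poissonIter (shiftedProduct (taylorMeasure N) (Real.pi * h)) N a b z := by
  have hc : Complex.I * (Real.pi * h : ℝ) / (2 * Real.pi) = Complex.I * h / 2 := by
    have hpi : (Real.pi : ℂ) ≠ 0 := by exact_mod_cast Real.pi_ne_zero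
    push_cast
    field_simp
  set s := Real.pi * h
  -- The terms of the expansion are the same integrals, taken without any shift of `a`.
  have h0 : ∀ j, Integrable (fun ζ => iteratedFDeriv ℝ j a z (fun _ => s • sympJ n ζ) *
        (phaseFT b ζ * phaseChar z ζ)) ∧
      ∫ ζ, iteratedFDeriv ℝ j a z (fun _ => s • sympJ n ζ) *
        (phaseFT b ζ * phaseChar z ζ) = (Complex.I * h / 2) ^ j *
          sigmaD^[j] (fun p => a p.1 * b p.2) (z, z) := by
    intro j
    obtain ⟨h1, h2⟩ := integrable_and_integral_iteratedFDeriv_shift (μ := Measure.dirac 0)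
      (ae_dirac_mem_Icc (by simp)) s j ha hb z
    have h3 := h1.integral_prod_left
    rw [integral_prod _ h1] at h2
    simp only [integral_dirac, zero_mul, zero_smul, add_zero] at h2 h3
    refine ⟨h3, ?_⟩
    rw [h2, hc, iterate_sigmaD_tensor j ha.1 hb.1]
    congr 1
    clear h1 h2 h3
    induction j generalizing a b with
    | zero => exact shiftedProduct_dirac_zero s hb ha z
    | succ j ih =>
      simp only [poissonIter, Finset.sum_apply]
      exact Finset.sum_congr rfl fun α _ =>
        ih (HasTemperateGrowth.dirDeriv ha _) (hb.dirDeriv _)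
  obtain ⟨h1, h2⟩ := integrable_and_integral_iteratedFDeriv_shift (ae_taylorMeasure_mem_Icc N) s N
    ha hb z
  have h3 := h1.integral_prod_left
  rw [integral_prod _ h1] at h2
  rw [← hc, ← h2, shiftedProduct_dirac_one s hb ha]
  have e : ∀ ζ, a (z + s • sympJ n ζ) * (phaseFT b ζ * phaseChar z ζ) =
      ∑ j ∈ Finset.range N, (1 / (j.factorial : ℂ)) *
        (iteratedFDeriv ℝ j a z (fun _ => s • sympJ n ζ) * (phaseFT b ζ * phaseChar z ζ)) +
      ∫ t, iteratedFDeriv ℝ N a (z + (t * s) • sympJ n ζ) (fun _ => s • sympJ n ζ) *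
        (phaseFT b ζ * phaseChar z ζ) ∂taylorMeasure N := by
    intro ζ
    rw [taylor_eq_sum_add_integral_taylorMeasure N ha.1, integral_mul_const, add_mul,
      Finset.sum_mul]
    simp only [smul_smul, mul_assoc]
  simp only [e]
  rw [integral_add (integrable_finsetSum _ fun j _ => (h0 j).1.const_mul _) h3,
    integral_finsetSum _ fun j _ => (h0 j).1.const_mul _]
  congr 1
  rw [moyalSum]
  refine Finset.sum_congr rfl fun j _ => ?_
  rw [integral_const_mul, (h0 j).2]
  ring

end MoyalExpansion

/-! ### The weight `(1 + |z|²)⁻¹` and kernel estimates -/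

section JapaneseBracket

variable {n : ℕ}

/-- The weight `(1 + |z|²)⁻¹`, with the Euclidean norm. -/
def invBracket (z : Phase n) : ℝ := (1 + dualForm n z z)⁻¹

theorem one_add_dualForm_self_pos (z : Phase n) : 0 < 1 + dualForm n z z := by
  linarith [sq_norm_le_dualForm_self z, sq_nonneg ‖z‖]

theorem invBracket_pos (z : Phase n) : 0 < invBracket z := inv_pos.2 (one_add_dualForm_self_pos z)

theorem invBracket_le (z : Phase n) : invBracket z ≤ 2 * ((1 + ‖z‖) ^ 2)⁻¹ := by
  have h := sq_norm_le_dualForm_self z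
  rw [invBracket, ← div_eq_mul_inv, inv_le_comm₀ (one_add_dualForm_self_pos z) (by positivity),
    inv_div]
  have : (1 + ‖z‖) ^ 2 ≤ 2 * (1 + ‖z‖ ^ 2) := by nlinarith [sq_nonneg (‖z‖ - 1)]
  linarith

theorem invBracket_mul_one_add_norm_le (z : Phase n) : invBracket z * (1 + ‖z‖) ≤ 2 := by
  have h1 : 1 ≤ 1 + ‖z‖ := by linarith [norm_nonneg z]
  calc _ ≤ 2 * ((1 + ‖z‖) ^ 2)⁻¹ * (1 + ‖z‖) := by gcongr; exact invBracket_le z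
    _ = 2 * (1 + ‖z‖)⁻¹ := by field_simp
    _ ≤ 2 * 1 := by gcongr; exact inv_le_one_of_one_le₀ h1
    _ = 2 := mul_one 2

theorem contDiff_invBracket : ContDiff ℝ ∞ (invBracket : Phase n → ℝ) := by
  refine ContDiff.inv ?_ fun z => (one_add_dualForm_self_pos z).ne'
  exact contDiff_const.add ((dualForm n).contDiff.clm_apply contDiff_id)

theorem norm_iteratedFDeriv_clm_le {E F : Type*} [NormedAddCommGroup E] [NormedSpace ℝ E]
    [NormedAddCommGroup F] [NormedSpace ℝ F] (A : E →L[ℝ] F) (m : ℕ) (x : E) :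
    ‖iteratedFDeriv ℝ m A x‖ ≤ ‖A‖ * (1 + ‖x‖) := by
  rcases m with _ | _ | m
  · rw [norm_iteratedFDeriv_zero]
    refine (A.le_opNorm x).trans ?_
    gcongr
    linarith
  · rw [zero_add, norm_iteratedFDeriv_one, A.fderiv]
    nlinarith [norm_nonneg A, norm_nonneg x]
  · rw [← norm_iteratedFDeriv_fderiv, show fderiv ℝ A = fun _ => A by ext1 y; exact A.fderiv,
      iteratedFDeriv_const_of_ne (by omega)]
    simp
    positivity

theorem fderiv_invBracket (z : Phase n) :
    fderiv ℝ invBracket z = (-invBracket z) • (invBracket z • ((2 : ℝ) • dualForm n) z) := by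
  have h1 : HasFDerivAt (fun z : Phase n => 1 + dualForm n z z) ((2 : ℝ) • dualForm n z) z := by
    have := ((dualForm n).hasFDerivAt (x := z)).clm_apply (hasFDerivAt_id z)
    refine (this.const_add 1).congr_fderiv ?_
    ext v <;> simp [dualForm_comm _ z] <;> ring
  have h2 := (hasDerivAt_inv (one_add_dualForm_self_pos z).ne').comp_hasFDerivAt z h1
  have h3 : HasFDerivAt invBracket _ z := h2
  rw [h3.fderiv]
  ext v <;> simp [invBracket, ← inv_pow] <;> ring

/-- Every derivative of the weight is controlled by the weight itself. -/
theorem exists_norm_iteratedFDeriv_invBracket_le (j : ℕ) :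
    ∃ C : ℝ, 0 ≤ C ∧ ∀ z : Phase n, ‖iteratedFDeriv ℝ j invBracket z‖ ≤ C * invBracket z := by
  induction j using Nat.strong_induction_on with
  | _ j ih =>
    rcases j with _ | j
    · refine ⟨1, zero_le_one, fun z => ?_⟩
      rw [norm_iteratedFDeriv_zero, one_mul, Real.norm_of_nonneg (invBracket_pos z).le]
    choose! C hC0 hC using ih
    let A : Phase n →L[ℝ] Phase n →L[ℝ] ℝ := (2 : ℝ) • dualForm n
    have hG : ContDiff ℝ ∞ fun z : Phase n => invBracket z • A z :=
      contDiff_invBracket.smul A.contDiff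
    -- The second factor has bounded derivatives since `(1 + |z|²)⁻¹ |z|` is bounded.
    have hGb : ∀ i ≤ j, ∀ z : Phase n, ‖iteratedFDeriv ℝ i (fun z => invBracket z • A z) z‖ ≤
        ∑ l ∈ Finset.range (i + 1), (i.choose l : ℝ) * (C l * (‖A‖ * 2)) := by
      intro i hi z
      refine (norm_iteratedFDeriv_smul_le contDiff_invBracket A.contDiff z
        (by exact_mod_cast le_top)).trans (Finset.sum_le_sum fun l hl => ?_)
      have hl' : l < j + 1 := by simp at hl; omega
      rw [mul_assoc]
      refine mul_le_mul_of_nonneg_left ?_ (by positivity)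
      have hCl := hC0 l hl'
      calc _ ≤ (C l * invBracket z) * (‖A‖ * (1 + ‖z‖)) := by
            gcongr
            · exact mul_nonneg hCl (invBracket_pos z).le
            · exact hC l hl' z
            · exact norm_iteratedFDeriv_clm_le A _ z
        _ = C l * (‖A‖ * (invBracket z * (1 + ‖z‖))) := by ring
        _ ≤ _ := by
            gcongr
            exact invBracket_mul_one_add_norm_le z
    refine ⟨∑ i ∈ Finset.range (j + 1), (j.choose i : ℝ) * C i *
      ∑ l ∈ Finset.range (j - i + 1), ((j - i).choose l : ℝ) * (C l * (‖A‖ * 2)), ?_, fun z => ?_⟩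
    · refine Finset.sum_nonneg fun i hi => ?_
      have hi' : i < j + 1 := by simpa using hi
      have := hC0 i hi'
      refine mul_nonneg (by positivity) (Finset.sum_nonneg fun l hl => ?_)
      have hl' : l < j + 1 := by simp at hl; omega
      have := hC0 l hl'
      positivity
    · rw [← norm_iteratedFDeriv_fderiv, show fderiv ℝ (invBracket : Phase n → ℝ) = fun z =>
        (-invBracket z) • (invBracket z • A z) from funext fun z => fderiv_invBracket z]
      refine (norm_iteratedFDeriv_smul_le contDiff_invBracket.neg hG z
        (by exact_mod_cast le_top)).trans ?_
      rw [Finset.sum_mul]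
      refine Finset.sum_le_sum fun i hi => ?_
      have hi' : i < j + 1 := by simpa using hi
      have h1 : ‖iteratedFDeriv ℝ i (fun z : Phase n => -invBracket z) z‖ ≤
          C i * invBracket z := by
        rw [show (fun z : Phase n => -invBracket z) = -invBracket from rfl,
          iteratedFDeriv_neg_apply, norm_neg]
        exact hC i hi' z
      have h3 := mul_nonneg (hC0 i hi') (invBracket_pos z).le
      calc _ ≤ (j.choose i : ℝ) * (C i * invBracket z) *
            ∑ l ∈ Finset.range (j - i + 1), ((j - i).choose l : ℝ) * (C l * (‖A‖ * 2)) := by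
            gcongr
            exact hGb _ (Nat.sub_le _ _) z
        _ = _ := by ring

theorem contDiff_invBracket_pow (K : ℕ) :
    ContDiff ℝ ∞ fun z : Phase n => invBracket z ^ K := contDiff_invBracket.pow K

theorem exists_norm_iteratedFDeriv_invBracket_pow_le (K j : ℕ) :
    ∃ C : ℝ, 0 ≤ C ∧ ∀ z : Phase n,
      ‖iteratedFDeriv ℝ j (fun z => invBracket z ^ K) z‖ ≤ C * invBracket z ^ K := by
  induction K generalizing j with
  | zero =>
    refine ⟨1, zero_le_one, fun z => ?_⟩
    rcases j with _ | j
    · rw [norm_iteratedFDeriv_zero]; simp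
    · simp only [pow_zero]
      rw [iteratedFDeriv_const_of_ne (by omega)]
      simp
  | succ K ih =>
    choose C hC0 hC using ih
    choose D hD0 hD using exists_norm_iteratedFDeriv_invBracket_le (n := n)
    refine ⟨∑ i ∈ Finset.range (j + 1), (j.choose i : ℝ) * C i * D (j - i),
      Finset.sum_nonneg fun i _ => mul_nonneg (mul_nonneg (by positivity) (hC0 i)) (hD0 _),
      fun z => ?_⟩
    simp only [pow_succ]
    refine (norm_iteratedFDeriv_mul_le (contDiff_invBracket_pow K) contDiff_invBracket z
        (by exact_mod_cast le_top)).trans ?_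
    rw [Finset.sum_mul]
    refine Finset.sum_le_sum fun i _ => ?_
    have h0 := invBracket_pos z
    have h1 := hC0 i
    calc _ ≤ (j.choose i : ℝ) * (C i * invBracket z ^ K) * (D (j - i) * invBracket z) := by
          gcongr
          exacts [hC i z, hD _ z]
      _ = _ := by ring

theorem integrable_invBracket_pow {K : ℕ} (hK : Module.finrank ℝ (Phase n) < K) :
    Integrable fun z : Phase n => invBracket z ^ K := by
  refine ((integrable_inv_one_add_norm_pow hK).const_mul (2 ^ K)).mono'
    (contDiff_invBracket_pow K).continuous.aestronglyMeasurable (.of_forall fun z => ?_)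
  have h0 := invBracket_pos z
  rw [Real.norm_of_nonneg (by positivity), ← inv_pow, ← mul_pow]
  gcongr
  refine (invBracket_le z).trans ?_
  have h1 : (1 : ℝ) ≤ 1 + ‖z‖ := by linarith [norm_nonneg z]
  gcongr
  exact le_self_pow₀ h1 (by norm_num)

/-- The kernel estimate: the Fourier transform of a bounded symbol times a power of the weight
decreases like a power of the norm, with constants depending only on bounds for finitely many
derivatives of the symbol. -/
theorem exists_kernel_bound {K : ℕ} (hK : Module.finrank ℝ (Phase n) < K) :
    ∃ C : ℝ, 0 ≤ C ∧ ∀ (A : ℝ) (m : Phase n → ℂ), ContDiff ℝ ∞ m →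
      (∀ j ≤ K, ∀ η, ‖iteratedFDeriv ℝ j m η‖ ≤ A) → ∀ w : Phase n,
      ‖∫ η, phaseChar w η * (invBracket η ^ K • m η)‖ ≤ C * A * ((1 + ‖w‖) ^ K)⁻¹ := by
  choose C hC0 hC using exists_norm_iteratedFDeriv_invBracket_pow_le (n := n) K
  let D : ℕ → ℝ := fun j => ∑ i ∈ Finset.range (j + 1), (j.choose i : ℝ) * C i
  have hI := integrable_invBracket_pow hK
  refine ⟨4 ^ K * 2 * ∑ j ∈ Finset.range (K + 1), D j * ∫ z : Phase n, invBracket z ^ K, ?_,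
    fun A m hm hA w => ?_⟩
  · refine mul_nonneg (by positivity) (Finset.sum_nonneg fun j _ => mul_nonneg
      (Finset.sum_nonneg fun i _ => mul_nonneg (by positivity) (hC0 i))
      (integral_nonneg fun z => pow_nonneg (invBracket_pos z).le _))
  · have hg : ContDiff ℝ ∞ fun η : Phase n => invBracket η ^ K • m η :=
      (contDiff_invBracket_pow K).smul hm
    have hb : ∀ j ≤ K, ∀ η, ‖iteratedFDeriv ℝ j (fun η : Phase n => invBracket η ^ K • m η) η‖ ≤
        D j * A * invBracket η ^ K := by
      intro j hj η
      refine (norm_iteratedFDeriv_smul_le (contDiff_invBracket_pow K) hm η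
        (by exact_mod_cast le_top)).trans ?_
      simp only [D]
      rw [Finset.sum_mul, Finset.sum_mul]
      refine Finset.sum_le_sum fun i _ => ?_
      have h0 := invBracket_pos η
      have h1 := hC0 i
      calc _ ≤ (j.choose i : ℝ) * (C i * invBracket η ^ K) * A := by
            gcongr
            · exact hC i η
            · exact hA _ (by omega) η
        _ = _ := by ring
    have hi : ∀ j ≤ K, Integrable
        (iteratedFDeriv ℝ j (fun η : Phase n => invBracket η ^ K • m η)) := fun j hj =>
      (hI.const_mul _).mono' (hg.continuous_iteratedFDeriv
        (by exact_mod_cast le_top)).aestronglyMeasurable (.of_forall (hb j hj))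
    have h := one_add_norm_pow_mul_norm_phaseFT_le hg hi (-w)
    have e : ∀ z, phaseChar (-z) (-w) = phaseChar w z := fun z => by
      simp [phaseChar, dualForm_comm z w]
    rw [norm_neg, phaseFT_apply] at h
    simp only [e] at h
    rw [← div_eq_mul_inv, le_div_iff₀ (by positivity), mul_comm]
    refine h.trans ?_
    rw [mul_assoc (4 ^ K * 2 : ℝ), Finset.sum_mul]
    gcongr with j hj
    calc _ ≤ ∫ z, D j * A * invBracket z ^ K :=
          integral_mono (hi j (by simp at hj; omega)).norm (hI.const_mul _)
            (hb j (by simp at hj; omega))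
      _ = _ := by rw [integral_const_mul]; ring

end JapaneseBracket

/-! ### Boundedness on `L¹` -/

section KernelL1

variable {n : ℕ}

/-- The operator with symbol `m z ζ` times a rescaled power of the weight acts on `G ∈ L¹` as an
integral operator. -/
theorem integral_symbol_eq_integral_kernel {K : ℕ} (hK : Module.finrank ℝ (Phase n) < K) {r : ℝ}
    (hr : 0 < r) {m : Phase n → ℂ} (hm : Continuous m) {A : ℝ} (hA : ∀ η, ‖m η‖ ≤ A)
    {G : Phase n → ℂ} (hG : Integrable G) (z : Phase n) :
    ∫ ζ, m ζ * ((invBracket (r • ζ) ^ K : ℝ) * phaseFT G ζ * phaseChar z ζ) =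
      ∫ y, G y * ((r ^ Module.finrank ℝ (Phase n))⁻¹ • ∫ η, phaseChar (r⁻¹ • (z - y)) η *
        (invBracket η ^ K • m (r⁻¹ • η))) := by
  have hkc : Continuous fun z : Phase n => invBracket z ^ K :=
    (contDiff_invBracket_pow K).continuous
  let g : Phase n → ℂ := fun ζ => phaseChar z ζ * (invBracket (r • ζ) ^ K • m ζ)
  have hI : Integrable fun ζ : Phase n => invBracket (r • ζ) ^ K :=
    (integrable_invBracket_pow hK).comp_smul hr.ne'
  have hg : Integrable g := by
    refine (hI.const_mul A).mono' ?_ (.of_forall fun ζ => ?_)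
    · have : Continuous fun ζ : Phase n => invBracket (r • ζ) ^ K := hkc.comp (by fun_prop)
      exact Continuous.aestronglyMeasurable (by fun_prop)
    · have h0 := invBracket_pos (r • ζ)
      rw [norm_mul, norm_phaseChar, one_mul, norm_smul, Real.norm_of_nonneg (by positivity),
        mul_comm]
      gcongr
      exact hA ζ
  have h := VectorFourier.integral_fourierIntegral_smul_eq_flip (μ := volume) (ν := volume)
    (L := (dualForm n).toLinearMap₁₂) (f := G) (g := g)
    Real.continuous_fourierChar
    (by simp only [ContinuousLinearMap.toLinearMap₁₂_apply_apply_apply]; fun_prop) hG hg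
  refine Eq.trans (integral_congr_ae (.of_forall fun ζ => ?_)) (h.trans
    (integral_congr_ae (.of_forall fun y => ?_)))
  · change _ = phaseFT G ζ * (phaseChar z ζ * (invBracket (r • ζ) ^ K • m ζ))
    rw [Complex.real_smul]
    ring
  · change G y * VectorFourier.fourierIntegral _ _ _ g y = _
    congr 1
    have e : VectorFourier.fourierIntegral Real.fourierChar volume
        (dualForm n).toLinearMap₁₂.flip g y =
        ∫ ζ, phaseChar (z - y) ζ * (invBracket (r • ζ) ^ K • m ζ) := by
      refine integral_congr_ae (.of_forall fun ζ => ?_)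
      have e1 : ((Real.fourierChar (-dualForm n y ζ) : Circle) : ℂ) = phaseChar (-y) ζ := by
        simp only [phaseChar, map_neg, neg_apply]
      change ((Real.fourierChar (-dualForm n y ζ) : Circle) : ℂ) * (phaseChar z ζ * _) = _
      rw [e1, ← mul_assoc, ← phaseChar_add, neg_add_eq_sub]
    rw [e, ← Measure.integral_comp_smul_of_nonneg volume (fun η =>
      phaseChar (r⁻¹ • (z - y)) η * (invBracket η ^ K • m (r⁻¹ • η))) r (hR := hr.le)]
    refine integral_congr_ae (.of_forall fun ζ => ?_)
    simp only [phaseChar_smul_comm, smul_smul, inv_mul_cancel₀ hr.ne', one_smul]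

/-- The `L¹` bound for operators with symbol `m z ζ` times a rescaled power of the weight: their
kernels are dominated by a rescaled integrable function of the difference. -/
theorem exists_lintegral_symbol_le {K : ℕ} (hK : Module.finrank ℝ (Phase n) < K) :
    ∃ C : ℝ, 0 ≤ C ∧ ∀ (r : ℝ), 0 < r → ∀ (A : ℝ), 0 ≤ A → ∀ (m : Phase n → Phase n → ℂ),
      (∀ z, ContDiff ℝ ∞ (m z)) →
      (∀ z, ∀ j ≤ K, ∀ η, ‖iteratedFDeriv ℝ j (fun η => m z (r⁻¹ • η)) η‖ ≤ A) →
      ∀ G : Phase n → ℂ, Continuous G → Integrable G →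
      ∫⁻ z, ‖∫ ζ, m z ζ * ((invBracket (r • ζ) ^ K : ℝ) * phaseFT G ζ * phaseChar z ζ)‖ₑ ≤
        ENNReal.ofReal (C * A) * ∫⁻ y, ‖G y‖ₑ := by
  obtain ⟨C, hC0, hC⟩ := exists_kernel_bound hK
  have hw := integrable_inv_one_add_norm_pow hK
  refine ⟨C * ∫ w : Phase n, ((1 + ‖w‖) ^ K)⁻¹, mul_nonneg hC0 (integral_nonneg fun w => by
    positivity), fun r hr A hA m hm hmA G hGc hG => ?_⟩
  set d := Module.finrank ℝ (Phase n) with hd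
  let k : Phase n → ℝ := fun x => (r ^ d)⁻¹ * (C * A * ((1 + ‖r⁻¹ • x‖) ^ K)⁻¹)
  have hk0 : ∀ x, 0 ≤ k x := fun x => by positivity
  have hkc : Continuous k := by
    refine continuous_const.mul (continuous_const.mul (Continuous.inv₀ (by fun_prop) fun x => ?_))
    positivity
  have hki : ∫⁻ x, ENNReal.ofReal (k x) =
      ENNReal.ofReal (C * (∫ w : Phase n, ((1 + ‖w‖) ^ K)⁻¹) * A) := by
    have hkI : Integrable k := ((hw.comp_smul (inv_pos.2 hr).ne').const_mul _).const_mul _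
    rw [← ofReal_integral_eq_lintegral_ofReal hkI (.of_forall hk0)]
    simp only [k]
    rw [integral_const_mul, integral_const_mul,
      Measure.integral_comp_inv_smul_of_nonneg volume (fun w : Phase n => ((1 + ‖w‖) ^ K)⁻¹) hr.le,
      smul_eq_mul, ← hd]
    congr 1
    have : r ^ d ≠ 0 := by positivity
    field_simp
  have hF : ∀ z, ‖∫ ζ, m z ζ * ((invBracket (r • ζ) ^ K : ℝ) * phaseFT G ζ * phaseChar z ζ)‖ₑ ≤
      ∫⁻ y, ‖G y‖ₑ * ENNReal.ofReal (k (z - y)) := by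
    intro z
    have hA0 : ∀ η, ‖m z η‖ ≤ A := fun η => by
      have := hmA z 0 (Nat.zero_le _) (r • η)
      rwa [norm_iteratedFDeriv_zero, smul_smul, inv_mul_cancel₀ hr.ne', one_smul] at this
    rw [integral_symbol_eq_integral_kernel hK hr (hm z).continuous hA0 hG z]
    refine (enorm_integral_le_lintegral_enorm _).trans (lintegral_mono fun y => ?_)
    rw [enorm_mul]
    gcongr
    rw [← ofReal_norm]
    refine ENNReal.ofReal_le_ofReal ?_
    rw [norm_smul, Real.norm_of_nonneg (by positivity)]
    refine mul_le_mul_of_nonneg_left ?_ (by positivity)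
    exact hC A (fun η => m z (r⁻¹ • η)) ((hm z).comp (contDiff_const_smul _)) (hmA z) _
  calc _ ≤ ∫⁻ z, ∫⁻ y, ‖G y‖ₑ * ENNReal.ofReal (k (z - y)) := lintegral_mono hF
    _ = ∫⁻ y, ∫⁻ z, ‖G y‖ₑ * ENNReal.ofReal (k (z - y)) := by
        refine lintegral_lintegral_swap (Measurable.aemeasurable ?_)
        have h1 : Continuous fun p : Phase n × Phase n => k (p.1 - p.2) := hkc.comp (by fun_prop)
        exact (hGc.comp continuous_snd).measurable.enorm.mul h1.measurable.ennreal_ofReal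
    _ = ∫⁻ y, ‖G y‖ₑ * ENNReal.ofReal (C * (∫ w : Phase n, ((1 + ‖w‖) ^ K)⁻¹) * A) := by
        refine lintegral_congr fun y => ?_
        have h1 : Measurable fun z : Phase n => ENNReal.ofReal (k (z - y)) :=
          (hkc.comp (continuous_sub_right y)).measurable.ennreal_ofReal
        rw [lintegral_const_mul _ h1,
          lintegral_sub_right_eq_self (fun z => ENNReal.ofReal (k z)) y, hki]
    _ = _ := by
        rw [lintegral_mul_const _ hGc.measurable.enorm, mul_comm]

end KernelL1

/-! ### The symbol classes -/

section SymbolClasses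

variable {n : ℕ} {ρ : ℝ}

theorem SymbolS.hasTemperateGrowth {k : ℕ} {a : ℝ → Phase n → ℂ} (ha : SymbolS k a) {h : ℝ}
    (hh : h ∈ Set.Ioc (0 : ℝ) 1) : (a h).HasTemperateGrowth :=
  hasTemperateGrowth_of_bounded_iteratedFDeriv k (ha.1 h hh) fun m hm =>
    let ⟨C, hC⟩ := ha.2 m hm
    ⟨C, hC h hh⟩

theorem SymbolS.dirDeriv {k : ℕ} {a : ℝ → Phase n → ℂ} (ha : SymbolS k a) (v : Phase n) :
    SymbolS (k - 1) fun h => dirDeriv v (a h) := by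
  refine ⟨fun h hh => contDiff_dirDeriv (ha.1 h hh) v, fun m hm => ?_⟩
  obtain ⟨C, hC⟩ := ha.2 (m + 1) (by omega)
  refine ⟨‖v‖ * C, fun h hh z => (norm_iteratedFDeriv_dirDeriv_le (ha.1 h hh) v m z).trans ?_⟩
  gcongr
  exact hC h hh z

theorem iteratedFDeriv_zero_phase (m : ℕ) :
    iteratedFDeriv ℝ m (0 : Phase n → ℂ) = 0 := iteratedFDeriv_fun_zero

namespace IntegrableDerivs

theorem add {f g : Phase n → ℂ} (hf : IntegrableDerivs f) (hg : IntegrableDerivs g) :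
    IntegrableDerivs (f + g) := by
  refine ⟨hf.1.add hg.1, fun m => ?_⟩
  rw [iteratedFDeriv_add_of_smooth hf.1 hg.1]
  refine Integrable.mono' ((hf.2 m).norm.add (hg.2 m).norm) ?_
    (.of_forall fun z => norm_add_le _ _)
  rw [← iteratedFDeriv_add_of_smooth hf.1 hg.1]
  exact ((hf.1.add hg.1).continuous_iteratedFDeriv (m := m)
    (by exact_mod_cast le_top)).aestronglyMeasurable

theorem const_smul {f : Phase n → ℂ} (hf : IntegrableDerivs f) (c : ℂ) :
    IntegrableDerivs (c • f) := by
  refine ⟨contDiff_const_smul_fun hf.1 c, fun m => ?_⟩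
  rw [iteratedFDeriv_const_smul_of_smooth hf.1]
  exact (hf.2 m).smul c

theorem sum {ι : Type*} (s : Finset ι) {f : ι → Phase n → ℂ}
    (hf : ∀ i, IntegrableDerivs (f i)) : IntegrableDerivs (∑ i ∈ s, f i) := by
  induction s using Finset.cons_induction with
  | empty =>
    refine ⟨contDiff_const, fun m => ?_⟩
    simp only [Finset.sum_empty]
    rw [iteratedFDeriv_zero_phase]
    exact integrable_zero (Phase n) (ContinuousMultilinearMap ℝ (fun _ : Fin m => Phase n) ℂ) volume
  | cons i s hi ih => rw [Finset.sum_cons]; exact (hf i).add ih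

theorem phaseFT_add {f g : Phase n → ℂ} (hf : IntegrableDerivs f) (hg : IntegrableDerivs g) :
    phaseFT (f + g) = phaseFT f + phaseFT g := by
  have key : ∀ {f : Phase n → ℂ}, IntegrableDerivs f → ∀ ζ,
      Integrable fun z => phaseChar (-z) ζ * f z := fun hf ζ => by
    have h1 := hf.1.continuous
    exact hf.integrable.norm.mono' (Continuous.aestronglyMeasurable (by fun_prop))
      (.of_forall fun z => by rw [norm_mul, norm_phaseChar, one_mul])
  ext ζ
  simp only [phaseFT_apply, Pi.add_apply, mul_add]
  exact integral_add (key hf ζ) (key hg ζ)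

theorem phaseFT_sum {ι : Type*} (s : Finset ι) {f : ι → Phase n → ℂ}
    (hf : ∀ i, IntegrableDerivs (f i)) : phaseFT (∑ i ∈ s, f i) = ∑ i ∈ s, phaseFT (f i) := by
  induction s using Finset.cons_induction with
  | empty => ext ζ; simp [phaseFT_apply]
  | cons i s hi ih => rw [Finset.sum_cons, Finset.sum_cons, (hf i).phaseFT_add (.sum s hf), ih]

end IntegrableDerivs

/-- The operator `1 - (r / 2π)² Δ`, whose Fourier multiplier is `1 + |r ζ|²`. -/
def bracketOp (r : ℝ) (g : Phase n → ℂ) : Phase n → ℂ :=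
  g + ∑ α, (-(4 * Real.pi ^ 2 : ℂ)⁻¹) • ((r : ℂ) • dirDeriv (phaseBasis n α)
    ((r : ℂ) • dirDeriv (phaseBasis n α) g))

theorem IntegrableDerivs.bracketOp {g : Phase n → ℂ} (hg : IntegrableDerivs g) (r : ℝ) :
    IntegrableDerivs (bracketOp r g) :=
  hg.add (.sum _ fun _ => (((hg.dirDeriv _).const_smul _).dirDeriv _ |>.const_smul _).const_smul _)

/-- The weight inverts the Fourier multiplier of `bracketOp`. -/
theorem invBracket_mul_phaseFT_bracketOp {g : Phase n → ℂ} (hg : IntegrableDerivs g) (r : ℝ)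
    (ζ : Phase n) :
    (invBracket (r • ζ) : ℝ) * phaseFT (bracketOp r g) ζ = phaseFT g ζ := by
  have h1 : phaseFT (bracketOp r g) ζ = (1 + dualForm n (r • ζ) (r • ζ) : ℝ) * phaseFT g ζ := by
    rw [bracketOp, hg.phaseFT_add (.sum _ fun _ =>
      (((hg.dirDeriv _).const_smul _).dirDeriv _ |>.const_smul _).const_smul _),
      IntegrableDerivs.phaseFT_sum _ fun _ =>
      (((hg.dirDeriv _).const_smul _).dirDeriv _ |>.const_smul _).const_smul _,
      ← sum_sq_dualForm_phaseBasis]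
    simp only [Pi.add_apply, Finset.sum_apply, phaseFT_const_smul, Pi.smul_apply, smul_eq_mul,
      ((hg.dirDeriv _).const_smul _).phaseFT_dirDeriv, hg.phaseFT_dirDeriv, map_smul]
    push_cast
    rw [add_mul, one_mul, Finset.sum_mul]
    congr 1
    refine Finset.sum_congr rfl fun α _ => ?_
    have hpi : (Real.pi : ℂ) ≠ 0 := by exact_mod_cast Real.pi_ne_zero
    field_simp
    rw [Complex.I_sq]
    ring
  rw [h1, ← mul_assoc, ← Complex.ofReal_mul, invBracket,
    inv_mul_cancel₀ (one_add_dualForm_self_pos _).ne', Complex.ofReal_one, one_mul]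

theorem IntegrableDerivs.iterate_bracketOp {g : Phase n → ℂ} (hg : IntegrableDerivs g) (r : ℝ)
    (K : ℕ) : IntegrableDerivs ((Weyl.bracketOp r)^[K] g) := by
  induction K generalizing g with
  | zero => exact hg
  | succ K ih => exact ih (hg.bracketOp r)

theorem invBracket_pow_mul_phaseFT_iterate_bracketOp {g : Phase n → ℂ} (hg : IntegrableDerivs g)
    (r : ℝ) (K : ℕ) (ζ : Phase n) :
    (invBracket (r • ζ) ^ K : ℝ) * phaseFT ((bracketOp r)^[K] g) ζ = phaseFT g ζ := by
  induction K generalizing g with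
  | zero => simp
  | succ K ih =>
    rw [Function.iterate_succ_apply, pow_succ', Complex.ofReal_mul, mul_assoc, ih (hg.bracketOp r),
      invBracket_mul_phaseFT_bracketOp hg]

theorem eLpNorm_iteratedFDeriv_const_smul_le {f : Phase n → ℂ} (hf : ContDiff ℝ ∞ f) (c : ℂ)
    (m : ℕ) : eLpNorm (iteratedFDeriv ℝ m (c • f)) 1 volume ≤
      ‖c‖ₑ * eLpNorm (iteratedFDeriv ℝ m f) 1 volume := by
  rw [← ofReal_norm]
  refine eLpNorm_le_mul_eLpNorm_of_ae_le_mul (.of_forall fun z => ?_) 1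
  rw [iteratedFDeriv_const_smul_of_smooth hf, Pi.smul_apply, norm_smul]

namespace SymbolL1

theorem congr {b c : ℝ → Phase n → ℂ} (hb : SymbolL1 ρ b)
    (h : ∀ h ∈ Set.Ioc (0 : ℝ) 1, b h = c h) : SymbolL1 ρ c :=
  ⟨fun t ht => h t ht ▸ hb.1 t ht, fun m => (hb.2 m).imp fun _ hC t ht => h t ht ▸ hC t ht⟩

theorem exists_nonneg {b : ℝ → Phase n → ℂ} (hb : SymbolL1 ρ b) (m : ℕ) :
    ∃ C : ℝ, 0 ≤ C ∧ ∀ h ∈ Set.Ioc (0 : ℝ) 1, eLpNorm (iteratedFDeriv ℝ m (b h)) 1 volume ≤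
      ENNReal.ofReal (C * h ^ n * h ^ (-(ρ * m))) := by
  obtain ⟨C, hC⟩ := hb.2 m
  refine ⟨|C|, abs_nonneg C, fun h hh => (hC h hh).trans (ENNReal.ofReal_le_ofReal ?_)⟩
  have h0 := hh.1
  gcongr
  exact le_abs_self C

theorem integrableDerivs {b : ℝ → Phase n → ℂ} (hb : SymbolL1 ρ b) {h : ℝ}
    (hh : h ∈ Set.Ioc (0 : ℝ) 1) : IntegrableDerivs (b h) := by
  refine ⟨hb.1 h hh, fun m => ?_⟩
  obtain ⟨C, hC⟩ := hb.2 m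
  exact memLp_one_iff_integrable.1 ⟨((hb.1 h hh).continuous_iteratedFDeriv
    (by exact_mod_cast le_top)).aestronglyMeasurable, (hC h hh).trans_lt ENNReal.ofReal_lt_top⟩

theorem add {b c : ℝ → Phase n → ℂ} (hb : SymbolL1 ρ b) (hc : SymbolL1 ρ c) :
    SymbolL1 ρ fun h => b h + c h := by
  refine ⟨fun h hh => (hb.1 h hh).add (hc.1 h hh), fun m => ?_⟩
  obtain ⟨B, hB0, hB⟩ := hb.exists_nonneg m
  obtain ⟨C, hC0, hC⟩ := hc.exists_nonneg m
  refine ⟨B + C, fun h hh => ?_⟩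
  have h0 := hh.1
  rw [iteratedFDeriv_add_of_smooth (hb.1 h hh) (hc.1 h hh), add_mul, add_mul,
    ENNReal.ofReal_add (by positivity) (by positivity)]
  exact (eLpNorm_add_le ((hb.integrableDerivs hh).2 m).1 ((hc.integrableDerivs hh).2 m).1
    le_rfl).trans (add_le_add (hB h hh) (hC h hh))

theorem smul {b : ℝ → Phase n → ℂ} (hb : SymbolL1 ρ b) {c : ℝ → ℂ} {D : ℝ}
    (hc : ∀ h ∈ Set.Ioc (0 : ℝ) 1, ‖c h‖ ≤ D) : SymbolL1 ρ fun h => c h • b h := by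
  refine ⟨fun h hh => contDiff_const_smul_fun (hb.1 h hh) _, fun m => ?_⟩
  obtain ⟨B, hB0, hB⟩ := hb.exists_nonneg m
  refine ⟨D * B, fun h hh => ?_⟩
  refine (eLpNorm_iteratedFDeriv_const_smul_le (hb.1 h hh) _ m).trans ?_
  rw [mul_assoc, mul_assoc, ENNReal.ofReal_mul ((norm_nonneg _).trans (hc h hh)), ← mul_assoc B]
  refine mul_le_mul' ?_ (hB h hh)
  rw [← ofReal_norm]
  exact ENNReal.ofReal_le_ofReal (hc h hh)

theorem sum {ι : Type*} (s : Finset ι) {b : ι → ℝ → Phase n → ℂ}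
    (hb : ∀ i, SymbolL1 ρ (b i)) : SymbolL1 ρ fun h => ∑ i ∈ s, b i h := by
  induction s using Finset.cons_induction with
  | empty =>
    refine ⟨fun h _ => contDiff_const, fun m => ⟨0, fun h _ => ?_⟩⟩
    simp only [Finset.sum_empty]
    refine (eLpNorm_congr_norm_ae (g := fun _ => (0 : ℝ)) (.of_forall fun z => ?_)).trans_le ?_
    · rw [iteratedFDeriv_zero_phase]
      simp
    · simp
  | cons i s hi ih =>
    simp only [Finset.sum_cons]
    exact (hb i).add ih

/-- A derivative of `b` costs a factor `h ^ (-ρ)`. -/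
theorem rpow_smul_dirDeriv {b : ℝ → Phase n → ℂ} (hb : SymbolL1 ρ b) (v : Phase n) :
    SymbolL1 ρ fun h => ((h ^ ρ : ℝ) : ℂ) • Weyl.dirDeriv v (b h) := by
  refine ⟨fun h hh => contDiff_const_smul_fun (contDiff_dirDeriv (hb.1 h hh) v) _, fun m => ?_⟩
  obtain ⟨B, hB0, hB⟩ := hb.exists_nonneg (m + 1)
  refine ⟨‖v‖ * B, fun h hh => ?_⟩
  have h0 := hh.1
  have h2 := eLpNorm_le_mul_eLpNorm_of_ae_le_mul (μ := volume) (.of_forall fun z =>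
    norm_iteratedFDeriv_dirDeriv_le (hb.1 h hh) v m z) 1
  have h3 : ‖((h ^ ρ : ℝ) : ℂ)‖ₑ = ENNReal.ofReal (h ^ ρ) := by
    rw [← ofReal_norm, Complex.norm_of_nonneg (by positivity)]
  refine (eLpNorm_iteratedFDeriv_const_smul_le (contDiff_dirDeriv (hb.1 h hh) v) _ m).trans ?_
  rw [h3]
  refine (mul_le_mul' le_rfl (h2.trans (mul_le_mul' le_rfl (hB h hh)))).trans (le_of_eq ?_)
  rw [← ENNReal.ofReal_mul (by positivity), ← ENNReal.ofReal_mul (by positivity)]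
  congr 1
  have h4 : h ^ (-(ρ * m)) = h ^ ρ * h ^ (-(ρ * (m + 1 : ℕ))) := by
    rw [← Real.rpow_add h0]
    congr 1
    push_cast
    ring
  rw [h4]
  ring

theorem bracketOp {b : ℝ → Phase n → ℂ} (hb : SymbolL1 ρ b) :
    SymbolL1 ρ fun h => Weyl.bracketOp (h ^ ρ) (b h) :=
  hb.add (.sum _ fun α => ((hb.rpow_smul_dirDeriv (phaseBasis n α)).rpow_smul_dirDeriv
    (phaseBasis n α)).smul fun _ _ => le_rfl)

theorem iterate_bracketOp {b : ℝ → Phase n → ℂ} (hb : SymbolL1 ρ b) (K : ℕ) :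
    SymbolL1 ρ fun h => (Weyl.bracketOp (h ^ ρ))^[K] (b h) := by
  induction K generalizing b with
  | zero => exact hb
  | succ K ih => exact ih hb.bracketOp

end SymbolL1

end SymbolClasses

/-! ### Symbol estimates for shifted products -/

section SymbolBounds

variable {n : ℕ} {ρ : ℝ}

theorem norm_iteratedFDeriv_comp_shift_le {f : Phase n → ℂ} (hf : ContDiff ℝ ∞ f) (j : ℕ)
    {C : ℝ} (hC : ∀ z, ‖iteratedFDeriv ℝ j f z‖ ≤ C) (z : Phase n) (c : ℝ) (η : Phase n) :
    ‖iteratedFDeriv ℝ j (fun η => f (z + c • sympJ n η)) η‖ ≤ C * |c| ^ j := by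
  have h1 : ContDiff ℝ ∞ fun y => f (z + y) := hf.comp (contDiff_const.add contDiff_id)
  have h2 := (c • sympJ n).iteratedFDeriv_comp_right h1 η (i := j) (by exact_mod_cast le_top)
  change ‖iteratedFDeriv ℝ j ((fun y => f (z + y)) ∘ (c • sympJ n)) η‖ ≤ _
  rw [h2, iteratedFDeriv_comp_add_left]
  refine (ContinuousMultilinearMap.norm_compContinuousLinearMap_le _ _).trans ?_
  have h3 : ‖c • sympJ n‖ ≤ |c| := ContinuousLinearMap.opNorm_le_bound _ (abs_nonneg c) fun η => by
    rw [smul_apply, norm_smul, norm_sympJ_apply, Real.norm_eq_abs]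
  rw [Finset.prod_const, Finset.card_univ, Fintype.card_fin]
  gcongr
  · exact (norm_nonneg _).trans (hC z)
  · exact hC _

/-- For a single shift the product is bounded in `L¹`, uniformly in the semiclassical parameter.
At the scale `h ^ ρ` of `b` the shift by `t π h J ζ` differentiates `a` at the harmless scale
`h ^ (1 - ρ)`. -/
theorem exists_lintegral_shift_le (hρ1 : ρ ≤ 1) {a b : ℝ → Phase n → ℂ} (ha : SymbolS 0 a)
    (hb : SymbolL1 ρ b) :
    ∃ C : ℝ, 0 ≤ C ∧ ∀ h ∈ Set.Ioc (0 : ℝ) 1, ∀ t ∈ Set.Icc (0 : ℝ) 1,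
      ∫⁻ z, ‖∫ ζ, a h (z + (t * (Real.pi * h)) • sympJ n ζ) *
        (phaseFT (b h) ζ * phaseChar z ζ)‖ₑ ≤ ENNReal.ofReal (C * h ^ n) := by
  -- The least exponent for which `(1 + ‖w‖) ^ (-K)` is integrable.
  let K := Module.finrank ℝ (Phase n) + 1
  obtain ⟨C, hC0, hC⟩ := exists_lintegral_symbol_le (n := n) (K := K) (Nat.lt_succ_self _)
  choose D hD using fun j => ha.2 j (Nat.zero_le j)
  have hD0 : ∀ j, 0 ≤ D j := fun j =>
    (norm_nonneg _).trans (hD j 1 (by simp) 0)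
  let A : ℝ := ∑ j ∈ Finset.range (K + 1), D j * Real.pi ^ j
  have hA0 : 0 ≤ A := Finset.sum_nonneg fun j _ => mul_nonneg (hD0 j) (by positivity)
  obtain ⟨B, hB0, hB⟩ := (hb.iterate_bracketOp K).exists_nonneg 0
  refine ⟨C * A * B, by positivity, fun h hh t ht => ?_⟩
  have h0 := hh.1
  have hr : 0 < h ^ ρ := by positivity
  have hbd := hb.integrableDerivs hh
  have hG := hbd.iterate_bracketOp (h ^ ρ) K
  have key := hC (h ^ ρ) hr A hA0 (fun z ζ => a h (z + (t * (Real.pi * h)) • sympJ n ζ))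
    (fun z => (ha.1 h hh).comp (contDiff_const.add ((sympJ n).contDiff.const_smul _)))
    (fun z j hj η => by
      have e : (fun η => a h (z + (t * (Real.pi * h)) • sympJ n ((h ^ ρ)⁻¹ • η))) =
          fun η => a h (z + (t * (Real.pi * h) * (h ^ ρ)⁻¹) • sympJ n η) := by
        ext η
        rw [map_smul, smul_smul]
      rw [e]
      refine (norm_iteratedFDeriv_comp_shift_le (ha.1 h hh) j (hD j h hh) z _ η).trans ?_
      refine le_trans ?_ (Finset.single_le_sum (f := fun j => D j * Real.pi ^ j)
        (fun j _ => mul_nonneg (hD0 j) (by positivity)) (Finset.mem_range.2 (Nat.lt_succ_of_le hj)))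
      have h1 : |t * (Real.pi * h) * (h ^ ρ)⁻¹| ≤ Real.pi := by
        have h2 : h * (h ^ ρ)⁻¹ ≤ 1 := by
          rw [← div_eq_mul_inv, div_le_one hr]
          calc h = h ^ (1 : ℝ) := (Real.rpow_one h).symm
            _ ≤ h ^ ρ := Real.rpow_le_rpow_of_exponent_ge h0 hh.2 hρ1
        have ht0 := ht.1
        rw [abs_of_nonneg (by positivity)]
        calc _ = t * Real.pi * (h * (h ^ ρ)⁻¹) := by ring
          _ ≤ 1 * Real.pi * 1 := by gcongr; exact ht.2
          _ = Real.pi := by ring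
      have := hD0 j
      gcongr)
    _ hG.1.continuous hG.integrable
  simp only [invBracket_pow_mul_phaseFT_iterate_bracketOp hbd] at key
  refine key.trans ?_
  have h1 := hB h hh
  simp only [Nat.cast_zero, mul_zero, neg_zero, Real.rpow_zero, mul_one] at h1
  rw [eLpNorm_one_eq_lintegral_enorm] at h1
  have h2 : ∀ y, ‖iteratedFDeriv ℝ 0 ((bracketOp (h ^ ρ))^[K] (b h)) y‖ₑ =
      ‖(bracketOp (h ^ ρ))^[K] (b h) y‖ₑ := fun y => by
    rw [← ofReal_norm, ← ofReal_norm, norm_iteratedFDeriv_zero]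
  simp only [h2] at h1
  refine (mul_le_mul' le_rfl h1).trans (le_of_eq ?_)
  rw [← ENNReal.ofReal_mul (by positivity)]
  ring_nf

theorem exists_eLpNorm_shiftedProduct_le (hρ1 : ρ ≤ 1) {μ : Measure ℝ} [IsFiniteMeasure μ]
    (hμ : ∀ᵐ t ∂μ, t ∈ Set.Icc (0 : ℝ) 1) {a b : ℝ → Phase n → ℂ} (ha : SymbolS 0 a)
    (hb : SymbolL1 ρ b) :
    ∃ C : ℝ, 0 ≤ C ∧ ∀ h ∈ Set.Ioc (0 : ℝ) 1,
      eLpNorm (shiftedProduct μ (Real.pi * h) (a h) (b h)) 1 volume ≤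
        ENNReal.ofReal (C * h ^ n) := by
  obtain ⟨C, hC0, hC⟩ := exists_lintegral_shift_le hρ1 ha hb
  refine ⟨μ.real Set.univ * C, by positivity, fun h hh => ?_⟩
  have h0 := hh.1
  have hat := ha.hasTemperateGrowth hh
  have hbd := hb.integrableDerivs hh
  let F : Phase n → ℝ → ℂ := fun z t => ∫ ζ, a h (z + (t * (Real.pi * h)) • sympJ n ζ) *
    (phaseFT (b h) ζ * phaseChar z ζ)
  have hF : StronglyMeasurable (Function.uncurry F) := by
    refine StronglyMeasurable.integral_prod_right' (f := fun q : (Phase n × ℝ) × Phase n =>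
      a h (q.1.1 + (q.1.2 * (Real.pi * h)) • sympJ n q.2) *
        (phaseFT (b h) q.2 * phaseChar q.1.1 q.2)) (Continuous.stronglyMeasurable ?_)
    have h1 := hat.1.continuous
    have h2 := hbd.continuous_phaseFT
    fun_prop
  have hQ : ∀ z, ‖shiftedProduct μ (Real.pi * h) (a h) (b h) z‖ₑ ≤ ∫⁻ t, ‖F z t‖ₑ ∂μ := by
    intro z
    rw [shiftedProduct, integral_prod_symm _ (integrable_shiftedProduct hμ _ hat hbd z)]
    exact enorm_integral_le_lintegral_enorm _
  rw [eLpNorm_one_eq_lintegral_enorm]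
  calc _ ≤ ∫⁻ z, ∫⁻ t, ‖F z t‖ₑ ∂μ := lintegral_mono hQ
    _ = ∫⁻ t, (∫⁻ z, ‖F z t‖ₑ) ∂μ := lintegral_lintegral_swap hF.enorm.aemeasurable
    _ ≤ ∫⁻ _, ENNReal.ofReal (C * h ^ n) ∂μ :=
        lintegral_mono_ae (hμ.mono fun t ht => hC h hh t ht)
    _ = _ := by
        rw [lintegral_const, mul_assoc, ENNReal.ofReal_mul measureReal_nonneg,
          ofReal_measureReal, mul_comm]

/-- The symbol estimate for averaged shifted products. A derivative of the product falls on `a`,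
which costs nothing, or on `b`, which costs a factor `h ^ (-ρ)`. -/
theorem SymbolL1.shiftedProduct (hρ0 : 0 ≤ ρ) (hρ1 : ρ ≤ 1) {μ : Measure ℝ} [IsFiniteMeasure μ]
    (hμ : ∀ᵐ t ∂μ, t ∈ Set.Icc (0 : ℝ) 1) {a b : ℝ → Phase n → ℂ} (ha : SymbolS 0 a)
    (hb : SymbolL1 ρ b) :
    SymbolL1 ρ fun h => shiftedProduct μ (Real.pi * h) (a h) (b h) := by
  have hsm : ∀ {a b : ℝ → Phase n → ℂ}, SymbolS 0 a → SymbolL1 ρ b → ∀ h ∈ Set.Ioc (0 : ℝ) 1,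
      ContDiff ℝ ∞ (Weyl.shiftedProduct μ (Real.pi * h) (a h) (b h)) := fun ha hb h hh =>
    (hasTemperateGrowth_shiftedProduct hμ _ (ha.hasTemperateGrowth hh)
      (hb.integrableDerivs hh)).1
  refine ⟨hsm ha hb, fun m => ?_⟩
  suffices H : ∃ C : ℝ, 0 ≤ C ∧ ∀ h ∈ Set.Ioc (0 : ℝ) 1,
      eLpNorm (iteratedFDeriv ℝ m (Weyl.shiftedProduct μ (Real.pi * h) (a h) (b h))) 1 volume ≤
        ENNReal.ofReal (C * h ^ n * h ^ (-(ρ * m))) by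
    obtain ⟨C, -, hC⟩ := H
    exact ⟨C, hC⟩
  induction m generalizing a b with
  | zero =>
    obtain ⟨C, hC0, hC⟩ := exists_eLpNorm_shiftedProduct_le hρ1 hμ ha hb
    refine ⟨C, hC0, fun h hh => ?_⟩
    simp only [Nat.cast_zero, mul_zero, neg_zero, Real.rpow_zero, mul_one]
    refine le_trans (le_of_eq ?_) (hC h hh)
    exact eLpNorm_congr_norm_ae (.of_forall fun z => norm_iteratedFDeriv_zero)
  | succ m ih =>
    obtain ⟨E, hE0, hE⟩ := exists_norm_iteratedFDeriv_succ_le (phaseBasis n)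
    choose C hC0 hC using fun α => ih (ha.dirDeriv (phaseBasis n α)) hb
    choose D hD0 hD using fun α => ih ha (hb.rpow_smul_dirDeriv (phaseBasis n α))
    refine ⟨E * ∑ α, (C α + D α), mul_nonneg hE0.le (Finset.sum_nonneg fun α _ =>
      add_nonneg (hC0 α) (hD0 α)), fun h hh => ?_⟩
    have h0 := hh.1
    have hat := ha.hasTemperateGrowth hh
    have hbd := hb.integrableDerivs hh
    set P := Weyl.shiftedProduct μ (Real.pi * h) (a h) (b h)
    have hdP : ∀ α, ContDiff ℝ ∞ (dirDeriv (phaseBasis n α) P) := fun α =>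
      contDiff_dirDeriv (hsm ha hb h hh) _
    have hpow : h ^ (-(ρ * m)) ≤ h ^ (-(ρ * (m + 1 : ℕ))) := by
      refine Real.rpow_le_rpow_of_exponent_ge h0 hh.2 ?_
      push_cast
      nlinarith
    have hpow' : (h ^ ρ)⁻¹ * h ^ (-(ρ * m)) = h ^ (-(ρ * (m + 1 : ℕ))) := by
      rw [← Real.rpow_neg h0.le, ← Real.rpow_add h0]
      congr 1
      push_cast
      ring
    have hα : ∀ α, eLpNorm (iteratedFDeriv ℝ m (dirDeriv (phaseBasis n α) P)) 1 volume ≤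
        ENNReal.ofReal ((C α + D α) * h ^ n * h ^ (-(ρ * (m + 1 : ℕ)))) := by
      intro α
      have hs1 := hsm (ha.dirDeriv (phaseBasis n α)) hb h hh
      have hs2 := hsm ha (hb.rpow_smul_dirDeriv (phaseBasis n α)) h hh
      have hne : ((h ^ ρ : ℝ) : ℂ) ≠ 0 := by
        exact_mod_cast (Real.rpow_pos_of_pos h0 ρ).ne'
      -- The derivative of `b` is rescaled by `h ^ ρ` so that it stays in the same symbol class.
      have e1 : dirDeriv (phaseBasis n α) P =
          Weyl.shiftedProduct μ (Real.pi * h) (dirDeriv (phaseBasis n α) (a h)) (b h) +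
          ((h ^ ρ : ℝ) : ℂ)⁻¹ • Weyl.shiftedProduct μ (Real.pi * h) (a h)
            (((h ^ ρ : ℝ) : ℂ) • dirDeriv (phaseBasis n α) (b h)) := by
        rw [dirDeriv_shiftedProduct hμ _ hat hbd, shiftedProduct_smul_right, smul_smul,
          inv_mul_cancel₀ hne, one_smul]
      have h3 : ‖((h ^ ρ : ℝ) : ℂ)⁻¹‖ₑ = ENNReal.ofReal ((h ^ ρ)⁻¹) := by
        rw [← ofReal_norm, norm_inv, Complex.norm_of_nonneg (by positivity)]
      have hm1 := (hs1.continuous_iteratedFDeriv (m := m)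
        (by exact_mod_cast le_top)).aestronglyMeasurable (μ := volume)
      have hm2 := ((contDiff_const_smul_fun hs2
        ((h ^ ρ : ℝ) : ℂ)⁻¹).continuous_iteratedFDeriv (m := m)
          (by exact_mod_cast le_top)).aestronglyMeasurable (μ := volume)
      rw [e1, iteratedFDeriv_add_of_smooth hs1 (contDiff_const_smul_fun hs2 _)]
      refine (eLpNorm_add_le hm1 hm2 le_rfl).trans ?_
      have hCα := hC0 α
      have hDα := hD0 α
      rw [add_mul, add_mul, ENNReal.ofReal_add (by positivity) (by positivity)]
      refine add_le_add ((hC α h hh).trans (ENNReal.ofReal_le_ofReal (by gcongr))) ?_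
      refine (eLpNorm_iteratedFDeriv_const_smul_le hs2 _ m).trans ?_
      rw [h3]
      refine (mul_le_mul' le_rfl (hD α h hh)).trans (le_of_eq ?_)
      rw [← ENNReal.ofReal_mul (by positivity), ← hpow']
      congr 1
      ring
    calc eLpNorm (iteratedFDeriv ℝ (m + 1) P) 1 volume
        ≤ ENNReal.ofReal E * eLpNorm (fun z => ∑ α,
            ‖iteratedFDeriv ℝ m (dirDeriv (phaseBasis n α) P) z‖) 1 volume := by
          refine eLpNorm_le_mul_eLpNorm_of_ae_le_mul (.of_forall fun z => ?_) 1
          rw [Real.norm_of_nonneg (Finset.sum_nonneg fun _ _ => norm_nonneg _)]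
          exact hE P (hsm ha hb h hh) m z
      _ ≤ ENNReal.ofReal E * ∑ α,
            eLpNorm (iteratedFDeriv ℝ m (dirDeriv (phaseBasis n α) P)) 1 volume := by
          gcongr
          have := eLpNorm_sum_le (μ := (volume : Measure (Phase n))) (p := 1) (s := Finset.univ)
            (f := fun α z => ‖iteratedFDeriv ℝ m (dirDeriv (phaseBasis n α) P) z‖)
            (fun α _ => ((hdP α).continuous_iteratedFDeriv (m := m)
              (by exact_mod_cast le_top)).norm.aestronglyMeasurable) le_rfl
          refine le_trans (le_of_eq ?_) (this.trans (le_of_eq ?_))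
          · congr 1
            ext z
            simp
          · simp only [eLpNorm_norm]
      _ ≤ ENNReal.ofReal E * ∑ α,
            ENNReal.ofReal ((C α + D α) * h ^ n * h ^ (-(ρ * (m + 1 : ℕ)))) := by
          gcongr with α
          exact hα α
      _ = _ := by
          rw [← ENNReal.ofReal_sum_of_nonneg fun α _ => by
            have := add_nonneg (hC0 α) (hD0 α)
            positivity, ← ENNReal.ofReal_mul hE0.le, ← Finset.sum_mul, ← Finset.sum_mul]
          congr 1
          ring

theorem poissonIter_shiftedProduct_smul_right (μ : Measure ℝ) (s : ℝ) (c : ℂ) (N : ℕ)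
    (a : Phase n → ℂ) {b : Phase n → ℂ} (hb : ContDiff ℝ ∞ b) :
    poissonIter (Weyl.shiftedProduct μ s) N a (c • b) =
      c • poissonIter (Weyl.shiftedProduct μ s) N a b := by
  induction N generalizing a b with
  | zero => exact shiftedProduct_smul_right μ s a b c
  | succ N ih =>
    simp only [poissonIter, Finset.smul_sum]
    refine Finset.sum_congr rfl fun α _ => ?_
    rw [dirDeriv_const_smul (hb.differentiable (by simp))]
    exact ih _ (contDiff_dirDeriv hb _)

/-- The remainder terms of the Moyal expansion: each of the `N` derivatives falling on `b` costs a
factor `h ^ (-ρ)`, and only derivatives of `a` of order at least `N ≥ k` occur. -/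
theorem SymbolL1.poissonIter_shiftedProduct (hρ0 : 0 ≤ ρ) (hρ1 : ρ ≤ 1) {μ : Measure ℝ}
    [IsFiniteMeasure μ] (hμ : ∀ᵐ t ∂μ, t ∈ Set.Icc (0 : ℝ) 1) (N : ℕ) {k : ℕ} (hk : k ≤ N)
    {a b : ℝ → Phase n → ℂ} (ha : SymbolS k a) (hb : SymbolL1 ρ b) :
    SymbolL1 ρ fun h => (((h ^ ρ) ^ N : ℝ) : ℂ) •
      poissonIter (Weyl.shiftedProduct μ (Real.pi * h)) N (a h) (b h) := by
  induction N generalizing k a b with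
  | zero =>
    obtain rfl : k = 0 := by omega
    simpa using! SymbolL1.shiftedProduct hρ0 hρ1 hμ ha hb
  | succ N ih =>
    refine (SymbolL1.sum Finset.univ fun α => ih (k := k - 1) (by omega)
      (ha.dirDeriv (phaseBasis n α))
      (hb.rpow_smul_dirDeriv (sympJ n (phaseBasis n α)))).congr fun h hh => ?_
    rw [poissonIter, Finset.smul_sum]
    refine Finset.sum_congr rfl fun α _ => ?_
    rw [poissonIter_shiftedProduct_smul_right _ _ _ _ _ (contDiff_dirDeriv (hb.1 h hh) _),
      smul_smul, pow_succ, Complex.ofReal_mul]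

end SymbolBounds

/-! ### Superpositions of phase space translations -/

section PhaseTranslations

variable {n : ℕ}

/-- The superposition, with weight `b̂`, of the phase space translations
`u ↦ exp (2 π i ⟪x + s q, p⟫) u (x + 2 s q)`, `ζ = (p, q)`. Each translation with `s = π h` is the
Weyl quantization of the character `exp (2 π i ⟪z, ζ⟫)`, so for this value of `s` the superposition
is `Op_h(b) u`. -/
def translationAverage (s : ℝ) (b : Phase n → ℂ) (u : Config n → ℂ) (x : Config n) : ℂ :=
  ∫ ζ : Phase n, phaseFT b ζ * (phaseChar (x + s • ζ.2, 0) ζ * u (x + (2 * s) • ζ.2))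

theorem exists_pow_mul_norm_schwartz_le (u : 𝓢(Config n, ℂ)) (k : ℕ) :
    ∃ C : ℝ, 0 ≤ C ∧ ∀ y, (1 + ‖y‖) ^ k * ‖u y‖ ≤ C :=
  ⟨_, apply_nonneg _ _, fun y => by simpa using le_domSeminorm k 0 u y⟩

theorem norm_snd_smul_le (r : ℝ) (ζ : Phase n) : ‖r • ζ.2‖ ≤ |r| * ‖ζ‖ := by
  rw [norm_smul, Real.norm_eq_abs]
  gcongr
  exact le_max_right _ _

theorem integrable_translationAverage {V : Type*} [NormedAddCommGroup V] [NormedSpace ℂ V]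
    {b : Phase n → ℂ} (hb : IntegrableDerivs b) {G : Phase n → V} (hG : Continuous G) {C : ℝ}
    {k : ℕ} (h : ∀ ζ, ‖G ζ‖ ≤ C * (1 + ‖ζ‖) ^ k) : Integrable fun ζ => phaseFT b ζ • G ζ := by
  refine ((hb.integrable_pow_mul_phaseFT k).const_mul C).mono'
    (hb.continuous_phaseFT.smul hG).aestronglyMeasurable (.of_forall fun ζ => ?_)
  rw [norm_smul]
  calc _ ≤ ‖phaseFT b ζ‖ * (C * (1 + ‖ζ‖) ^ k) := by gcongr; exact h ζ
    _ = _ := by ring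

theorem integrable_translationAverage_integrand (s : ℝ) {b : Phase n → ℂ}
    (hb : IntegrableDerivs b) (u : 𝓢(Config n, ℂ)) (x : Config n) :
    Integrable fun ζ : Phase n =>
      phaseFT b ζ * (phaseChar (x + s • ζ.2, 0) ζ * u (x + (2 * s) • ζ.2)) := by
  obtain ⟨C, hC0, hC⟩ := exists_pow_mul_norm_schwartz_le u 0
  have hu := u.continuous
  refine integrable_translationAverage hb (C := C) (k := 0)
    (G := fun ζ => phaseChar (x + s • ζ.2, 0) ζ * u (x + (2 * s) • ζ.2)) (by fun_prop)
    fun ζ => ?_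
  rw [norm_mul, norm_phaseChar]
  simpa using hC (x + (2 * s) • ζ.2)

theorem exists_pow_mul_norm_translationAverage_le (s : ℝ) {b : Phase n → ℂ}
    (hb : IntegrableDerivs b) (u : 𝓢(Config n, ℂ)) (k : ℕ) :
    ∃ C : ℝ, ∀ x, ‖x‖ ^ k * ‖translationAverage s b u x‖ ≤ C := by
  obtain ⟨C, hC0, hC⟩ := exists_pow_mul_norm_schwartz_le u k
  refine ⟨∫ ζ : Phase n, (C * (1 + 2 * |s|) ^ k) * ((1 + ‖ζ‖) ^ k * ‖phaseFT b ζ‖), fun x => ?_⟩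
  rw [translationAverage]
  refine (mul_le_mul_of_nonneg_left (norm_integral_le_integral_norm _) (by positivity)).trans ?_
  rw [← integral_const_mul]
  refine integral_mono ((integrable_translationAverage_integrand s hb u x).norm.const_mul _)
    ((hb.integrable_pow_mul_phaseFT k).const_mul _) fun ζ => ?_
  dsimp only
  rw [norm_mul, norm_mul, norm_phaseChar, one_mul]
  -- Growth in `x` is shared between the argument of `u` and the weight `b̂`.
  set y := x + (2 * s) • ζ.2 with hy
  have h1 : ‖x‖ ≤ (1 + 2 * |s|) * (1 + ‖ζ‖) * (1 + ‖y‖) := by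
    have h2 : ‖x‖ ≤ ‖y‖ + 2 * |s| * ‖ζ‖ := by
      calc ‖x‖ = ‖y - (2 * s) • ζ.2‖ := by rw [hy, add_sub_cancel_right]
        _ ≤ ‖y‖ + ‖(2 * s) • ζ.2‖ := norm_sub_le _ _
        _ ≤ ‖y‖ + |2 * s| * ‖ζ‖ := by gcongr; exact norm_snd_smul_le _ _
        _ = _ := by rw [abs_mul, abs_two]
    have h3 := abs_nonneg s
    have h4 := norm_nonneg ζ
    have h5 := norm_nonneg y
    nlinarith [mul_nonneg h3 h4, mul_nonneg h3 h5, mul_nonneg h4 h5,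
      mul_nonneg (mul_nonneg h3 h4) h5]
  calc ‖x‖ ^ k * (‖phaseFT b ζ‖ * ‖u y‖)
      ≤ ((1 + 2 * |s|) * (1 + ‖ζ‖) * (1 + ‖y‖)) ^ k * (‖phaseFT b ζ‖ * ‖u y‖) := by gcongr
    _ = (1 + 2 * |s|) ^ k * (1 + ‖ζ‖) ^ k * ‖phaseFT b ζ‖ * ((1 + ‖y‖) ^ k * ‖u y‖) := by
        rw [mul_pow, mul_pow]; ring
    _ ≤ (1 + 2 * |s|) ^ k * (1 + ‖ζ‖) ^ k * ‖phaseFT b ζ‖ * C := by gcongr; exact hC y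
    _ = _ := by ring

/-- The Leibniz rule: a derivative of the superposition falls on the characters, where it turns into
a position derivative of `b`, or on `u`. -/
theorem exists_hasFDerivAt_translationAverage (s : ℝ) {b : Phase n → ℂ}
    (hb : IntegrableDerivs b) (u : 𝓢(Config n, ℂ)) (x : Config n) :
    ∃ A : Config n →L[ℝ] ℂ, HasFDerivAt (translationAverage s b u) A x ∧
      ∀ v, A v = translationAverage s (dirDeriv (v, 0) b) u x +
        translationAverage s b (LineDeriv.lineDerivOp v u : 𝓢(Config n, ℂ)) x := by
  obtain ⟨C, hC0, hC⟩ := exists_pow_mul_norm_schwartz_le u 0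
  let D : ℝ := domSeminorm (Config n) ℂ 0 1 u
  have hD0 : 0 ≤ D := apply_nonneg _ _
  have hD : ∀ y, ‖fderiv ℝ u y‖ ≤ D := fun y => by
    have := le_domSeminorm 0 1 u y
    rwa [pow_zero, one_mul, norm_iteratedFDeriv_one] at this
  let L : Phase n → Config n →L[ℝ] ℂ := fun ζ =>
    Complex.ofRealCLM ∘L ((dualForm n).flip ζ ∘L ContinuousLinearMap.inl ℝ (Config n) (Config n))
  have hL : ∀ ζ, ‖L ζ‖ ≤ ‖ζ‖ := fun ζ => by
    refine ContinuousLinearMap.opNorm_le_bound _ (norm_nonneg _) fun v => ?_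
    have h1 : L ζ v = ((⟪v, ζ.1⟫ : ℝ) : ℂ) := by simp [L, dualForm_apply]
    rw [h1, Complex.norm_real, mul_comm]
    refine (norm_inner_le_norm _ _).trans ?_
    gcongr
    exact le_max_left _ _
  have hLc : Continuous L :=
    continuous_const.clm_comp ((dualForm n).flip.continuous.clm_comp continuous_const)
  let G : Config n → Phase n → Config n →L[ℝ] ℂ := fun x ζ =>
    phaseChar (x + s • ζ.2, 0) ζ • (fderiv ℝ u (x + (2 * s) • ζ.2) +
      (u (x + (2 * s) • ζ.2) * (2 * Real.pi * Complex.I)) • L ζ)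
  have hG : ∀ x ζ, ‖G x ζ‖ ≤ (D + C * (2 * Real.pi)) * (1 + ‖ζ‖) ^ 1 := by
    intro x ζ
    have h5 : ‖(2 * Real.pi * Complex.I : ℂ)‖ = 2 * Real.pi := by
      simp [abs_of_nonneg Real.pi_nonneg]
    have h1 := hC (x + (2 * s) • ζ.2)
    rw [pow_zero, one_mul] at h1
    rw [norm_smul, norm_phaseChar, one_mul]
    refine (norm_add_le _ _).trans ?_
    rw [norm_smul, norm_mul, h5]
    have h2 : ‖u (x + (2 * s) • ζ.2)‖ * (2 * Real.pi) * ‖L ζ‖ ≤ C * (2 * Real.pi) * ‖ζ‖ := by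
      gcongr
      exact hL ζ
    have h3 := hD (x + (2 * s) • ζ.2)
    have h4 := norm_nonneg ζ
    have h6 : 0 ≤ C * (2 * Real.pi) := by positivity
    nlinarith [mul_nonneg hD0 h4]
  have hGc : ∀ x, Continuous (G x) := fun x => by
    have h1 := u.continuous
    have h2 : Continuous (fderiv ℝ u) := (u.smooth ⊤).continuous_fderiv (by simp)
    fun_prop
  have hd : ∀ x ζ, HasFDerivAt (fun x : Config n =>
      phaseFT b ζ * (phaseChar (x + s • ζ.2, 0) ζ * u (x + (2 * s) • ζ.2)))
      (phaseFT b ζ • G x ζ) x := by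
    intro x ζ
    have h1 : HasFDerivAt (fun x : Config n => u (x + (2 * s) • ζ.2))
        (fderiv ℝ u (x + (2 * s) • ζ.2)) x :=
      (u.hasFDerivAt _).comp x ((hasFDerivAt_id x).add_const _)
    have h2 : HasFDerivAt (fun x : Config n => (x + s • ζ.2, (0 : Config n)))
        (ContinuousLinearMap.inl ℝ (Config n) (Config n)) x := by
      have := ((hasFDerivAt_id (𝕜 := ℝ) x).add_const (s • ζ.2)).prodMk
        (hasFDerivAt_const (0 : Config n) x)
      exact this
    have h3 := (hasFDerivAt_phaseChar (x + s • ζ.2, 0) ζ).comp x h2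
    refine ((h3.mul h1).const_mul (phaseFT b ζ)).congr_fderiv ?_
    ext v
    simp [G, L]
    left
    ring
  have hI : ∀ x, Integrable fun ζ => phaseFT b ζ • G x ζ := fun x =>
    integrable_translationAverage hb (hGc x) (hG x)
  refine ⟨∫ ζ, phaseFT b ζ • G x ζ, ?_, fun v => ?_⟩
  · refine hasFDerivAt_integral_of_dominated_of_fderiv_le (s := Set.univ) Filter.univ_mem
      (.of_forall fun x => (integrable_translationAverage_integrand s hb u x).aestronglyMeasurable)
      (integrable_translationAverage_integrand s hb u x) (hI x).aestronglyMeasurable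
      (.of_forall fun ζ x _ => ?_)
      ((hb.integrable_pow_mul_phaseFT 1).const_mul (D + C * (2 * Real.pi)))
      (.of_forall fun ζ x _ => hd x ζ)
    rw [norm_smul]
    calc _ ≤ ‖phaseFT b ζ‖ * ((D + C * (2 * Real.pi)) * (1 + ‖ζ‖) ^ 1) := by
          gcongr
          exact hG x ζ
      _ = _ := by ring
  · rw [ContinuousLinearMap.integral_apply (hI x)]
    simp only [translationAverage]
    rw [← integral_add (integrable_translationAverage_integrand s (hb.dirDeriv (v, 0)) u x)
      (integrable_translationAverage_integrand s hb _ x)]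
    refine integral_congr_ae (.of_forall fun ζ => ?_)
    simp only [G, L, hb.phaseFT_dirDeriv, smul_apply, add_apply, smul_eq_mul,
      ContinuousLinearMap.comp_apply, ContinuousLinearMap.flip_apply, Complex.ofRealCLM_apply,
      ContinuousLinearMap.inl_apply, lineDerivOp_apply_eq_fderiv]
    ring

/-- A superposition of phase space translations with rapidly decreasing weight preserves the
Schwartz space. -/
theorem exists_schwartzMap_eq_translationAverage (s : ℝ) {b : Phase n → ℂ}
    (hb : IntegrableDerivs b) (u : 𝓢(Config n, ℂ)) :
    ∃ w : 𝓢(Config n, ℂ), ∀ x, w x = translationAverage s b u x := by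
  -- Finite sums of such superpositions are stable under derivatives, by the Leibniz rule.
  let T : Set (Config n → ℂ) := {f | ∃ (b : Phase n → ℂ) (u : 𝓢(Config n, ℂ)),
    IntegrableDerivs b ∧ f = translationAverage s b u}
  let S := AddSubmonoid.closure T
  have hS : ∀ f ∈ S, Differentiable ℝ f ∧ ∀ v, dirDeriv v f ∈ S := by
    intro f hf
    induction hf using AddSubmonoid.closure_induction with
    | mem f hf =>
      obtain ⟨b, u, hb, rfl⟩ := hf
      choose A hA hA' using exists_hasFDerivAt_translationAverage s hb u
      refine ⟨fun x => (hA x).differentiableAt, fun v => ?_⟩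
      have e : dirDeriv v (translationAverage s b u) =
          translationAverage s (dirDeriv (v, 0) b) u +
            translationAverage s b (LineDeriv.lineDerivOp v u : 𝓢(Config n, ℂ)) := by
        ext x
        rw [dirDeriv, (hA x).fderiv, hA']
        rfl
      rw [e]
      exact S.add_mem (AddSubmonoid.subset_closure ⟨_, _, hb.dirDeriv _, rfl⟩)
        (AddSubmonoid.subset_closure ⟨_, _, hb, rfl⟩)
    | zero => exact ⟨differentiable_const 0, fun v => by rw [dirDeriv_zero]; exact S.zero_mem⟩
    | add f g _ _ hf hg =>
      refine ⟨hf.1.add hg.1, fun v => ?_⟩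
      rw [dirDeriv_add hf.1 hg.1]
      exact S.add_mem (hf.2 v) (hg.2 v)
  have hmem : translationAverage s b u ∈ S := AddSubmonoid.subset_closure ⟨b, u, hb, rfl⟩
  refine ⟨⟨translationAverage s b u,
    contDiff_of_dirDeriv_mem (S := S) (fun f hf => (hS f hf).1) (fun f hf => (hS f hf).2) hmem,
    fun k m => decay_of_dirDeriv_mem (S := S) (fun f hf => (hS f hf).1) (fun f hf => (hS f hf).2)
      k (fun f hf => ?_) m hmem⟩, fun x => rfl⟩
  induction hf using AddSubmonoid.closure_induction with
  | mem f hf =>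
    obtain ⟨b, u, hb, rfl⟩ := hf
    exact exists_pow_mul_norm_translationAverage_le s hb u k
  | zero => exact ⟨0, by simp⟩
  | add f g _ _ hf hg =>
    obtain ⟨C, hC⟩ := hf
    obtain ⟨D, hD⟩ := hg
    refine ⟨C + D, fun x => ?_⟩
    refine (mul_le_mul_of_nonneg_left (norm_add_le _ _) (by positivity)).trans ?_
    rw [mul_add]
    exact add_le_add (hC x) (hD x)

end PhaseTranslations

/-! ### Composition of Weyl quantizations -/

section Composition

variable {n : ℕ}

theorem integrable_schwartz_comp_wigner_arg (v : 𝓢(Config n, ℂ)) (X : Config n) :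
    Integrable fun s : Config n => v (X + (1 / 2 : ℝ) • s) :=
  (v.integrable.comp_add_left X).comp_smul (by norm_num : (1 / 2 : ℝ) ≠ 0)

/-- A phase space translation of `u` translates the Wigner transform `W(u, v)` and multiplies it by
a character. -/
theorem wignerCLM_translationAverage {h : ℝ} (hh : 0 < h) {b : Phase n → ℂ}
    (hb : IntegrableDerivs b) (u v w : 𝓢(Config n, ℂ))
    (hw : ∀ x, w x = translationAverage (Real.pi * h) b u x) (z : Phase n) :
    wignerCLM hh w v z = ∫ ζ, phaseFT b ζ *
      (phaseChar z ζ * wignerCLM hh u v (z - (Real.pi * h) • sympJ n ζ)) := by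
  set r := Real.pi * h with hr
  obtain ⟨C, hC0, hC⟩ := exists_pow_mul_norm_schwartz_le u 0
  let F : Config n → Phase n → ℂ := fun s ζ =>
    Complex.exp (Complex.I * (⟪s, z.2⟫ / h : ℝ)) *
      (phaseFT b ζ * (phaseChar (z.1 - (1 / 2 : ℝ) • s + r • ζ.2, 0) ζ *
        u (z.1 - (1 / 2 : ℝ) • s + (2 * r) • ζ.2)) * v (z.1 + (1 / 2 : ℝ) • s))
  have hexp : ∀ t : ℝ, ‖Complex.exp (Complex.I * t)‖ = 1 := fun t => by
    rw [mul_comm, Complex.norm_exp_ofReal_mul_I]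
  have hF : Integrable (Function.uncurry F) := by
    refine (((integrable_schwartz_comp_wigner_arg v z.1).norm.mul_prod
      (hb.integrable_phaseFT.norm)).const_mul C).mono' (Continuous.aestronglyMeasurable ?_)
      (.of_forall fun p => ?_)
    · have h1 := u.continuous
      have h2 := v.continuous
      have h3 := hb.continuous_phaseFT
      simp only [F, Function.uncurry_def]
      fun_prop
    · have h1 := hC (z.1 - (1 / 2 : ℝ) • p.1 + (2 * r) • p.2.2)
      rw [pow_zero, one_mul] at h1
      simp only [F, Function.uncurry_def, norm_mul, hexp, norm_phaseChar, one_mul]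
      calc _ ≤ ‖phaseFT b p.2‖ * C * ‖v (z.1 + (1 / 2 : ℝ) • p.1)‖ := by gcongr
        _ = _ := by ring
  have h1 : wignerCLM hh w v z = ∫ s, ∫ ζ, F s ζ := by
    rw [wignerCLM_apply]
    refine integral_congr_ae (.of_forall fun s => ?_)
    simp only [F, hw, translationAverage]
    rw [← integral_mul_const, ← integral_const_mul]
  rw [h1, integral_integral_swap hF]
  refine integral_congr_ae (.of_forall fun ζ => ?_)
  -- The substitution `s ↦ s + 2 π h q` recentres the arguments of `u` and `v`.
  dsimp only
  rw [← integral_add_right_eq_self _ ((2 * r) • ζ.2), wignerCLM_apply, ← integral_const_mul,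
    ← integral_const_mul]
  refine integral_congr_ae (.of_forall fun s => ?_)
  have e1 : z.1 - (1 / 2 : ℝ) • (s + (2 * r) • ζ.2) + (2 * r) • ζ.2 =
      (z - r • sympJ n ζ).1 - (1 / 2 : ℝ) • s := by
    simp only [Prod.fst_sub, Prod.smul_fst, sympJ_apply]
    module
  have e2 : z.1 + (1 / 2 : ℝ) • (s + (2 * r) • ζ.2) =
      (z - r • sympJ n ζ).1 + (1 / 2 : ℝ) • s := by
    simp only [Prod.fst_sub, Prod.smul_fst, sympJ_apply]
    module
  have e3 : z.1 - (1 / 2 : ℝ) • (s + (2 * r) • ζ.2) + r • ζ.2 = z.1 - (1 / 2 : ℝ) • s := by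
    module
  have e4 : Complex.exp (Complex.I * (⟪s + (2 * r) • ζ.2, z.2⟫ / h : ℝ)) *
      phaseChar (z.1 - (1 / 2 : ℝ) • s, 0) ζ = phaseChar z ζ *
        Complex.exp (Complex.I * (⟪s, (z - r • sympJ n ζ).2⟫ / h : ℝ)) := by
    simp only [phaseChar, Real.fourierChar_apply, dualForm_apply, ← Complex.exp_add]
    congr 1
    have hh' : (h : ℂ) ≠ 0 := by exact_mod_cast hh.ne'
    simp only [inner_add_left, inner_sub_left, inner_sub_right, real_inner_smul_left,
      real_inner_smul_right, Prod.snd_sub, Prod.smul_snd, sympJ_apply, inner_zero_left, hr,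
      real_inner_comm z.2 ζ.2]
    push_cast
    field_simp
    ring
  simp only [F]
  rw [e1, e2, e3]
  linear_combination (phaseFT b ζ * u ((z - r • sympJ n ζ).1 - (1 / 2 : ℝ) • s) *
    v ((z - r • sympJ n ζ).1 + (1 / 2 : ℝ) • s)) * e4

/-- Composition with a superposition of phase space translations, in terms of symbols. -/
theorem integral_wignerCLM_translationAverage {h : ℝ} (hh : 0 < h) {a b : Phase n → ℂ}
    (ha : a.HasTemperateGrowth) (hb : IntegrableDerivs b) (u v w : 𝓢(Config n, ℂ))
    (hw : ∀ x, w x = translationAverage (Real.pi * h) b u x) :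
    ∫ z, wignerCLM hh w v z * a z =
      ∫ z, wignerCLM hh u v z * shiftedProduct (Measure.dirac 1) (Real.pi * h) a b z := by
  set r := Real.pi * h
  set W := wignerCLM hh u v
  obtain ⟨k, C, hC0, hC⟩ := ha.norm_iteratedFDeriv_le_uniform 0
  replace hC : ∀ z, ‖a z‖ ≤ C * (1 + ‖z‖) ^ k := fun z => by
    simpa using hC 0 le_rfl z
  let d := Module.finrank ℝ (Phase n) + 1
  let D : ℝ := domSeminorm (Phase n) ℂ (k + d) 0 W
  have hD0 : 0 ≤ D := apply_nonneg _ _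
  have hD : ∀ z, (1 + ‖z‖) ^ (k + d) * ‖W z‖ ≤ D := fun z => by
    simpa using le_domSeminorm (k + d) 0 W z
  have hac := ha.1.continuous
  have hWc := W.continuous
  have hbc := hb.continuous_phaseFT
  have hi : Integrable fun p : Phase n × Phase n =>
      ((1 + ‖p.1‖) ^ d)⁻¹ * ((1 + ‖p.2‖) ^ (k + d) * ‖phaseFT b p.2‖) :=
    (integrable_inv_one_add_norm_pow (Nat.lt_succ_self _)).mul_prod
      (hb.integrable_pow_mul_phaseFT (k + d))
  -- Both double integrals converge absolutely: the decrease of the Wigner transform at `z - r J ζ`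
  -- yields decrease in `z` at the expense of growth in `ζ`, which `b̂` compensates.
  clear_value d
  have h1 : Integrable (Function.uncurry fun z ζ : Phase n =>
      a z * (phaseFT b ζ * (phaseChar z ζ * W (z - r • sympJ n ζ)))) := by
    refine (hi.const_mul (C * (1 + |r|) ^ (k + d) * D)).mono'
      (Continuous.aestronglyMeasurable (by simp only [Function.uncurry_def]; fun_prop))
      (.of_forall fun p => ?_)
    obtain ⟨z, ζ⟩ := p
    simp only [Function.uncurry_apply_pair, norm_mul, norm_phaseChar, one_mul]
    set y := z - r • sympJ n ζ with hy
    have h2 : 1 + ‖z‖ ≤ (1 + |r|) * (1 + ‖y‖) * (1 + ‖ζ‖) := by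
      have := one_add_norm_shift_le y ζ (t := 1) (by simp) r
      rwa [one_mul, hy, sub_add_cancel] at this
    have h3 : (1 + ‖z‖) ^ (k + d) * ‖W y‖ ≤ ((1 + |r|) * (1 + ‖ζ‖)) ^ (k + d) * D := by
      calc _ ≤ ((1 + |r|) * (1 + ‖y‖) * (1 + ‖ζ‖)) ^ (k + d) * ‖W y‖ := by gcongr
        _ = ((1 + |r|) * (1 + ‖ζ‖)) ^ (k + d) * ((1 + ‖y‖) ^ (k + d) * ‖W y‖) := by
            rw [mul_pow, mul_pow, mul_pow]; ring
        _ ≤ _ := by gcongr; exact hD y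
    have hz : (0 : ℝ) < (1 + ‖z‖) ^ d := by positivity
    calc ‖a z‖ * (‖phaseFT b ζ‖ * ‖W y‖)
        ≤ (C * (1 + ‖z‖) ^ k) * (‖phaseFT b ζ‖ * ‖W y‖) := by gcongr; exact hC z
      _ = C * ‖phaseFT b ζ‖ * ((1 + ‖z‖) ^ d)⁻¹ * ((1 + ‖z‖) ^ (k + d) * ‖W y‖) := by
          rw [pow_add]; field_simp
      _ ≤ C * ‖phaseFT b ζ‖ * ((1 + ‖z‖) ^ d)⁻¹ * (((1 + |r|) * (1 + ‖ζ‖)) ^ (k + d) * D) := by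
          gcongr
      _ = _ := by rw [mul_pow]; ring
  have h4 : Integrable (Function.uncurry fun z ζ : Phase n =>
      a (z + r • sympJ n ζ) * (phaseFT b ζ * (phaseChar z ζ * W z))) := by
    refine (hi.const_mul (C * (1 + |r|) ^ k * D)).mono'
      (Continuous.aestronglyMeasurable (by simp only [Function.uncurry_def]; fun_prop))
      (.of_forall fun p => ?_)
    obtain ⟨z, ζ⟩ := p
    simp only [Function.uncurry_apply_pair, norm_mul, norm_phaseChar, one_mul]
    have h2 : 1 + ‖z + r • sympJ n ζ‖ ≤ (1 + |r|) * (1 + ‖z‖) * (1 + ‖ζ‖) := by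
      have := one_add_norm_shift_le z ζ (t := 1) (by simp) r
      rwa [one_mul] at this
    have hz : (0 : ℝ) < (1 + ‖z‖) ^ d := by positivity
    have hζ : (1 + ‖ζ‖) ^ k ≤ (1 + ‖ζ‖) ^ (k + d) := by
      gcongr
      · linarith [norm_nonneg ζ]
      · omega
    calc ‖a (z + r • sympJ n ζ)‖ * (‖phaseFT b ζ‖ * ‖W z‖)
        ≤ (C * ((1 + |r|) * (1 + ‖z‖) * (1 + ‖ζ‖)) ^ k) * (‖phaseFT b ζ‖ * ‖W z‖) := by
          gcongr
          exact (hC _).trans (by gcongr)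
      _ = C * (1 + |r|) ^ k * ‖phaseFT b ζ‖ * (1 + ‖ζ‖) ^ k * ((1 + ‖z‖) ^ d)⁻¹ *
            ((1 + ‖z‖) ^ (k + d) * ‖W z‖) := by
          rw [pow_add, mul_pow, mul_pow]; field_simp
      _ ≤ C * (1 + |r|) ^ k * ‖phaseFT b ζ‖ * (1 + ‖ζ‖) ^ (k + d) * ((1 + ‖z‖) ^ d)⁻¹ * D := by
          gcongr
          exact hD z
      _ = _ := by ring
  calc ∫ z, wignerCLM hh w v z * a z
      = ∫ z, ∫ ζ, a z * (phaseFT b ζ * (phaseChar z ζ * W (z - r • sympJ n ζ))) := by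
        refine integral_congr_ae (.of_forall fun z => ?_)
        dsimp only
        rw [wignerCLM_translationAverage hh hb u v w hw, mul_comm, ← integral_const_mul]
    _ = ∫ ζ, ∫ z, a z * (phaseFT b ζ * (phaseChar z ζ * W (z - r • sympJ n ζ))) :=
        integral_integral_swap h1
    _ = ∫ ζ, ∫ z, a (z + r • sympJ n ζ) * (phaseFT b ζ * (phaseChar z ζ * W z)) := by
        refine integral_congr_ae (.of_forall fun ζ => ?_)
        dsimp only
        rw [← integral_add_right_eq_self _ (r • sympJ n ζ)]
        refine integral_congr_ae (.of_forall fun z => ?_)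
        dsimp only
        -- The character `exp (2 π i ⟨z, ζ⟩)` is constant in the direction `J ζ`.
        rw [add_sub_cancel_right, phaseChar_add, phaseChar_smul_sympJ, mul_one]
    _ = ∫ z, ∫ ζ, a (z + r • sympJ n ζ) * (phaseFT b ζ * (phaseChar z ζ * W z)) :=
        (integral_integral_swap h4).symm
    _ = _ := by
        refine integral_congr_ae (.of_forall fun z => ?_)
        dsimp only
        rw [shiftedProduct_dirac_one _ hb ha, ← integral_const_mul]
        refine integral_congr_ae (.of_forall fun ζ => ?_)
        dsimp only
        ring

theorem integrable_slice_fst (F : 𝓢(Phase n, ℂ)) (X : Config n) :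
    Integrable fun s => F (X, s) := by
  simpa using integrable_slice F (X, 0)

/-- Fourier inversion in the second variable, at the origin. -/
theorem integral_partialFourierCLM (F : 𝓢(Phase n, ℂ)) (X : Config n) :
    ∫ η, partialFourierCLM (Config n) F (X, η) = F (X, 0) := by
  have hc : Continuous fun s => F (X, s) := F.continuous.comp (by fun_prop)
  have h1 : 𝓕 (fun s => F (X, s)) = fun η => partialFourierCLM (Config n) F (X, η) := by
    ext η
    rw [Real.fourier_eq, partialFourierCLM_apply]
  have h2 := congrFun (hc.fourierInv_fourier_eq (integrable_slice_fst F X)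
    (h1 ▸ integrable_slice_fst (partialFourierCLM (Config n) F) X)) 0
  rw [← h2, h1, Real.fourierInv_eq]
  simp

/-- The Wigner transform has total mass `∫ W(w, v) = (2 π h)ⁿ ∫ w v`; in other words, the Weyl
quantization of the constant symbol `1` is the identity. -/
theorem integral_wignerCLM {h : ℝ} (hh : 0 < h) (w v : 𝓢(Config n, ℂ)) :
    ∫ z, wignerCLM hh w v z = ((2 * Real.pi * h) ^ n : ℂ) * ∫ x, w x * v x := by
  let F : 𝓢(Phase n, ℂ) := compCLMOfContinuousLinearEquiv ℂ (shear n) (tensorCLM w v)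
  have h1 : ∀ X ξ, wignerCLM hh w v (X, ξ) =
      partialFourierCLM (Config n) F (X, (-(2 * Real.pi * h)⁻¹) • ξ) := fun X ξ => rfl
  have h2 : ∀ X, F (X, 0) = w X * v X := fun X => by
    change w (X - (1 / 2 : ℝ) • 0) * v (X + (1 / 2 : ℝ) • 0) = _
    simp
  have h0 : 0 < 2 * Real.pi * h := by positivity
  have hI := (wignerCLM hh w v).integrable (μ := volume)
  rw [Measure.volume_eq_prod] at hI ⊢
  rw [integral_prod _ hI,
    ← integral_const_mul]
  refine integral_congr_ae (.of_forall fun X => ?_)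
  simp only [h1]
  rw [Measure.integral_comp_smul volume fun η => partialFourierCLM (Config n) F (X, η),
    integral_partialFourierCLM, h2, finrank_euclideanSpace_fin, neg_pow, inv_pow, mul_inv, inv_inv,
    abs_mul, abs_inv, abs_pow, abs_neg, abs_one, one_pow, inv_one, one_mul,
    abs_of_pos (pow_pos h0 n), Complex.real_smul]
  push_cast
  rfl

theorem hasTemperateGrowth_one : (fun _ : Phase n => (1 : ℂ)).HasTemperateGrowth :=
  .const 1

theorem shiftedProduct_dirac_one_one_left (s : ℝ) {b : Phase n → ℂ} (hb : IntegrableDerivs b)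
    (z : Phase n) : shiftedProduct (Measure.dirac 1) s (fun _ => 1) b z = b z := by
  rw [shiftedProduct_dirac_one s hb hasTemperateGrowth_one]
  simp only [one_mul]
  exact hb.integral_phaseFT_mul_phaseChar z

theorem Represents.apply_eq_integral {T : 𝓢'(Phase n, ℂ)} {f : Phase n → ℂ} (h : Represents T f)
    (g : 𝓢(Phase n, ℂ)) : T g = ∫ z, g z * f z := by
  obtain ⟨hf, rfl⟩ := h
  rfl

/-- The Weyl quantization of a symbol with integrable derivatives is the superposition of phase
space translations given by its Fourier transform, and the quantizations compose by
`shiftedProduct`. -/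
theorem weylOp_comp {h : ℝ} (hh : 0 < h) {a b : Phase n → ℂ} (ha : a.HasTemperateGrowth)
    (hb : IntegrableDerivs b) {A B c : 𝓢'(Phase n, ℂ)} (hA : Represents A a)
    (hB : Represents B b)
    (hc : Represents c (shiftedProduct (Measure.dirac 1) (Real.pi * h) a b))
    (u : 𝓢(Config n, ℂ)) :
    ∃ w : 𝓢(Config n, ℂ), weylOp hh B u = toTemperedDistributionCLM (Config n) ℂ volume w ∧
      weylOp hh A w = weylOp hh c u := by
  obtain ⟨w, hw⟩ := exists_schwartzMap_eq_translationAverage (Real.pi * h) hb u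
  refine ⟨w, ?_, ?_⟩
  -- For the constant symbol `1` in place of `a` the composition formula identifies `Op_h(b) u`.
  · ext v
    have key := integral_wignerCLM_translationAverage hh hasTemperateGrowth_one hb u v w hw
    simp only [shiftedProduct_dirac_one_one_left _ hb, mul_one] at key
    have h0 : ((2 * Real.pi * h) ^ n : ℂ) ≠ 0 := by
      have : (2 * Real.pi * h) ^ n ≠ 0 := by positivity
      exact_mod_cast this
    rw [weylOp_apply, hB.apply_eq_integral, ← key, integral_wignerCLM, inv_mul_cancel_left₀ h0,
      toTemperedDistributionCLM_apply_apply volume w v]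
    simp only [smul_eq_mul, mul_comm]
  · ext v
    rw [weylOp_apply, weylOp_apply, hA.apply_eq_integral, hc.apply_eq_integral,
      integral_wignerCLM_translationAverage hh ha hb u v w hw]

end Composition

/-! ### The remainder of the Moyal expansion -/

section Remainder

variable {n : ℕ} {ρ : ℝ}

/-- The remainder of the `N`-term Moyal expansion, divided by `h ^ (N * (1 - ρ))`. -/
def moyalRemainder (N : ℕ) (ρ : ℝ) (a b : ℝ → Phase n → ℂ) (h : ℝ) (z : Phase n) : ℂ :=
  ((h ^ ((N : ℝ) * (1 - ρ)) : ℝ) : ℂ)⁻¹ * ((Complex.I * h / 2) ^ N *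
    poissonIter (shiftedProduct (taylorMeasure N) (Real.pi * h)) N (a h) (b h) z)

/-- The factor `h ^ N` of the remainder is split into `h ^ (N (1 - ρ))` and the factor `(h ^ ρ) ^ N`
that pays for the `N` derivatives of `b`. -/
theorem symbolL1_moyalRemainder (hρ0 : 0 ≤ ρ) (hρ1 : ρ ≤ 1) {k N : ℕ} (hk : k ≤ N)
    {a b : ℝ → Phase n → ℂ} (ha : SymbolS k a) (hb : SymbolL1 ρ b) :
    SymbolL1 ρ (moyalRemainder N ρ a b) := by
  have h1 := SymbolL1.poissonIter_shiftedProduct hρ0 hρ1 (ae_taylorMeasure_mem_Icc N) N hk ha hb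
  refine (h1.smul (c := fun _ => (Complex.I / 2) ^ N) (fun _ _ => le_rfl)).congr fun h hh => ?_
  ext z
  have h0 := hh.1
  have hC : (h : ℂ) ≠ 0 := by exact_mod_cast h0.ne'
  have e : h ^ ((N : ℝ) * (1 - ρ)) * (h ^ ρ) ^ N = h ^ N := by
    rw [← Real.rpow_natCast (h ^ ρ), ← Real.rpow_mul h0.le, ← Real.rpow_add h0,
      ← Real.rpow_natCast h]
    congr 1
    ring
  have h2 : ((h ^ ((N : ℝ) * (1 - ρ)) : ℝ) : ℂ) ≠ 0 := by
    exact_mod_cast (Real.rpow_pos_of_pos h0 _).ne'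
  have e' : ((h ^ ((N : ℝ) * (1 - ρ)) : ℝ) : ℂ) * (((h ^ ρ) ^ N : ℝ) : ℂ) = (h : ℂ) ^ N := by
    rw [← Complex.ofReal_mul, e, Complex.ofReal_pow]
  simp only [moyalRemainder, Pi.smul_apply, smul_eq_mul]
  rw [eq_inv_mul_iff_mul_eq₀ h2, mul_div_right_comm, mul_pow _ (h : ℂ), ← e']
  ring

theorem shiftedProduct_dirac_one_eq_moyalSum_add_moyalRemainder (N : ℕ) {a b : ℝ → Phase n → ℂ}
    {h : ℝ} (h0 : 0 < h) (ha : (a h).HasTemperateGrowth) (hb : IntegrableDerivs (b h)) :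
    shiftedProduct (Measure.dirac 1) (Real.pi * h) (a h) (b h) = fun z =>
      moyalSum N h (a h) (b h) z +
        ((h ^ ((N : ℝ) * (1 - ρ)) : ℝ) : ℂ) * moyalRemainder N ρ a b h z := by
  ext z
  have h2 : ((h ^ ((N : ℝ) * (1 - ρ)) : ℝ) : ℂ) ≠ 0 := by
    exact_mod_cast (Real.rpow_pos_of_pos h0 _).ne'
  rw [moyalRemainder, mul_inv_cancel_left₀ h2, shiftedProduct_dirac_one_eq_moyalSum_add N h ha hb]

/-- A family of functions of temperate growth, as a family of tempered distributions. -/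
theorem exists_represents {f : ℝ → Phase n → ℂ}
    (hf : ∀ h ∈ Set.Ioc (0 : ℝ) 1, (f h).HasTemperateGrowth) :
    ∃ T : ℝ → 𝓢'(Phase n, ℂ), ∀ h ∈ Set.Ioc (0 : ℝ) 1, Represents (T h) (f h) := by
  have : ∀ h, ∃ T : 𝓢'(Phase n, ℂ), h ∈ Set.Ioc (0 : ℝ) 1 → Represents T (f h) := fun h => by
    by_cases hh : h ∈ Set.Ioc (0 : ℝ) 1
    · exact ⟨_, fun _ => ⟨hf h hh, rfl⟩⟩
    · exact ⟨0, fun hh' => absurd hh' hh⟩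
  choose T hT using this
  exact ⟨T, hT⟩

end Remainder

end Weyl

end

theorem mainTheorem7 (n k : ℕ) (ρ : ℝ) (hρ0 : 0 ≤ ρ) (hρ1 : ρ < 1)
    (a b : ℝ → Weyl.Phase n → ℂ) (ha : Weyl.SymbolS k a) (hb : Weyl.SymbolL1 ρ b) :
    ∃ A B c : ℝ → 𝓢'(Weyl.Phase n, ℂ),
      (∀ h ∈ Set.Ioc (0 : ℝ) 1,
        Weyl.Represents (A h) (a h) ∧ Weyl.Represents (B h) (b h)) ∧
      (∀ (h : ℝ) (hh : 0 < h), h ≤ 1 → ∀ u : 𝓢(Weyl.Config n, ℂ), ∃ w : 𝓢(Weyl.Config n, ℂ),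
        Weyl.weylOp hh (B h) u =
          SchwartzMap.toTemperedDistributionCLM (Weyl.Config n) ℂ volume w ∧
        Weyl.weylOp hh (A h) w = Weyl.weylOp hh (c h) u) ∧
      (∀ N : ℕ, k ≤ N → ∃ e : ℝ → Weyl.Phase n → ℂ, Weyl.SymbolL1 ρ e ∧
        ∀ h ∈ Set.Ioc (0 : ℝ) 1,
          Weyl.Represents (c h) (fun z =>
            Weyl.moyalSum N h (a h) (b h) z + ((h ^ ((N : ℝ) * (1 - ρ)) : ℝ) : ℂ) * e h z)) := by
  have hag := fun h hh => ha.hasTemperateGrowth (h := h) hh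
  have hbd := fun h hh => hb.integrableDerivs (h := h) hh
  obtain ⟨A, hA⟩ := Weyl.exists_represents hag
  obtain ⟨B, hB⟩ := Weyl.exists_represents fun h hh => (hbd h hh).hasTemperateGrowth
  obtain ⟨c, hc⟩ := Weyl.exists_represents fun h hh =>
    Weyl.hasTemperateGrowth_shiftedProduct (Weyl.ae_dirac_mem_Icc (x := 1) (by simp))
      (Real.pi * h) (hag h hh) (hbd h hh)
  refine ⟨A, B, c, fun h hh => ⟨hA h hh, hB h hh⟩, fun h hh hh1 u =>
    Weyl.weylOp_comp hh (hag h ⟨hh, hh1⟩) (hbd h ⟨hh, hh1⟩) (hA h ⟨hh, hh1⟩) (hB h ⟨hh, hh1⟩)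
      (hc h ⟨hh, hh1⟩) u, fun N hN => ⟨_, Weyl.symbolL1_moyalRemainder hρ0 hρ1.le hN ha hb,
    fun h hh => ?_⟩⟩
  rw [← Weyl.shiftedProduct_dirac_one_eq_moyalSum_add_moyalRemainder N hh.1 (hag h hh)
    (hbd h hh)]
  exact hc h hh
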